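/- Let $\varepsilon\in(0,1]$ with $\varepsilon^{-1}$ a power of $2$, let $h\in\{\tfrac12,\tfrac14,\tfrac18,\dots,\tfrac{\varepsilon^2}{64}\}$ (a scale), and put $\ell_{\max}=3/\varepsilon$, $\mathsf{limit}_h=6/h+1$, $\tau_{\max}(h)=72/(h\varepsilon)$, $\Delta_h=36/(h\varepsilon)$. Let $G$ be a finite simple graph and $M$ a matching of $G$; each edge is viewed as two arcs. A vertex is free if it has no incident edge of $M$. An $M$-augmenting path is a simple path, alternating between matched and unmatched edges, between two distinct free vertices. **A phase of scale $h$ started with $M$.** Every matched arc $a$ has a label $\ell(a)$, initially $\ell_{\max}+1$. Every free vertex $\alpha$ has a structure $S_\alpha=(G_\alpha,\Omega_\alpha,w'_\alpha)$: a subgraph $G_\alpha$ of $G$ given by arcs, a laminar set $\Omega_\alpha$ of blossoms, and a working vertex $w'_\alpha$ (possibly $\emptyset$). Initially $G_\alpha$ is the single vertex $\alpha$, $\Omega_\alpha=\{\{\alpha\}\}$ and $w'_\alpha=\{\alpha\}$. $\Omega(v)$ denotes the maximal blossom containing $v$ ($\{v\}$ if $v$ is in no structure). Contracting the maximal blossoms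 turns $G_\alpha$ into a tree $T'_\alpha$ rooted at $\Omega(\alpha)$, its arcs directed away from the root; a vertex of $T'_\alpha$ is inner if its depth is odd and outer otherwise. The basic operations, which mark the structures involved as modified, are: * *Augment* on an unmatched arc $(u,v)$ with $\Omega(u),\Omega(v)$ outer vertices of different structures $S_\alpha,S_\beta$: record an $M$-augmenting path from $\alpha$ to $\beta$ consisting of $\{u,v\}$ and edges of $G_\alpha$ and $G_\beta$ (a lift of the tree path through the blossoms); remove all vertices of both structures for the rest of the phase. * *Contract* on an unmatched arc $(u,v)$ with $\Omega(u)=w'_\alpha$ and $\Omega(v)\ne\Omega(u)$ an outer vertex of $T'_\alpha$: let $B$ be the union of the vertices of the cycle in $T'_\alpha\cup\{(\Omega(u),\Omega(v))\}$; add $(u,v)$ to $G_\alpha$ and $B$ to $\Omega_\alpha$, set the labels of all matched arcs inside $B$ to $0$, and set $w'_\alpha=B$. * *Overtake* of a matched arc $(v,t)$ by $S_\alpha$ through an unmatched arc $(u,v)$ with $\Omega(u)=w'_\alpha$, with value $k$: set $\ell((v,t))=k$. If $v$ is in no structure, add $(u,v)$ and $(v,t)$ to $S_\alpha$ and set $w'_\alpha=\Omega(t)$.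 Otherwise $v$ lies in some $S_\beta$ and there is an arc $(p,v)$ of $G_\beta$ from the parent $\Omega(p)$ of $\Omega(v)$; replace it by $(u,v)$, so that the subtree of $\Omega(v)$ (with its vertices, arcs and blossoms) becomes part of $S_\alpha$, hanging from $\Omega(u)$. If $\beta\neq\alpha$ and $w'_\beta$ was in the subtree of $\Omega(t)$, set $w'_\alpha$ to the old $w'_\beta$ and then $w'_\beta$ to $\Omega(p)$; otherwise set $w'_\alpha=\Omega(t)$. The phase consists of $\tau_{\max}(h)$ pass-bundles. Each first marks exactly the structures with at least $\mathsf{limit}_h$ vertices as on hold, and all structures as not modified. It then performs the following. 1. *Extend-Active-Path*: read all arcs $(u,v)$ of $G$, each once, in an arbitrary order. Skip $(u,v)$ if $u$ or $v$ is removed, $\Omega(u)=\Omega(v)$, $(u,v)$ is matched, $\Omega(u)$ is not the working vertex of a structure, or the structure $S_\alpha$ with working vertex $\Omega(u)$ is on hold or modified. Otherwise, if $\Omega(v)$ is outer, Contract or Augment, according to whether $\Omega(v)$ is in $S_\alpha$ or in another structure. If $\Omega(v)$ is not outer, let $(v,t)$ be the matched arc with tail $v$, and let $d=0$ if $\Omega(u)$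 contains a free vertex, and otherwise let $d$ be the label of the matched arc entering $\Omega(u)$ from outside; if $d+1<\ell((v,t))$, Overtake with value $d+1$. 2. *Contract-and-Augment*: perform Contract inside the structures, in any order, as long as it is applicable; then read all arcs of $G$, each once, in an arbitrary order, and Augment on every unmatched arc joining outer vertices of different structures. 3. *Backtrack*: in every structure that is neither on hold nor modified, replace a working vertex that is not the root by its grandparent in the tree, and the root by $\emptyset$. At the end of the phase all vertices are restored and $M$ is replaced by the symmetric difference $M'$ of $M$ and the edges of the recorded paths. **Lemma.** Let $\mathcal P^*$ be a maximum set of pairwise vertex-disjoint $M$-augmenting paths in $G$ each having at most $\ell_{\max}$ matched edges. Suppose that $|\mathcal P^*|\ge 4h\,\ell_{\max}\,|M|$. Then, whatever the orders in which the arcs are read and whatever choices are made, the phase of scale $h$ started with $M$ can be carried out, and every set $M'$ with which it can end is a matching of $G$ with $$|M'|\;\ge\;\Bigl(1+\frac{h\,\ell_{\max}}{\Delta_h}\Bigr)|M| .$$ -/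

import Mathlib

namespace MatchingPhase

/-! ### Parameters -/

/-- `ε ∈ (0, 1]` and `ε⁻¹` is a power of two. -/
def IsAccuracy (ε : ℝ) : Prop := 0 < ε ∧ ε ≤ 1 ∧ ∃ k : ℕ, ε⁻¹ = 2 ^ k

/-- The scales are `1/2, 1/4, 1/8, …, ε² / 64`. -/
def IsScale (ε h : ℝ) : Prop := (∃ j : ℕ, 1 ≤ j ∧ h = (1 / 2) ^ j) ∧ ε ^ 2 / 64 ≤ h

/-- `ℓ_max = 3 / ε`, an integer for the admissible values of `ε`. -/
noncomputable def ellMax (ε : ℝ) : ℕ := ⌊3 / ε⌋₊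

/-- The number `τ_max(h) = 72 / (h ε)` of pass-bundles of a phase, an integer for the admissible
values of `ε` and `h`. -/
noncomputable def tauMax (ε h : ℝ) : ℕ := ⌊72 / (h * ε)⌋₊

/-- `limit_h = 6 / h + 1`. -/
noncomputable def limitH (h : ℝ) : ℝ := 6 / h + 1

/-- `Δ_h = 36 / (h ε)`. -/
noncomputable def Delta (ε h : ℝ) : ℝ := 36 / (h * ε)

/-! ### Augmenting paths -/

variable {V : Type*} {G : SimpleGraph V}

/-- A vertex is free if it has no incident matched edge. -/
def Free (M : G.Subgraph) (v : V) : Prop := ∀ w, ¬ M.Adj v w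

/-- An augmenting path with respect to `M`: a simple path whose edges are alternately matched and
unmatched and whose endpoints are two (distinct) free vertices. -/
structure AugPath (M : G.Subgraph) where
  src : V
  tgt : V
  walk : G.Walk src tgt
  isPath : walk.IsPath
  alternating : walk.edges.IsChain (fun e f => e ∈ M.edgeSet ↔ f ∉ M.edgeSet)
  src_free : Free M src
  tgt_free : Free M tgt
  src_ne_tgt : src ≠ tgt

/-- `p` has at most `k` matched edges. -/
def AugPath.IsShort {M : G.Subgraph} (p : AugPath M) (k : ℕ) : Prop :=
  {e | e ∈ p.walk.edges ∧ e ∈ M.edgeSet}.ncard ≤ k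

/-- `Q` consists of pairwise vertex-disjoint augmenting paths with at most `k` matched edges. -/
def IsDisjointShort {M : G.Subgraph} (k : ℕ) (Q : Finset (AugPath M)) : Prop :=
  (∀ p ∈ Q, p.IsShort k) ∧
    ∀ p ∈ Q, ∀ q ∈ Q, p ≠ q → p.walk.support.Disjoint q.walk.support

/-- `Q` is a maximum set of disjoint augmenting paths with at most `k` matched edges. -/
def IsMaximumDisjointShort {M : G.Subgraph} (k : ℕ) (Q : Finset (AugPath M)) : Prop :=
  IsDisjointShort k Q ∧ ∀ R : Finset (AugPath M), IsDisjointShort k R → R.card ≤ Q.card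

/-- The matching obtained by augmenting `M` along the paths of `P`: its edge set is the symmetric
difference of the edge set of `M` and the set of edges of the paths in `P`. -/
def augment (M : G.Subgraph) (P : Set (AugPath M)) : G.Subgraph where
  verts := {x | ∃ y, G.Adj x y ∧ Xor (M.Adj x y) (∃ p ∈ P, s(x, y) ∈ p.walk.edges)}
  Adj x y := G.Adj x y ∧ Xor (M.Adj x y) (∃ p ∈ P, s(x, y) ∈ p.walk.edges)
  adj_sub h := h.1
  edge_vert h := ⟨_, h⟩
  symm := ⟨fun x y h => by rwa [G.adj_comm, M.adj_comm, Sym2.eq_swap]⟩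

/-! ### Structures and states -/

/-- The data `(G_α, Ω_α, w'_α)`: a subgraph given by its vertices and its (directed) arcs, a set of
blossoms (given by their vertex sets, the edges of a blossom `B` being the arcs of the structure
inside `B`), and the working vertex, a root blossom or `none`. -/
structure Struct (V : Type*) where
  verts : Set V
  arcs : Set (V × V)
  blossoms : Set (Set V)
  working : Option (Set V)

/-- The structure without vertices: the one of non-free vertices and of removed free vertices. -/
def Struct.empty : Struct V := ⟨∅, ∅, ∅, none⟩

/-- The structure consisting of the single vertex `α`. -/
def Struct.single (α : V) : Struct V := ⟨{α}, ∅, {{α}}, some {α}⟩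

/-- The data maintained during a phase. -/
structure State (M : G.Subgraph) where
  /-- the vertices removed so far -/
  removed : Set V
  /-- the label of the arc `(x, y)`; only the labels of matched arcs are ever used -/
  label : V → V → ℕ
  /-- the structure of each free vertex -/
  struct : V → Struct V
  /-- the free vertices whose structure is marked as on hold -/
  onHold : Set V
  /-- the free vertices whose structure is marked as modified -/
  modified : Set V
  /-- the augmenting paths found so far -/
  paths : Set (AugPath M)

variable {M : G.Subgraph}

/-- `Ω(v)`: the root blossom containing `v`, that is, the union of the trivial blossom `{v}` and
of all blossoms of the structures that contain `v` (the blossoms form a laminar family). -/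
def State.Om (s : State M) (v : V) : Set V :=
  {v} ∪ ⋃₀ {B | v ∈ B ∧ ∃ α, B ∈ (s.struct α).blossoms}

/-- The arcs, directed from parent to child, of the alternating tree `T'_α = G_α / Ω_α`. -/
def State.TArc (s : State M) (α : V) (X Y : Set V) : Prop :=
  X ≠ Y ∧ ∃ x y, (x, y) ∈ (s.struct α).arcs ∧ s.Om x = X ∧ s.Om y = Y

/-- `Y` is reached from `X` by a directed path with `n` arcs in the relation `T`. -/
inductive DirPath {B : Type*} (T : B → B → Prop) : B → B → ℕ → Prop
  | nil (X : B) : DirPath T X X 0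
  | snoc {X Y Z : B} {n : ℕ} : DirPath T X Y n → T Y Z → DirPath T X Z (n + 1)

/-- `Ω(v)` is an inner vertex of `T'_α`: the path from the root `Ω(α)` to it has odd length. -/
def State.Inner (s : State M) (α v : V) : Prop :=
  v ∈ (s.struct α).verts ∧ ∃ n, Odd n ∧ DirPath (s.TArc α) (s.Om α) (s.Om v) n

/-- `Ω(v)` is an outer vertex of `T'_α`. -/
def State.Outer (s : State M) (α v : V) : Prop :=
  v ∈ (s.struct α).verts ∧ ¬ s.Inner α v

/-- `Y` lies in the subtree of `T'_β` rooted at `X`. -/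
def State.InSubtree (s : State M) (β : V) (X Y : Set V) : Prop :=
  Relation.ReflTransGen (s.TArc β) X Y

/-! ### Basic operations -/

open Classical in
/-- The operation Augment on the arc `(u, v)`, where `Ω(u)` and `Ω(v)` are outer vertices of the
structures of `α` and `β`: an augmenting path from `α` to `β` that uses `(u, v)` and otherwise only
tree and blossom arcs of the two structures is recorded, and both structures are removed. -/
def AugmentOp (s : State M) (α β u v : V) (s' : State M) : Prop :=
  ∃ p : AugPath M, p.src = α ∧ p.tgt = β ∧
    (∀ e ∈ p.walk.edges, e = s(u, v) ∨
      ∃ x y, ((x, y) ∈ (s.struct α).arcs ∨ (x, y) ∈ (s.struct β).arcs) ∧ e = s(x, y)) ∧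
    s' = { s with
      removed := s.removed ∪ ((s.struct α).verts ∪ (s.struct β).verts)
      struct := fun γ => if γ = α ∨ γ = β then Struct.empty else s.struct γ
      modified := s.modified ∪ {α, β}
      paths := insert p s.paths }

open Classical in
/-- The operation Contract on the arc `(u, v)` inside the structure of `α`. The new blossom `B` is
the union of the vertices of the cycle that `(Ω(u), Ω(v))` closes in `T'_α`; this cycle consists of
two directed tree paths that start at a common vertex `C`, end at `Ω(u)` and at `Ω(v)`, and are
disjoint except for `C`. -/
def ContractOp (s : State M) (α u v : V) (s' : State M) : Prop :=
  ∃ (C : Set V) (l₁ l₂ : List (Set V)) (B : Set V),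
    (C :: l₁).IsChain (s.TArc α) ∧ (C :: l₁).getLast? = some (s.Om u) ∧
    (C :: l₂).IsChain (s.TArc α) ∧ (C :: l₂).getLast? = some (s.Om v) ∧
    l₁.Disjoint l₂ ∧
    B = {x | ∃ X ∈ C :: (l₁ ++ l₂), x ∈ X} ∧
    s' = { s with
      label := fun x y => if M.Adj x y ∧ x ∈ B ∧ y ∈ B then 0 else s.label x y
      struct := fun γ => if γ = α then
          { verts := (s.struct α).verts
            arcs := insert (u, v) (s.struct α).arcs
            blossoms := insert B (s.struct α).blossoms
            working := some B }
        else s.struct γ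
      modified := insert α s.modified }

/-- The vertices `x` such that `Ω(x)` is in the subtree of `Ω(v)` in `T'_β`. -/
def State.moved (s : State M) (β v : V) : Set V :=
  {x | x ∈ (s.struct β).verts ∧ s.InSubtree β (s.Om v) (s.Om x)}

open Classical in
/-- The label function after the label of the arc `(v, t)` has been set to `k`. -/
noncomputable def State.setLabel (s : State M) (v t : V) (k : ℕ) : V → V → ℕ :=
  fun x y => if x = v ∧ y = t then k else s.label x y

open Classical in
/-- The operation Overtake, by which the structure of `α` overtakes the matched arc `(v, t)` via the
unmatched arc `(u, v)` and sets the label of `(v, t)` to `k`. -/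
inductive OvertakeOp (s : State M) (α u v t : V) (k : ℕ) : State M → Prop
  /-- `(v, t)` is in no structure. -/
  | unvisited (hv : ∀ β, v ∉ (s.struct β).verts) :
      OvertakeOp s α u v t k { s with
        label := s.setLabel v t k
        struct := fun γ => if γ = α then
            { verts := (s.struct α).verts ∪ {v, t}
              arcs := (s.struct α).arcs ∪ {(u, v), (v, t)}
              blossoms := (s.struct α).blossoms ∪ {{v}, {t}}
              working := some (s.Om t) }
          else s.struct γ
        modified := insert α s.modified }
  /-- `(v, t)` is in the structure of `α`; `Ω(p)` is the parent of `Ω(v)`. -/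
  | same (hv : v ∈ (s.struct α).verts) (p : V) (hp : (p, v) ∈ (s.struct α).arcs)
      (hpv : s.Om p ≠ s.Om v) :
      OvertakeOp s α u v t k { s with
        label := s.setLabel v t k
        struct := fun γ => if γ = α then
            { verts := (s.struct α).verts
              arcs := ((s.struct α).arcs \ {(p, v)}) ∪ {(u, v)}
              blossoms := (s.struct α).blossoms
              working := some (s.Om t) }
          else s.struct γ
        modified := insert α s.modified }
  /-- `(v, t)` is in the structure of `β ≠ α`; `Ω(p)` is the parent of `Ω(v)`. The subtree of `Ω(v)`
  is moved from the structure of `β` to the structure of `α`. -/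
  | other (β : V) (hβ : β ≠ α) (hv : v ∈ (s.struct β).verts) (p : V)
      (hp : (p, v) ∈ (s.struct β).arcs) (hpv : s.Om p ≠ s.Om v) :
      OvertakeOp s α u v t k { s with
        label := s.setLabel v t k
        struct := fun γ =>
          if γ = α then
            { verts := (s.struct α).verts ∪ s.moved β v
              arcs := (s.struct α).arcs ∪ {(u, v)} ∪
                {e | e ∈ (s.struct β).arcs ∧ e.1 ∈ s.moved β v ∧ e.2 ∈ s.moved β v}
              blossoms := (s.struct α).blossoms ∪
                {B | B ∈ (s.struct β).blossoms ∧ B ⊆ s.moved β v}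
              working :=
                if ∃ W, (s.struct β).working = some W ∧ s.InSubtree β (s.Om t) W
                then (s.struct β).working else some (s.Om t) }
          else if γ = β then
            { verts := (s.struct β).verts \ s.moved β v
              arcs := {e | e ∈ (s.struct β).arcs ∧ e ≠ (p, v) ∧
                ¬ (e.1 ∈ s.moved β v ∧ e.2 ∈ s.moved β v)}
              blossoms := {B | B ∈ (s.struct β).blossoms ∧ ¬ B ⊆ s.moved β v}
              working :=
                if ∃ W, (s.struct β).working = some W ∧ s.InSubtree β (s.Om t) W
                then some (s.Om p) else (s.struct β).working }
          else s.struct γ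
        modified := s.modified ∪ {α, β} }

/-! ### The procedures of a pass-bundle -/

/-- A list is an admissible stream if it contains every arc of `G` exactly once, in any order. -/
def IsStream (G : SimpleGraph V) (L : List (V × V)) : Prop :=
  L.Nodup ∧ ∀ u v, (u, v) ∈ L ↔ G.Adj u v

/-- Executing a (possibly nondeterministic) step for every arc of a stream, one after the other. -/
inductive Scan (R : State M → V × V → State M → Prop) :
    List (V × V) → State M → State M → Prop
  | nil (s : State M) : Scan R [] s s
  | cons {g : V × V} {L : List (V × V)} {s s₁ s₂ : State M} :
      R s g s₁ → Scan R L s₁ s₂ → Scan R (g :: L) s s₂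

/-- The arc `(u, v)` is not skipped by Extend-Active-Path, and `Ω(u)` is the working vertex of the
structure of `α`. -/
def State.Eligible (s : State M) (α u v : V) : Prop :=
  u ∉ s.removed ∧ v ∉ s.removed ∧ s.Om u ≠ s.Om v ∧ (s.struct α).working = some (s.Om u) ∧
    ¬ M.Adj u v ∧ α ∉ s.modified ∧ α ∉ s.onHold

/-- `distance(u) = d`: it is `0` if `Ω(u)` contains a free vertex, and otherwise the label of the
matched arc whose head is `Ω(u)` in the contracted graph. -/
def State.Distance (s : State M) (u : V) (d : ℕ) : Prop :=
  ((∃ x ∈ s.Om u, Free M x) ∧ d = 0) ∨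
    ((∀ x ∈ s.Om u, ¬ Free M x) ∧
      ∃ x y, M.Adj x y ∧ x ∉ s.Om u ∧ y ∈ s.Om u ∧ d = s.label x y)

/-- The treatment of one arc of the stream by Extend-Active-Path. -/
inductive ExtendStep (s : State M) : V × V → State M → Prop
  | skip (u v : V) : (∀ α, ¬ s.Eligible α u v) → ExtendStep s (u, v) s
  | contract (α u v : V) (s' : State M) : s.Eligible α u v → s.Outer α v →
      ContractOp s α u v s' → ExtendStep s (u, v) s'
  | augment (α β u v : V) (s' : State M) : s.Eligible α u v → β ≠ α → s.Outer β v →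
      AugmentOp s α β u v s' → ExtendStep s (u, v) s'
  | overtake (α u v t : V) (d : ℕ) (s' : State M) : s.Eligible α u v → (∀ β, ¬ s.Outer β v) →
      s.Distance u d → M.Adj v t → d + 1 < s.label v t → OvertakeOp s α u v t (d + 1) s' →
      ExtendStep s (u, v) s'
  | noOvertake (α u v t : V) (d : ℕ) : s.Eligible α u v → (∀ β, ¬ s.Outer β v) →
      s.Distance u d → M.Adj v t → s.label v t ≤ d + 1 → ExtendStep s (u, v) s

/-- The unmatched arc `(u, v)` of `G` joins two vertices of the structure of `α`, `Ω(u)` is its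
working vertex and `Ω(v) ≠ Ω(u)` is an outer vertex. -/
def State.Contractible (s : State M) (α u v : V) : Prop :=
  G.Adj u v ∧ ¬ M.Adj u v ∧ u ∈ (s.struct α).verts ∧ v ∈ (s.struct α).verts ∧
    (s.struct α).working = some (s.Om u) ∧ s.Om v ≠ s.Om u ∧ s.Outer α v

/-- Step 1 of Contract-and-Augment: contract as long as possible, in any order. -/
def ContractAll (s s' : State M) : Prop :=
  Relation.ReflTransGen
      (fun s₁ s₂ : State M => ∃ α u v, s₁.Contractible α u v ∧ ContractOp s₁ α u v s₂) s s' ∧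
    ∀ α u v, ¬ s'.Contractible α u v

/-- The unmatched arc `(u, v)` joins outer vertices of the different structures of `α` and `β`. -/
def State.Joins (s : State M) (α β u v : V) : Prop :=
  ¬ M.Adj u v ∧ α ≠ β ∧ s.Outer α u ∧ s.Outer β v

/-- The treatment of one arc of the stream by Step 2 of Contract-and-Augment. -/
inductive JoinStep (s : State M) : V × V → State M → Prop
  | skip (u v : V) : (∀ α β, ¬ s.Joins α β u v) → JoinStep s (u, v) s
  | augment (α β u v : V) (s' : State M) : s.Joins α β u v → AugmentOp s α β u v s' →
      JoinStep s (u, v) s'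

/-- The working vertex `w` of the structure of `α` after Backtrack-Stuck-Structures. -/
inductive BacktrackTo (s : State M) (α : V) : Option (Set V) → Prop
  | keep : α ∈ s.onHold ∨ α ∈ s.modified ∨ (s.struct α).working = none →
      BacktrackTo s α (s.struct α).working
  | root : α ∉ s.onHold → α ∉ s.modified → (s.struct α).working = some (s.Om α) →
      BacktrackTo s α none
  | grandparent (X Y Z : Set V) : α ∉ s.onHold → α ∉ s.modified →
      (s.struct α).working = some Z → Z ≠ s.Om α → s.TArc α X Y → s.TArc α Y Z →
      BacktrackTo s α (some X)

/-- The procedure Backtrack-Stuck-Structures. -/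
def Backtrack (s s' : State M) : Prop :=
  ∃ w : V → Option (Set V), (∀ α, BacktrackTo s α (w α)) ∧
    s' = { s with struct := fun α => { s.struct α with working := w α } }

/-- The marks at the beginning of a pass-bundle. -/
def State.mark (s : State M) (h : ℝ) : State M :=
  { s with
    onHold := {α | limitH h ≤ ((s.struct α).verts.ncard : ℝ)}
    modified := ∅ }

/-- A pass-bundle of scale `h`, in which Extend-Active-Path reads the stream in the order `L₁` and
Step 2 of Contract-and-Augment reads it in the order `L₂`. -/
def PassBundle (h : ℝ) (L₁ L₂ : List (V × V)) (s s' : State M) : Prop :=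
  ∃ s₁ s₂ s₃ : State M, Scan ExtendStep L₁ (s.mark h) s₁ ∧ ContractAll s₁ s₂ ∧
    Scan JoinStep L₂ s₂ s₃ ∧ Backtrack s₃ s'

/-! ### A phase -/

open Classical in
/-- The state at the beginning of a phase. -/
noncomputable def initState (M : G.Subgraph) (ε : ℝ) : State M where
  removed := ∅
  label := fun _ _ => ellMax ε + 1
  struct := fun α => if Free M α then Struct.single α else Struct.empty
  onHold := ∅
  modified := ∅
  paths := ∅

/-- `M'` is a possible matching at the end of a phase of scale `h` that starts with the matching
`M`; in the pass-bundle number `τ` the stream is read in the orders `L₁ τ` and `L₂ τ`. -/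
def PhaseResult (M : G.Subgraph) (ε h : ℝ) (L₁ L₂ : ℕ → List (V × V)) (M' : G.Subgraph) : Prop :=
  ∃ st : ℕ → State M, st 0 = initState M ε ∧
    (∀ τ < tauMax ε h, PassBundle h (L₁ τ) (L₂ τ) (st τ) (st (τ + 1))) ∧
    M' = augment M (st (tauMax ε h)).paths

end MatchingPhase

/-! All structures are merged into one forest, together with a set `I` of inner vertices that is
carried along and proved to consist of the vertices of odd depth (`Inv.inner_iff`). The invariants
`Forest.OK` say in particular that the label of a tree arc `(v, t)` exceeds the distance of the
parent of `v`; it is also the distance of `t`. Hence a rank grows strictly along tree arcs. An outer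
blossom has a single base, from which even alternating paths inside the blossom lead to all its
vertices. By the rank, Overtake never hangs a subtree below itself; by the alternating paths,
Augment always finds its path. So no operation can get stuck.

Activity. A structure is active while it has a working vertex, and a matched tree arc is critical if
it lies on the tree path to a working vertex. The potential is three times the sum of all labels
plus the number of critical arcs. Overtake and Contract lower a label, create at most one critical
arc and mark at most two structures. Backtracking takes a critical arc from each structure that
stays active without being modified or on hold. So a pass-bundle lowers the potential by at least
the number of structures that are active afterwards and were not on hold (`Boundary.passBundle`). At
most `h|M|/3` structures are on hold (`Inv.onHold_le`), and the initial potential is at most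
`6|M|(ℓ+1)`. After `72/(hε)` pass-bundles at most `(2/3)h|M|` structures are active, each with at
most `ℓ` critical arcs (`Inv.crit_le`).

Blocking. Every augmenting path with at most `ℓ` matched edges meets a removed vertex, the tail of a
critical arc or the root of an active structure (`Boundary.hits`). This rests on two facts at the
end of a pass-bundle: no arc leaving an inactive outer vertex admits an overtaking
(`State.Settled`), and no unmatched edge joins different outer blossoms (`State.Closed`). Counting
the disjoint paths of the given family yields at least `3hℓ|M|` removed vertices.

Sizes. Only structures with fewer than `limit_h` vertices overtake, and each overtaking lowers a
label; therefore a structure has at most `(ℓ+1) limit_h` vertices (`Size`) and a recorded path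
removes at most twice as many. So at least `h²|M|/6` disjoint paths are recorded, and each adds one
edge to the matching (`ncard_augment`). The required gain is `h²|M|/12`. -/

namespace MatchingPhase

variable {V : Type*} {G : SimpleGraph V} {M : G.Subgraph}

/-! ### Even alternating paths -/

/-- There is a simple alternating path of even length from `b` to `y` with vertex set `S` whose
edges come from `A`; it starts with an unmatched and ends with a matched edge. -/
inductive AltPath (M : G.Subgraph) (A : V → V → Prop) : V → V → Set V → Prop
  | nil (b : V) : AltPath M A b b {b}
  | snoc {b u v t : V} {S : Set V} : AltPath M A b u S → (A u v ∨ A v u) → ¬ M.Adj u v →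
      M.Adj v t → (A v t ∨ A t v) → v ∉ S → t ∉ S → AltPath M A b t (S ∪ {v, t})

namespace AltPath

variable {A A' : V → V → Prop} {b u v t w y : V} {S S' : Set V}

theorem left_mem (h : AltPath M A b y S) : b ∈ S := by
  induction h with
  | nil => rfl
  | snoc _ _ _ _ _ _ _ ih => exact Or.inl ih

theorem right_mem (h : AltPath M A b y S) : y ∈ S := by
  cases h with
  | nil => rfl
  | snoc => simp

/-- Only arcs between vertices of the path matter, so changes of the forest elsewhere leave the path
intact. -/
theorem mono (h : AltPath M A b y S) (hA : ∀ x ∈ S, ∀ z ∈ S, A x z → A' x z) :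
    AltPath M A' b y S := by
  induction h with
  | nil => exact .nil _
  | snoc h1 h2 h3 h4 h5 h6 h7 ih =>
    have hu := h1.right_mem
    refine .snoc (ih fun x hx z hz => hA x (Or.inl hx) z (Or.inl hz)) ?_ h3 h4 ?_ h6 h7
    · exact h2.imp (hA _ (Or.inl hu) _ (by simp)) (hA _ (by simp) _ (Or.inl hu))
    · exact h5.imp (hA _ (by simp) _ (by simp)) (hA _ (by simp) _ (by simp))

/-- The matched edges of the path pair up all vertices but the first. Inside a blossom this shows
that only the base can be matched to the outside. -/
theorem mate_mem (h : AltPath M A b y S) {x : V} (hx : x ∈ S) (hxb : x ≠ b) :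
    ∃ z ∈ S, M.Adj x z := by
  induction h with
  | nil => exact absurd hx hxb
  | snoc h1 h2 h3 h4 h5 h6 h7 ih =>
    rcases hx with hx | rfl | rfl
    · obtain ⟨z, hz, hm⟩ := ih hx
      exact ⟨z, Or.inl hz, hm⟩
    · exact ⟨_, by simp, h4⟩
    · exact ⟨_, by simp, h4.symm⟩

/-- Concatenation across one inner vertex `v`, used to descend from one outer blossom to the next.
-/
theorem trans (h : AltPath M A b u S) (huv : A u v ∨ A v u) (hn : ¬ M.Adj u v)
    (hvt : M.Adj v t) (ha : A v t ∨ A t v) (h' : AltPath M A t y S') (hv : v ∉ S) (hv' : v ∉ S')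
    (hd : Disjoint S S') : AltPath M A b y (S ∪ insert v S') := by
  induction h' with
  | nil =>
    exact h.snoc huv hn hvt ha hv (fun h => Set.disjoint_left.1 hd h rfl)
  | @snoc u₁ v₁ t₁ S₁ h1 h2 h3 h4 h5 h6 h7 ih =>
    have hd1 : Disjoint S S₁ := hd.mono_right Set.subset_union_left
    have := ih (fun h => hv' (Or.inl h)) hd1
    have e : S ∪ insert v (S₁ ∪ {v₁, t₁}) = (S ∪ insert v S₁) ∪ {v₁, t₁} := by
      ext z; simp only [Set.mem_union, Set.mem_insert_iff, Set.mem_singleton_iff]; grind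
    rw [e]
    refine this.snoc h2 h3 h4 h5 ?_ ?_
    · rintro (h | rfl | h)
      · exact Set.disjoint_left.1 hd h (by simp)
      · exact hv' (by simp)
      · exact h6 h
    · rintro (h | rfl | h)
      · exact Set.disjoint_left.1 hd h (by simp)
      · exact hv' (by simp)
      · exact h7 h

/-- An even alternating path to `w`, an unmatched edge from `w` to `u`, an even alternating path
from `t` to `u` traversed backwards, and a matched edge from `t` to `v`. -/
theorem turn (h' : AltPath M A t u S') (h : AltPath M A b w S) (hwu : A w u ∨ A u w)
    (hn : ¬ M.Adj w u) (htv : M.Adj t v) (ha : A t v ∨ A v t) (hv : v ∉ S) (hv' : v ∉ S')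
    (hd : Disjoint S S') : AltPath M A b v (S ∪ insert v S') := by
  induction h' generalizing w b S with
  | nil =>
    have := h.snoc hwu hn htv ha (fun h => Set.disjoint_left.1 hd h rfl) hv
    rwa [Set.pair_comm] at this
  | @snoc u₁ v₁ t₁ S₁ h1 h2 h3 h4 h5 h6 h7 ih =>
    have a1 : v₁ ∉ S := fun h => Set.disjoint_left.1 hd h (by simp)
    have a2 : t₁ ∉ S := fun h => Set.disjoint_left.1 hd h (by simp)
    have := h.snoc hwu hn h4.symm h5.symm a2 a1
    have := ih this h2.symm (fun h => h3 h.symm) ?_ (fun h => hv' (Or.inl h)) ?_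
    · have e : S ∪ insert v (S₁ ∪ {v₁, t₁}) = (S ∪ {t₁, v₁}) ∪ insert v S₁ := by
        ext z; simp only [Set.mem_union, Set.mem_insert_iff, Set.mem_singleton_iff]; grind
      rwa [e]
    · rintro (h | rfl | rfl)
      · exact hv h
      · exact hv' (by simp)
      · exact hv' (by simp)
    · rw [Set.disjoint_union_left]
      refine ⟨hd.mono_right Set.subset_union_left, ?_⟩
      rw [Set.disjoint_left]
      rintro x (rfl | rfl)
      · exact h7
      · exact h6

/-- That the last edge is matched is part of the induction, because the next edge to be appended is
unmatched. -/
theorem exists_walk (h : AltPath M A b y S) (hA : ∀ x z, A x z → G.Adj x z) :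
    ∃ w : G.Walk b y, w.IsPath ∧ (∀ x, x ∈ w.support ↔ x ∈ S) ∧
      w.edges.IsChain (fun e f => e ∈ M.edgeSet ↔ f ∉ M.edgeSet) ∧
      (∀ e ∈ w.edges, ∃ x z, A x z ∧ e = s(x, z)) ∧
      (∀ e ∈ w.edges.getLast?, e ∈ M.edgeSet) := by
  induction h with
  | nil => exact ⟨.nil, by simp⟩
  | @snoc u v t S h1 h2 h3 h4 h5 h6 h7 ih =>
    obtain ⟨w, hw, hS, hc, he, hl⟩ := ih
    have e1 : G.Adj u v := h2.elim (hA _ _) fun h => (hA _ _ h).symm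
    have e2 : G.Adj v t := h4.adj_sub
    refine ⟨(w.concat e1).concat e2, ?_, ?_, ?_, ?_, ?_⟩
    · refine (hw.concat (by rwa [hS]) e1).concat ?_ e2
      simp only [SimpleGraph.Walk.support_concat, List.mem_append, hS, List.mem_singleton]
      rintro (h | rfl)
      · exact h7 h
      · exact h4.ne rfl
    · intro x
      simp only [SimpleGraph.Walk.support_concat, List.mem_append, hS, List.mem_singleton,
        Set.mem_union, Set.mem_insert_iff, Set.mem_singleton_iff, or_assoc]
    · simp only [SimpleGraph.Walk.edges_concat, List.concat_eq_append, List.append_assoc]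
      rw [List.isChain_append]
      refine ⟨hc, by simp [h3, h4], ?_⟩
      intro x hx y hy
      simp at hy
      subst hy
      simp [hl x hx, h3]
    · intro e h
      simp only [SimpleGraph.Walk.edges_concat, List.concat_eq_append, List.mem_append, List.mem_singleton, or_assoc] at h
      rcases h with h | rfl | rfl
      · exact he e h
      · rcases h2 with h2 | h2
        · exact ⟨_, _, h2, rfl⟩
        · exact ⟨_, _, h2, Sym2.eq_swap⟩
      · rcases h5 with h2 | h2
        · exact ⟨_, _, h2, rfl⟩
        · exact ⟨_, _, h2, Sym2.eq_swap⟩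
    · simp [SimpleGraph.Walk.edges_concat, h4]

/-- Two disjoint even alternating paths that start at free vertices and whose ends are joined by an
unmatched edge form an augmenting path. -/
theorem exists_augPath {B : V → V → Prop} {a c : V} (h : AltPath M A a u S)
    (h' : AltPath M B c v S') (hA : ∀ x z, A x z → G.Adj x z) (hB : ∀ x z, B x z → G.Adj x z)
    (huv : G.Adj u v) (hn : ¬ M.Adj u v) (ha : Free M a) (hc : Free M c) (hd : Disjoint S S') :
    ∃ p : AugPath M, p.src = a ∧ p.tgt = c ∧
      ∀ e ∈ p.walk.edges, e = s(u, v) ∨ ∃ x z, (A x z ∨ B x z) ∧ e = s(x, z) := by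
  obtain ⟨w, hw, hS, hch, he, hl⟩ := h.exists_walk hA
  obtain ⟨w', hw', hS', hch', he', hl'⟩ := h'.exists_walk hB
  refine ⟨⟨a, c, w.append (.cons huv w'.reverse), ?_, ?_, ha, hc, ?_⟩, rfl, rfl, ?_⟩
  · rw [SimpleGraph.Walk.isPath_def, SimpleGraph.Walk.support_append]
    simp only [SimpleGraph.Walk.support_cons, List.tail_cons, SimpleGraph.Walk.support_reverse]
    refine List.Nodup.append hw.support_nodup (List.nodup_reverse.2 hw'.support_nodup) ?_
    intro x hx hx'
    rw [List.mem_reverse, hS'] at hx'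
    exact Set.disjoint_left.1 hd ((hS x).1 hx) hx'
  · simp only [SimpleGraph.Walk.edges_append, SimpleGraph.Walk.edges_cons,
      SimpleGraph.Walk.edges_reverse]
    rw [List.isChain_append]
    refine ⟨hch, ?_, ?_⟩
    · rw [List.isChain_cons]
      constructor
      · intro e he2
        rw [List.head?_reverse] at he2
        simp [hl' e he2, hn]
      · rw [List.isChain_reverse]
        exact hch'.imp fun {e f} h => by tauto
    · intro x hx y hy
      simp at hy
      subst hy
      simp [hl x hx, hn]
  · rintro rfl
    exact Set.disjoint_left.1 hd h.left_mem h'.left_mem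
  · intro e h
    simp only [SimpleGraph.Walk.edges_append, SimpleGraph.Walk.edges_cons, List.mem_append,
      SimpleGraph.Walk.edges_reverse, List.mem_cons, List.mem_reverse] at h
    rcases h with h | h | h
    · obtain ⟨x, z, h1, h2⟩ := he e h
      exact Or.inr ⟨x, z, Or.inl h1, h2⟩
    · exact Or.inl h
    · obtain ⟨x, z, h1, h2⟩ := he' e h
      exact Or.inr ⟨x, z, Or.inr h1, h2⟩

end AltPath
end MatchingPhase

namespace MatchingPhase

variable {V : Type*} {G : SimpleGraph V} {M : G.Subgraph}

/-! ### The forest of all structures -/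

/-- The union of all structures of a state: root blossoms, arcs, inner vertices, visited vertices,
labels, and the vertices in working blossoms. -/
@[ext]
structure Forest (V : Type*) where
  om : V → Set V
  arc : V → V → Prop
  inner : Set V
  vis : Set V
  label : V → V → ℕ
  work : Set V

/-- The label of the matched arc that enters `X`, or `0` if there is none. -/
noncomputable def distOf (M : G.Subgraph) (label : V → V → ℕ) (X : Set V) : ℕ :=
  sSup {k | ∃ m c, M.Adj m c ∧ c ∈ X ∧ m ∉ X ∧ k = label m c}

theorem distOf_eq {label : V → V → ℕ} {X : Set V} {m c : V} (h : M.Adj m c) (hc : c ∈ X)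
    (hm : m ∉ X) (hu : ∀ m' c', M.Adj m' c' → c' ∈ X → m' ∉ X → m' = m ∧ c' = c) :
    distOf M label X = label m c := by
  have : {k | ∃ m c, M.Adj m c ∧ c ∈ X ∧ m ∉ X ∧ k = label m c} = {label m c} := by
    ext k
    constructor
    · rintro ⟨m', c', h1, h2, h3, rfl⟩
      obtain ⟨rfl, rfl⟩ := hu m' c' h1 h2 h3
      rfl
    · rintro rfl
      exact ⟨m, c, h, hc, hm, rfl⟩
  rw [distOf, this, csSup_singleton]

/-- The supremum of the empty set in `ℕ` is `0`, which is the value wanted for the blossom of a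
root. -/
theorem distOf_eq_zero {label : V → V → ℕ} {X : Set V}
    (h : ∀ m c, M.Adj m c → c ∈ X → m ∈ X) : distOf M label X = 0 := by
  have : {k | ∃ m c, M.Adj m c ∧ c ∈ X ∧ m ∉ X ∧ k = label m c} = ∅ := by
    rw [Set.eq_empty_iff_forall_notMem]
    rintro k ⟨m', c', h1, h2, h3, rfl⟩
    exact h3 (h m' c' h1 h2)
  rw [distOf, this, csSup_empty]; rfl

theorem distOf_congr {l l' : V → V → ℕ} {X : Set V}
    (h : ∀ m c, M.Adj m c → c ∈ X → m ∉ X → l m c = l' m c) : distOf M l X = distOf M l' X := by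
  unfold distOf
  congr 1
  ext k
  constructor
  · rintro ⟨m, c, h1, h2, h3, rfl⟩
    exact ⟨m, c, h1, h2, h3, h m c h1 h2 h3⟩
  · rintro ⟨m, c, h1, h2, h3, rfl⟩
    exact ⟨m, c, h1, h2, h3, (h m c h1 h2 h3).symm⟩

namespace Forest

variable {F : Forest V} {ℓ : ℕ}

/-- The visited vertices in outer blossoms. -/
def outer (F : Forest V) : Set V := F.vis \ F.inner

/-- `distance` of the blossom of `x`. -/
noncomputable def dist (M : G.Subgraph) (F : Forest V) (x : V) : ℕ := distOf M F.label (F.om x)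

/-- One step downwards in the contracted forest, or inside a blossom. -/
def Step (F : Forest V) (x y : V) : Prop := F.om x = F.om y ∨ F.arc x y

/-- The blossom of `x` is an ancestor of the blossom of `y`. -/
def Anc (F : Forest V) : V → V → Prop := Relation.ReflTransGen F.Step

/-- The blossom of `x` is an ancestor of a working blossom. -/
def Act (F : Forest V) (x : V) : Prop := ∃ w ∈ F.work, F.Anc x w

/-- The critical arcs: the matched arcs of the active paths. -/
def crit (M : G.Subgraph) (F : Forest V) : Set (V × V) :=
  {e | M.Adj e.1 e.2 ∧ e.1 ∈ F.inner ∧ F.Act e.2}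

/-- The vertices of the subtree of `v`. -/
def sub (F : Forest V) (v : V) : Set V := {x | F.Anc v x}

/-- The structural invariants of a forest. -/
structure OK (M : G.Subgraph) (ℓ : ℕ) (F : Forest V) : Prop where
  matching : M.IsMatching
  mem_om : ∀ x, x ∈ F.om x
  om_eq : ∀ {x y}, y ∈ F.om x → F.om y = F.om x
  om_vis : ∀ {x y}, x ∈ F.vis → y ∈ F.om x → y ∈ F.vis
  arc_vis : ∀ {x y}, F.arc x y → x ∈ F.vis ∧ y ∈ F.vis
  arc_adj : ∀ {x y}, F.arc x y → G.Adj x y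
  inner_vis : F.inner ⊆ F.vis
  inner_om : ∀ {v}, v ∈ F.inner → F.om v = {v}
  inner_parent : ∀ {v}, v ∈ F.inner → ∃ p, F.arc p v
  inner_child : ∀ {v}, v ∈ F.inner → ∃ t, M.Adj v t ∧ F.arc v t
  arc_unique : ∀ {v p q}, v ∈ F.inner → F.arc p v → F.arc q v → p = q
  label_lt : ∀ {v p t}, v ∈ F.inner → F.arc p v → M.Adj v t →
    F.dist M p < F.label v t ∧ F.label v t ≤ ℓ
  crossing : ∀ {x y}, F.arc x y → F.om x ≠ F.om y →
    (x ∉ F.inner ∧ y ∈ F.inner ∧ ¬ M.Adj x y) ∨ (x ∈ F.inner ∧ y ∉ F.inner ∧ M.Adj x y)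
  mate : ∀ {x y}, x ∈ F.outer → M.Adj x y → F.om y = F.om x ∨ y ∈ F.inner
  blossom : ∀ {x}, x ∈ F.outer → ∃ b ∈ F.om x, (∀ m, M.Adj b m → m ∉ F.om x) ∧
    ∀ y ∈ F.om x, ∃ S ⊆ F.om x, AltPath M F.arc b y S
  work_outer : F.work ⊆ F.outer
  work_om : ∀ {x y}, x ∈ F.work → F.om y = F.om x → y ∈ F.work

/-! ### Consequences of the invariants: parents, children and entering arcs are unique. -/

namespace OK

variable {u v w x y z p q t m c m' c' : V}

theorem om_eq_iff (h : F.OK M ℓ) : F.om y = F.om x ↔ y ∈ F.om x :=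
  ⟨fun e => e ▸ h.mem_om y, h.om_eq⟩

theorem eq_of_om_inner (h : F.OK M ℓ) (hv : v ∈ F.inner) (e : F.om x = F.om v) : x = v := by
  have := h.mem_om x
  rwa [e, h.inner_om hv] at this

theorem not_inner_om (h : F.OK M ℓ) (hx : x ∉ F.inner) (e : F.om y = F.om x) : y ∉ F.inner :=
  fun hy => hx (h.eq_of_om_inner hy e.symm ▸ hy)

theorem outer_om (h : F.OK M ℓ) (hx : x ∈ F.outer) (e : F.om y = F.om x) : y ∈ F.outer :=
  ⟨h.om_vis hx.1 (h.om_eq_iff.1 e), h.not_inner_om hx.2 e⟩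

theorem om_ne_of_arc_inner (h : F.OK M ℓ) (hv : v ∈ F.inner) (ha : F.arc p v) :
    F.om p ≠ F.om v := fun e => by
  have := h.arc_adj ha
  rw [h.eq_of_om_inner hv e] at this
  exact G.loopless.irrefl _ this

theorem om_ne_of_inner_arc (h : F.OK M ℓ) (hv : v ∈ F.inner) (ha : F.arc v t) :
    F.om v ≠ F.om t := fun e => by
  have := h.arc_adj ha
  rw [h.eq_of_om_inner hv e.symm] at this
  exact G.loopless.irrefl _ this

theorem parent (h : F.OK M ℓ) (hv : v ∈ F.inner) (ha : F.arc p v) :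
    p ∈ F.outer ∧ ¬ M.Adj p v := by
  rcases h.crossing ha (h.om_ne_of_arc_inner hv ha) with h1 | h1
  · exact ⟨⟨(h.arc_vis ha).1, h1.1⟩, h1.2.2⟩
  · exact absurd hv h1.2.1

theorem child (h : F.OK M ℓ) (hv : v ∈ F.inner) (ha : F.arc v t) :
    t ∈ F.outer ∧ M.Adj v t := by
  rcases h.crossing ha (h.om_ne_of_inner_arc hv ha) with h1 | h1
  · exact absurd hv h1.1
  · exact ⟨⟨(h.arc_vis ha).2, h1.2.1⟩, h1.2.2⟩

theorem mate_of_inner (h : F.OK M ℓ) (hv : v ∈ F.inner) (hm : M.Adj v t) :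
    t ∈ F.outer ∧ F.arc v t := by
  obtain ⟨t', h1, h2⟩ := h.inner_child hv
  obtain rfl := h.matching.eq_of_adj_left hm h1
  exact ⟨(h.child hv h2).1, h2⟩

theorem vis_mate (h : F.OK M ℓ) (hx : x ∈ F.vis) (hm : M.Adj x y) : y ∈ F.vis := by
  by_cases hi : x ∈ F.inner
  · exact (h.mate_of_inner hi hm).1.1
  · rcases h.mate ⟨hx, hi⟩ hm with e | hy
    · exact h.om_vis hx (h.om_eq_iff.1 e)
    · exact h.inner_vis hy

/-- The even path from the base to another vertex of the blossom matches that vertex inside the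
blossom. So only the base is matched to the outside, and to one vertex. -/
theorem cross_unique (h : F.OK M ℓ) (hx : x ∈ F.outer) (h1 : M.Adj m c) (h2 : c ∈ F.om x)
    (h3 : m ∉ F.om x) (h1' : M.Adj m' c') (h2' : c' ∈ F.om x) (h3' : m' ∉ F.om x) :
    m' = m ∧ c' = c := by
  obtain ⟨b, hb, hbm, hp⟩ := h.blossom hx
  have key : ∀ m c, M.Adj m c → c ∈ F.om x → m ∉ F.om x → c = b := by
    intro m c h1 h2 h3
    by_contra hne
    obtain ⟨S, hS, hpS⟩ := hp c h2
    obtain ⟨z, hz, hcz⟩ := hpS.mate_mem hpS.right_mem hne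
    exact h3 (h.matching.eq_of_adj_left hcz h1.symm ▸ hS hz)
  obtain rfl := key m c h1 h2 h3
  obtain rfl := key m' c' h1' h2' h3'
  exact ⟨h.matching.eq_of_adj_right h1' h1, rfl⟩

theorem dist_of_cross (h : F.OK M ℓ) (hx : x ∈ F.outer) (h1 : M.Adj m c) (h2 : c ∈ F.om x)
    (h3 : m ∉ F.om x) : F.dist M x = F.label m c :=
  distOf_eq h1 h2 h3 fun _ _ h1' h2' h3' => h.cross_unique hx h1 h2 h3 h1' h2' h3'

theorem dist_om (e : F.om x = F.om y) : F.dist M x = F.dist M y := by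
  rw [dist, dist, e]

theorem dist_mate (h : F.OK M ℓ) (hv : v ∈ F.inner) (hm : M.Adj v t) :
    F.dist M t = F.label v t := by
  obtain ⟨h1, h2⟩ := h.mate_of_inner hv hm
  exact h.dist_of_cross h1 hm (h.mem_om t)
    fun e => h.om_ne_of_inner_arc hv h2 (h.om_eq e)

/-- The matched arc entering an outer blossom comes from an inner vertex. -/
theorem cross_inner (h : F.OK M ℓ) (hx : x ∈ F.outer) (h1 : M.Adj m c) (h2 : c ∈ F.om x)
    (h3 : m ∉ F.om x) : m ∈ F.inner ∧ F.arc m c := by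
  have e := h.om_eq h2
  rcases h.mate (h.outer_om hx e) h1.symm with e' | hi
  · exact absurd (h.om_eq_iff.1 (e'.trans e)) h3
  · exact ⟨hi, (h.mate_of_inner hi h1).2⟩

/-- Two arcs entering the same root blossom are equal. -/
theorem entry_unique (h : F.OK M ℓ) (ha : F.arc x y) (hne : F.om x ≠ F.om y)
    (ha' : F.arc z w) (hne' : F.om z ≠ F.om w) (e : F.om y = F.om w) : x = z ∧ y = w := by
  by_cases hy : y ∈ F.inner
  · obtain rfl := h.eq_of_om_inner hy e.symm
    exact ⟨h.arc_unique hy ha ha', rfl⟩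
  -- An arc into an outer blossom from elsewhere is matched, so uniqueness follows from
  -- `cross_unique`.
  · have hw : w ∉ F.inner := h.not_inner_om hy e.symm
    have h1 : M.Adj x y := by
      rcases h.crossing ha hne with h1 | h1
      · exact absurd h1.2.1 hy
      · exact h1.2.2
    have h2 : M.Adj z w := by
      rcases h.crossing ha' hne' with h1 | h1
      · exact absurd h1.2.1 hw
      · exact h1.2.2
    have hyo : y ∈ F.outer := ⟨(h.arc_vis ha).2, hy⟩
    obtain ⟨h3, h4⟩ := h.cross_unique hyo h1 (h.mem_om y) (fun e => hne (h.om_eq e)) h2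
      (h.om_eq_iff.1 e.symm) (fun e' => hne' ((h.om_eq e').trans e))
    exact ⟨h3.symm, h4.symm⟩

end OK

/-- A rank that increases along the arcs of the contracted forest. -/
noncomputable def rank (M : G.Subgraph) (F : Forest V) (x : V) : ℕ :=
  open Classical in
  if x ∈ F.inner then 2 * sSup {k | ∃ t, M.Adj x t ∧ k = F.label x t} - 1 else 2 * F.dist M x

/-! ### The rank and the ancestor order. -/

namespace OK

variable {u v w x y z p q t m c m' c' : V}

theorem rank_outer (hx : x ∉ F.inner) : F.rank M x = 2 * F.dist M x := by
  rw [rank, if_neg hx]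

theorem rank_inner (h : F.OK M ℓ) (hv : v ∈ F.inner) (hm : M.Adj v t) :
    F.rank M v = 2 * F.label v t - 1 := by
  have : {k | ∃ t, M.Adj v t ∧ k = F.label v t} = {F.label v t} := by
    ext k
    constructor
    · rintro ⟨t', h1, rfl⟩
      rw [h.matching.eq_of_adj_left h1 hm]; rfl
    · rintro rfl
      exact ⟨t, hm, rfl⟩
  rw [rank, if_pos hv, this, csSup_singleton]

theorem rank_om (h : F.OK M ℓ) (e : F.om x = F.om y) : F.rank M x = F.rank M y := by
  by_cases hx : x ∈ F.inner
  · rw [h.eq_of_om_inner hx e.symm]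
  · rw [rank_outer hx, rank_outer (h.not_inner_om hx e.symm), dist_om e]

theorem label_pos (h : F.OK M ℓ) (hv : v ∈ F.inner) (hm : M.Adj v t) : 0 < F.label v t := by
  obtain ⟨p, hp⟩ := h.inner_parent hv
  have := (h.label_lt hv hp hm).1
  omega

theorem label_le (h : F.OK M ℓ) (hv : v ∈ F.inner) (hm : M.Adj v t) : F.label v t ≤ ℓ := by
  obtain ⟨p, hp⟩ := h.inner_parent hv
  exact (h.label_lt hv hp hm).2

/-- The factor `2` in the rank leaves room for an inner vertex `v` between its parent `p` and its
mate `t`: the values are `2 * dist p < 2 * label - 1 < 2 * label`, and `label` is the distance of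
`t`. -/
theorem rank_lt (h : F.OK M ℓ) (ha : F.arc x y) (hne : F.om x ≠ F.om y) :
    F.rank M x < F.rank M y := by
  rcases h.crossing ha hne with ⟨h1, h2, h3⟩ | ⟨h1, h2, h3⟩
  · obtain ⟨t, ht, -⟩ := h.inner_child h2
    have := (h.label_lt h2 ha ht).1
    rw [rank_outer h1, h.rank_inner h2 ht]
    omega
  · have := h.label_pos h1 h3
    rw [rank_outer h2, h.rank_inner h1 h3, h.dist_mate h1 h3]
    omega

theorem anc_of_om (e : F.om x = F.om y) : F.Anc x y := .single (.inl e)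

theorem anc_of_arc (e : F.arc x y) : F.Anc x y := .single (.inr e)

/-- Steps inside a blossom keep the rank and tree arcs raise it. This is what makes the forest
acyclic. -/
theorem anc_rank (h : F.OK M ℓ) (ha : F.Anc x y) : F.om x = F.om y ∨ F.rank M x < F.rank M y := by
  induction ha with
  | refl => exact .inl rfl
  | @tail y z _ hs ih =>
    by_cases e : F.om y = F.om z
    · rw [← e, ← h.rank_om e]; exact ih
    · have := h.rank_lt (hs.resolve_left e) e
      rcases ih with ih | ih
      · right; rwa [h.rank_om ih]
      · right; omega

theorem anc_antisymm (h : F.OK M ℓ) (ha : F.Anc x y) (hb : F.Anc y x) : F.om x = F.om y := by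
  rcases h.anc_rank ha with h1 | h1
  · exact h1
  · rcases h.anc_rank hb with h2 | h2
    · exact h2.symm
    · omega

/-- A root blossom is entered by one arc only, so every descent to it from another blossom uses the
tail of that arc. -/
theorem anc_parent (h : F.OK M ℓ) (ha : F.Anc v y) (hz : F.arc z y) (hne : F.om z ≠ F.om y)
    (hvy : F.om v ≠ F.om y) : F.Anc v z := by
  induction ha generalizing z with
  | refl => exact absurd rfl hvy
  | @tail y y' h1 hs ih =>
    by_cases e : F.om y = F.om y'
    · rcases eq_or_ne y y' with rfl | hyy
      · exact ih hz hne hvy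
      -- the entering arc of `y'` need not end in `y`, so we argue through the first entry
      · by_contra hcon
        have key : ∀ a, F.Anc v a → F.om a = F.om y' → F.Anc v z := by
          intro a h1 e
          induction h1 with
          | refl => exact absurd e hvy
          | @tail a a' h2 hs' ih' =>
            by_cases e2 : F.om a = F.om a'
            · exact ih' (e2.trans e)
            · have := h.entry_unique (hs'.resolve_left e2) e2 hz hne e
              rw [← this.1]; exact h2
        exact hcon (key y h1 e)
    · have := h.entry_unique (hs.resolve_left e) e hz hne rfl
      rw [← this.1]; exact h1

/-- Climbing from `z` along the unique entering arcs meets both ancestors on the same path. -/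
theorem anc_total (h : F.OK M ℓ) (ha : F.Anc x z) (hb : F.Anc y z) : F.Anc x y ∨ F.Anc y x := by
  induction ha with
  | refl => exact .inr hb
  | @tail z' z h1 hs ih =>
    by_cases e : F.om z' = F.om z
    · exact ih (hb.trans (anc_of_om e.symm))
    · by_cases e2 : F.om y = F.om z
      · exact .inl ((h1.tail hs).trans (anc_of_om e2.symm))
      · exact ih (h.anc_parent hb (hs.resolve_left e) e e2)

theorem anc_vis (h : F.OK M ℓ) (hx : x ∈ F.vis) (ha : F.Anc x y) : y ∈ F.vis := by
  induction ha with
  | refl => exact hx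
  | tail _ hs ih =>
    rcases hs with e | e
    · exact h.om_vis ih (h.om_eq_iff.1 e.symm)
    · exact (h.arc_vis e).2

/-- A non-strict inner ancestor of an outer vertex has a small label. -/
theorem label_le_dist (h : F.OK M ℓ) (hv : v ∈ F.inner) (hm : M.Adj v t) (hu : u ∉ F.inner)
    (ha : F.Anc v u) : F.label v t ≤ F.dist M u := by
  have hp := h.label_pos hv hm
  rcases h.anc_rank ha with e | e
  · exact absurd (h.eq_of_om_inner hv e.symm ▸ hv) hu
  · rw [rank_outer hu, h.rank_inner hv hm] at e
    omega

/-- Descending below an inner vertex leads to its mate. -/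
theorem anc_mate (h : F.OK M ℓ) (hv : v ∈ F.inner) (hm : M.Adj v t) (ha : F.Anc v x)
    (hx : x ≠ v) : F.Anc t x := by
  induction ha with
  | refl => exact absurd rfl hx
  | @tail y z h1 hs ih =>
    by_cases hy : y = v
    · subst hy
      rcases hs with e | e
      · exact absurd (h.eq_of_om_inner hv e.symm) hx
      · have := h.child hv e
        rw [h.matching.eq_of_adj_left hm this.2]
        exact .refl
    · exact (ih hy).tail hs

theorem anc_of_act_mate (h : F.OK M ℓ) (hv : v ∈ F.inner) (hm : M.Adj v t) : F.Anc v t :=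
  anc_of_arc (h.mate_of_inner hv hm).2

/-- Every visited vertex lies below a vertex whose blossom is not entered by a matched arc. -/
theorem exists_root (h : F.OK M ℓ) (hx : x ∈ F.vis) :
    ∃ r ∈ F.outer, Free M r ∧ F.Anc r x := by
  -- The rank drops at each passage to a parent, so the climb ends.
  induction hn : F.rank M x using Nat.strong_induction_on generalizing x with
  | _ n ih =>
  subst hn
  by_cases hi : x ∈ F.inner
  · obtain ⟨p, hp⟩ := h.inner_parent hi
    obtain ⟨r, h1, h2, h3⟩ := ih _ (h.rank_lt hp (h.om_ne_of_arc_inner hi hp)) (h.arc_vis hp).1 rfl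
    exact ⟨r, h1, h2, h3.trans (anc_of_arc hp)⟩
  · obtain ⟨b, hb, hm, -⟩ := h.blossom ⟨hx, hi⟩
    -- If the base is matched, its mate is an inner vertex of smaller rank, and the climb continues
    -- from there.
    by_cases hf : Free M b
    · exact ⟨b, h.outer_om ⟨hx, hi⟩ (h.om_eq hb), hf, anc_of_om (h.om_eq hb)⟩
    · simp only [Free, not_forall, not_not] at hf
      obtain ⟨m, hbm⟩ := hf
      obtain ⟨h1, h2⟩ := h.cross_inner ⟨hx, hi⟩ hbm.symm hb (hm m hbm)
      have e := h.om_eq hb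
      obtain ⟨r, h3, h4, h5⟩ := ih _ (by
        rw [← h.rank_om e]
        exact h.rank_lt h2 (h.om_ne_of_inner_arc h1 h2)) (h.inner_vis h1) rfl
      exact ⟨r, h3, h4, h5.trans ((anc_of_arc h2).trans (anc_of_om e))⟩

end OK
end Forest
end MatchingPhase

namespace MatchingPhase

variable {V : Type*} {G : SimpleGraph V} {M : G.Subgraph}

namespace Forest

variable {F : Forest V} {ℓ : ℕ}

open Classical in
/-- The label function after the label of the arc `(v, t)` has been set to `k`. -/
noncomputable def setLabel (F : Forest V) (v t : V) (k : ℕ) : V → V → ℕ :=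
  fun x y => if x = v ∧ y = t then k else F.label x y

theorem setLabel_self {v t : V} {k : ℕ} : F.setLabel v t k v t = k := if_pos ⟨rfl, rfl⟩

theorem setLabel_of_ne {v t x y : V} {k : ℕ} (h : ¬ (x = v ∧ y = t)) :
    F.setLabel v t k x y = F.label x y := if_neg h

theorem setLabel_le {v t : V} {k : ℕ} (hk : k ≤ F.label v t) (x y : V) :
    F.setLabel v t k x y ≤ F.label x y := by
  unfold setLabel
  split_ifs with h
  · rw [h.1, h.2]; exact hk
  · exact le_rfl

/-! ### Moving a subtree -/

/-- The subtree of the inner vertex `v` is moved from `p` to `u`, and the arc `(v, t)` gets the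
label `k`. -/
noncomputable def move (F : Forest V) (p u v t : V) (k : ℕ) (W : Set V) : Forest V :=
  { F with
    arc := fun x y => (F.arc x y ∧ ¬ (x = p ∧ y = v)) ∨ (x = u ∧ y = v)
    label := F.setLabel v t k
    work := W }

/-- The two strict inequalities `dist u < k < label (v, t)` are what keeps the forest acyclic when
`v` is hung below `u`. -/
structure MoveHyp (M : G.Subgraph) (F : Forest V) (p u v t : V) (k : ℕ) : Prop where
  inner : v ∈ F.inner
  arc : F.arc p v
  outer : u ∈ F.outer
  adj : G.Adj u v
  not_matched : ¬ M.Adj u v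
  matched : M.Adj v t
  dist_lt : F.dist M u < k
  lt_label : k < F.label v t

variable {u v x y z p t : V} {k : ℕ} {W : Set V}

namespace MoveHyp

/-- If `v` were above the outer vertex `u`, the label of `(v, t)` would be at most the distance of
`u`, which is less than `k`. -/
theorem not_anc_u (H : MoveHyp M F p u v t k) (h : F.OK M ℓ) : ¬ F.Anc v u := fun ha => by
  have := h.label_le_dist H.inner H.matched H.outer.2 ha
  have := H.dist_lt
  have := H.lt_label
  omega

theorem not_anc_p (H : MoveHyp M F p u v t k) (h : F.OK M ℓ) : ¬ F.Anc v p := fun ha => by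
  have := h.label_le_dist H.inner H.matched (h.parent H.inner H.arc).1.2 ha
  have := (h.label_lt H.inner H.arc H.matched).1
  omega

theorem dist_eq (h : t ∉ F.om x) : (F.move p u v t k W).dist M x = F.dist M x := by
  refine distOf_congr fun m c h1 h2 h3 => setLabel_of_ne ?_
  rintro ⟨rfl, rfl⟩
  exact h h2

theorem dist_eq_of_mem (H : MoveHyp M F p u v t k) (h : F.OK M ℓ) (hx : t ∈ F.om x) :
    (F.move p u v t k W).dist M x = k := by
  have ht := h.mate_of_inner H.inner H.matched
  have e := h.om_eq hx
  have hv : v ∉ F.om x := fun hv => h.om_ne_of_inner_arc H.inner ht.2 ((h.om_eq hv).trans e.symm)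
  have hxo := h.outer_om ht.1 e.symm
  change distOf M (F.setLabel v t k) (F.om x) = k
  rw [distOf_eq H.matched hx hv]
  · exact setLabel_self
  · intro m' c' h1' h2' h3'
    exact h.cross_unique hxo H.matched hx hv h1' h2' h3'

/-- Only the blossom of `t` changes its distance, from the old label of `(v, t)` to `k`. So the
label inequalities at the children of all outer blossoms survive. -/
theorem dist_le (H : MoveHyp M F p u v t k) (h : F.OK M ℓ) (x : V) :
    (F.move p u v t k W).dist M x ≤ F.dist M x := by
  by_cases hx : t ∈ F.om x
  · rw [H.dist_eq_of_mem h hx, ← OK.dist_om (h.om_eq hx), h.dist_mate H.inner H.matched]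
    exact H.lt_label.le
  · rw [dist_eq hx]

theorem ok (H : MoveHyp M F p u v t k) (h : F.OK M ℓ) (hW : W ⊆ F.outer)
    (hW' : ∀ {x y}, x ∈ W → F.om y = F.om x → y ∈ W) : (F.move p u v t k W).OK M ℓ where
  matching := h.matching
  mem_om := h.mem_om
  om_eq := h.om_eq
  om_vis := h.om_vis
  arc_vis := by
    rintro x y (⟨h1, -⟩ | ⟨rfl, rfl⟩)
    · exact h.arc_vis h1
    · exact ⟨H.outer.1, h.inner_vis H.inner⟩
  arc_adj := by
    rintro x y (⟨h1, -⟩ | ⟨rfl, rfl⟩)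
    · exact h.arc_adj h1
    · exact H.adj
  inner_vis := h.inner_vis
  inner_om := h.inner_om
  inner_parent := by
    intro v' hv'
    by_cases e : v' = v
    · exact ⟨u, .inr ⟨rfl, e⟩⟩
    · obtain ⟨q, hq⟩ := h.inner_parent hv'
      exact ⟨q, .inl ⟨hq, fun e' => e e'.2⟩⟩
  inner_child := by
    intro v' hv'
    obtain ⟨t', h1, h2⟩ := h.inner_child hv'
    refine ⟨t', h1, .inl ⟨h2, ?_⟩⟩
    rintro ⟨-, rfl⟩
    exact (h.child hv' h2).1.2 H.inner
  arc_unique := by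
    rintro v' q r hv' (⟨h1, h1'⟩ | ⟨rfl, rfl⟩) (⟨h2, h2'⟩ | ⟨rfl, h3⟩)
    · exact h.arc_unique hv' h1 h2
    · subst h3; exact absurd ⟨h.arc_unique hv' h1 H.arc, rfl⟩ h1'
    · exact absurd ⟨h.arc_unique hv' h2 H.arc, rfl⟩ h2'
    · rfl
  label_lt := by
    intro v' q t' hv' ha hm
    rcases ha with ⟨h1, h1'⟩ | ⟨rfl, rfl⟩
    -- The arc from `p` was the only one into `v`, so a surviving arc concerns another inner vertex,
    -- whose label is unchanged.
    · have hne : v' ≠ v := by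
        rintro rfl
        exact h1' ⟨h.arc_unique hv' h1 H.arc, rfl⟩
      have e : (F.move p u v t k W).label v' t' = F.label v' t' :=
        setLabel_of_ne fun e => hne e.1
      rw [e]
      exact ⟨(H.dist_le h q).trans_lt (h.label_lt hv' h1 hm).1, (h.label_lt hv' h1 hm).2⟩
    · obtain rfl := h.matching.eq_of_adj_left hm H.matched
      have e : (F.move p q v' t' k W).label v' t' = k := setLabel_self
      rw [e]
      exact ⟨(H.dist_le h q).trans_lt H.dist_lt,
        H.lt_label.le.trans (h.label_lt hv' H.arc H.matched).2⟩
  crossing := by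
    rintro x y (⟨h1, -⟩ | ⟨rfl, rfl⟩) hne
    · exact h.crossing h1 hne
    · exact .inl ⟨H.outer.2, H.inner, H.not_matched⟩
  mate := h.mate
  blossom := by
    intro x hx
    obtain ⟨b, hb, hm, hp⟩ := h.blossom hx
    refine ⟨b, hb, hm, fun y hy => ?_⟩
    obtain ⟨S, hS, hpS⟩ := hp y hy
    refine ⟨S, hS, hpS.mono fun a _ c hc hac => .inl ⟨hac, ?_⟩⟩
    rintro ⟨-, rfl⟩
    exact h.not_inner_om hx.2 (h.om_eq (hS hc)) H.inner
  work_outer := hW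
  work_om := hW'

/-- Ancestors of vertices outside the moved subtree. -/
theorem anc_iff (H : MoveHyp M F p u v t k) (hy : ¬ F.Anc v y) :
    (F.move p u v t k W).Anc x y ↔ F.Anc x y := by
  constructor
  · intro ha
    induction ha with
    | refl => exact .refl
    | @tail z y h1 hs ih =>
      rcases hs with e | ⟨h2, -⟩ | ⟨rfl, rfl⟩
      · exact (ih fun h => hy (h.tail (.inl e))).tail (.inl e)
      · exact (ih fun h => hy (h.tail (.inr h2))).tail (.inr h2)
      · exact absurd .refl hy
  · intro ha
    induction ha with
    | refl => exact .refl
    | @tail z y h1 hs ih =>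
      have h3 := ih fun h => hy (h.tail hs)
      rcases hs with e | h2
      · exact h3.tail (.inl e)
      · refine h3.tail (.inr (.inl ⟨h2, ?_⟩))
        rintro ⟨-, rfl⟩
        exact hy .refl

/-- The deleted arc starts at `p`, which is not below `v`; hence the inside of the moved subtree is
untouched. -/
theorem anc_of_anc (H : MoveHyp M F p u v t k) (h : F.OK M ℓ) (hx : F.Anc v x) (ha : F.Anc x y) :
    (F.move p u v t k W).Anc x y := by
  induction ha with
  | refl => exact .refl
  | @tail z y h1 hs ih =>
    rcases hs with e | h2
    · exact ih.tail (.inl e)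
    · refine ih.tail (.inr (.inl ⟨h2, ?_⟩))
      rintro ⟨rfl, -⟩
      exact H.not_anc_p h (hx.trans h1)

/-- Climbing from a moved vertex in the new forest either stays within the old subtree of `v` or
leaves it through `u`. -/
theorem anc_cases (H : MoveHyp M F p u v t k) (h : F.OK M ℓ)
    (ha : (F.move p u v t k W).Anc x y) (hy : F.Anc v y) :
    (F.Anc v x ∧ F.Anc x y) ∨ F.Anc x u := by
  induction ha with
  | refl => exact .inl ⟨hy, .refl⟩
  | @tail z y h1 hs ih =>
    rcases hs with e | ⟨h2, h3⟩ | ⟨rfl, rfl⟩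
    · exact (ih (hy.tail (.inl e.symm))).imp_left fun h => ⟨h.1, h.2.tail (.inl e)⟩
    · by_cases e : F.om z = F.om y
      · exact (ih (hy.tail (.inl e.symm))).imp_left fun h => ⟨h.1, h.2.tail (.inl e)⟩
      · have hvy : F.om v ≠ F.om y := by
          intro e'
          obtain rfl := h.eq_of_om_inner H.inner e'.symm
          exact h3 ⟨h.arc_unique H.inner h2 H.arc, rfl⟩
        have := h.anc_parent hy h2 e hvy
        exact (ih this).imp_left fun h => ⟨h.1, h.2.tail (.inr h2)⟩
    · exact .inr ((H.anc_iff (H.not_anc_u h)).1 h1)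

/-- Only ancestors of `u` gain descendants; this localises the size estimate. -/
theorem sub_subset (H : MoveHyp M F p u v t k) (h : F.OK M ℓ) (hx : ¬ F.Anc x u) :
    (F.move p u v t k W).sub x ⊆ F.sub x := by
  intro y hy
  by_cases hv : F.Anc v y
  · exact ((H.anc_cases h hy hv).resolve_right hx).2
  · exact (H.anc_iff hv).1 hy

theorem anc_u_t (H : MoveHyp M F p u v t k) (h : F.OK M ℓ) : (F.move p u v t k W).Anc u t := by
  have h1 := (h.mate_of_inner H.inner H.matched).2
  have h2 : (F.move p u v t k W).Anc u v := .single (.inr (.inr ⟨rfl, rfl⟩))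
  exact h2.trans (H.anc_of_anc h .refl (OK.anc_of_arc h1))

theorem anc_v_t (H : MoveHyp M F p u v t k) (h : F.OK M ℓ) : F.Anc v t :=
  OK.anc_of_arc (h.mate_of_inner H.inner H.matched).2

/-- The active vertices if `(v, t)` was not on an active path. -/
theorem act_of_act (H : MoveHyp M F p u v t k) (h : F.OK M ℓ) (ht : ¬ F.Act t)
    (hx : F.Act x) : (F.move p u v t k ((F.work \ F.om u) ∪ F.om t)).Act x := by
  obtain ⟨w, hw, ha⟩ := hx
  -- Every proper descent from `v` goes through its mate `t`, so below an inactive `t` there is no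
  -- working vertex.
  have hvw : ¬ F.Anc v w := fun hv => by
    refine ht ⟨w, hw, h.anc_mate H.inner H.matched hv ?_⟩
    rintro rfl
    exact (h.work_outer hw).2 H.inner
  have ha' := (H.anc_iff (W := (F.work \ F.om u) ∪ F.om t) hvw).2 ha
  by_cases e : w ∈ F.om u
  · refine ⟨t, .inr (h.mem_om t), ha'.trans (Relation.ReflTransGen.head ?_ (H.anc_u_t h))⟩
    exact .inl (h.om_eq e)
  · exact ⟨w, .inl ⟨hw, e⟩, ha'⟩

/-- The active path that ended at `u` is prolonged by `(u, v)` and `(v, t)`, which contributes one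
matched arc; the other active paths are not affected. -/
theorem crit_subset (H : MoveHyp M F p u v t k) (h : F.OK M ℓ) (hu : u ∈ F.work) (ht : ¬ F.Act t) :
    (F.move p u v t k ((F.work \ F.om u) ∪ F.om t)).crit M ⊆ insert (v, t) (F.crit M) := by
  rintro ⟨v', t'⟩ ⟨hm, hi, w, hw, ha⟩
  dsimp only at hm hi ha
  have hi' : v' ∈ F.inner := hi
  have ht' := h.mate_of_inner hi' hm
  rcases hw with ⟨hw, hwu⟩ | hw
  · have hvw : ¬ F.Anc v w := fun hv => by
      refine ht ⟨w, hw, h.anc_mate H.inner H.matched hv ?_⟩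
      rintro rfl
      exact (h.work_outer hw).2 H.inner
    exact .inr ⟨hm, hi', w, hw, (H.anc_iff hvw).1 ha⟩
  · have hvw : F.Anc v w := (H.anc_v_t h).tail (.inl (h.om_eq hw).symm)
    rcases H.anc_cases h ha hvw with ⟨h1, h2⟩ | h1
    · left
      have h3 : F.Anc t t' := h.anc_mate H.inner H.matched h1 (by
        rintro rfl
        exact ht'.1.2 H.inner)
      -- Now `t'` is both below and above `t`, so both lie in one blossom, which only one matched
      -- arc enters.
      have e := h.anc_antisymm h3 (h2.tail (.inl (h.om_eq hw)))
      have h4 := h.mate_of_inner H.inner H.matched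
      have := h.entry_unique h4.2 (h.om_ne_of_inner_arc H.inner h4.2) ht'.2
        (h.om_ne_of_inner_arc hi' ht'.2) e
      rw [← this.1, ← this.2]
    · exact .inr ⟨hm, hi', u, hu, h1⟩

/-- The active vertices if `(v, t)` was on an active path. -/
theorem act_of_act' (H : MoveHyp M F p u v t k) (h : F.OK M ℓ)
    (ht : F.Act t) (hx : F.Act x) : (F.move p u v t k ((F.work \ F.om u) ∪ F.om p)).Act x := by
  -- A vertex above `w` is either below `v`, and then it remains above `w`, or above the old parent
  -- `p`, which is now in a working blossom.
  have key : ∀ w ∈ F.work, F.Anc v w → ∀ x, F.Anc x w →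
      (F.move p u v t k ((F.work \ F.om u) ∪ F.om p)).Act x := by
    intro w hw hvw x hx
    by_cases hvx : F.Anc v x
    · refine ⟨w, .inl ⟨hw, fun e => ?_⟩, H.anc_of_anc h hvx hx⟩
      exact H.not_anc_u h (hvw.tail (.inl (h.om_eq e)))
    · have h1 := (h.anc_total hx hvw).resolve_right hvx
      have h2 := h.anc_parent h1 H.arc (h.om_ne_of_arc_inner H.inner H.arc)
        fun e => hvx (OK.anc_of_om e.symm)
      exact ⟨p, .inr (h.mem_om p), (H.anc_iff (H.not_anc_p h)).2 h2⟩
  obtain ⟨w, hw, ha⟩ := hx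
  by_cases hvw : F.Anc v w
  · exact key w hw hvw x ha
  · have ha' := (H.anc_iff (W := (F.work \ F.om u) ∪ F.om p) hvw).2 ha
    by_cases e : w ∈ F.om u
    · obtain ⟨w', hw', ha2⟩ := ht
      have h3 : (F.move p u v t k ((F.work \ F.om u) ∪ F.om p)).Anc x w' :=
        (ha'.tail (.inl (h.om_eq e))).trans ((H.anc_u_t h).trans (H.anc_of_anc h (H.anc_v_t h) ha2))
      refine ⟨w', .inl ⟨hw', fun e => ?_⟩, h3⟩
      exact H.not_anc_u h (((H.anc_v_t h).trans ha2).tail (.inl (h.om_eq e)))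
    · exact ⟨w, .inl ⟨hw, e⟩, ha'⟩

/-- When the working vertex travels with the subtree, the new active paths are composed of old ones:
those above `u`, those below `v`, and the path to `p`, which was part of the active path through
`v`. -/
theorem crit_subset' (H : MoveHyp M F p u v t k) (h : F.OK M ℓ) (hu : u ∈ F.work) (ht : F.Act t) :
    (F.move p u v t k ((F.work \ F.om u) ∪ F.om p)).crit M ⊆ F.crit M := by
  rintro ⟨v', t'⟩ ⟨hm, hi, w, hw, ha⟩
  refine ⟨hm, hi, ?_⟩
  dsimp only at hm hi ha ⊢
  rcases hw with ⟨hw, hwu⟩ | hw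
  · by_cases hvw : F.Anc v w
    · rcases H.anc_cases h ha hvw with ⟨h1, h2⟩ | h1
      · exact ⟨w, hw, h2⟩
      · exact ⟨u, hu, h1⟩
    · exact ⟨w, hw, (H.anc_iff hvw).1 ha⟩
  · have hvw : ¬ F.Anc v w := fun h' => H.not_anc_p h (h'.tail (.inl (h.om_eq hw)))
    have h1 := ((H.anc_iff hvw).1 ha).tail (.inl (h.om_eq hw))
    obtain ⟨w', hw', ha2⟩ := ht
    exact ⟨w', hw', h1.trans ((OK.anc_of_arc H.arc).trans ((H.anc_v_t h).trans ha2))⟩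

end MoveHyp

/-! ### Adding an unvisited matched arc -/

/-- The unvisited matched arc `(v, t)` is attached to `u` and gets the label `k`. -/
noncomputable def add (F : Forest V) (u v t : V) (k : ℕ) : Forest V where
  om := F.om
  arc := fun x y => F.arc x y ∨ (x = u ∧ y = v) ∨ (x = v ∧ y = t)
  inner := insert v F.inner
  vis := F.vis ∪ {v, t}
  label := F.setLabel v t k
  work := (F.work \ F.om u) ∪ {t}

/-- Besides freshness of `(v, t)`, this records that `u` lies in a working blossom, which is the one
replaced by `{t}`. -/
structure AddHyp (M : G.Subgraph) (ℓ : ℕ) (F : Forest V) (u v t : V) (k : ℕ) : Prop where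
  not_vis : v ∉ F.vis
  om_v : F.om v = {v}
  om_t : F.om t = {t}
  work : u ∈ F.work
  adj : G.Adj u v
  not_matched : ¬ M.Adj u v
  matched : M.Adj v t
  dist_lt : F.dist M u < k
  le : k ≤ ℓ

namespace AddHyp

theorem t_not_vis (H : AddHyp M ℓ F u v t k) (h : F.OK M ℓ) : t ∉ F.vis :=
  fun ht => H.not_vis (h.vis_mate ht H.matched.symm)

theorem dist_eq (H : AddHyp M ℓ F u v t k) (h : F.OK M ℓ) (hx : x ∈ F.vis) :
    (F.add u v t k).dist M x = F.dist M x := by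
  refine distOf_congr fun m c h1 h2 h3 => setLabel_of_ne ?_
  rintro ⟨rfl, rfl⟩
  exact H.t_not_vis h (h.om_vis hx h2)

theorem ok (H : AddHyp M ℓ F u v t k) (h : F.OK M ℓ) : (F.add u v t k).OK M ℓ := by
  have ht := H.t_not_vis h
  have hu := h.work_outer H.work
  have hvi : v ∉ F.inner := fun hi => H.not_vis (h.inner_vis hi)
  have hti : t ∉ F.inner := fun hi => ht (h.inner_vis hi)
  have hvt : v ≠ t := H.matched.ne
  have ne_v : ∀ {x}, x ∈ F.vis → x ≠ v := by rintro x hx rfl; exact H.not_vis hx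
  have ne_t : ∀ {x}, x ∈ F.vis → x ≠ t := by rintro x hx rfl; exact ht hx
  refine
  { matching := h.matching, mem_om := h.mem_om, om_eq := h.om_eq, om_vis := ?_, arc_vis := ?_,
    arc_adj := ?_, inner_vis := ?_, inner_om := ?_, inner_parent := ?_, inner_child := ?_,
    arc_unique := ?_, label_lt := ?_, crossing := ?_, mate := ?_, blossom := ?_, work_outer := ?_,
    work_om := ?_ }
  · rintro x y (hx | rfl | rfl) hy
    · exact .inl (h.om_vis hx hy)
    · have hy' : y ∈ F.om x := hy
      rw [H.om_v] at hy'; exact .inr (.inl hy')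
    · have hy' : y ∈ F.om x := hy
      rw [H.om_t] at hy'; exact .inr (.inr hy')
  · rintro x y (ha | ⟨rfl, rfl⟩ | ⟨rfl, rfl⟩)
    · exact ⟨.inl (h.arc_vis ha).1, .inl (h.arc_vis ha).2⟩
    · exact ⟨.inl hu.1, .inr (.inl rfl)⟩
    · exact ⟨.inr (.inl rfl), .inr (.inr rfl)⟩
  · rintro x y (ha | ⟨rfl, rfl⟩ | ⟨rfl, rfl⟩)
    · exact h.arc_adj ha
    · exact H.adj
    · exact H.matched.adj_sub
  · rintro x (rfl | hx)
    · exact .inr (.inl rfl)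
    · exact .inl (h.inner_vis hx)
  · rintro x (rfl | hx)
    · exact H.om_v
    · exact h.inner_om hx
  · rintro x (rfl | hx)
    · exact ⟨u, .inr (.inl ⟨rfl, rfl⟩)⟩
    · exact (h.inner_parent hx).imp fun _ => .inl
  · rintro x (rfl | hx)
    · exact ⟨t, H.matched, .inr (.inr ⟨rfl, rfl⟩)⟩
    · exact (h.inner_child hx).imp fun _ h => ⟨h.1, .inl h.2⟩
  · have key : ∀ {x a}, x ∈ F.inner → (F.add u v t k).arc a x → F.arc a x := by
      rintro x a hx (ha | ⟨rfl, rfl⟩ | ⟨rfl, rfl⟩)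
      · exact ha
      · exact absurd hx hvi
      · exact absurd hx hti
    have key' : ∀ {a}, (F.add u v t k).arc a v → a = u := by
      rintro a (ha | ⟨rfl, -⟩ | ⟨rfl, e⟩)
      · exact absurd (h.arc_vis ha).2 H.not_vis
      · rfl
      · exact absurd e hvt
    rintro x a b (rfl | hx) ha hb
    · rw [key' ha, key' hb]
    · exact h.arc_unique hx (key hx ha) (key hx hb)
  · rintro x a b hx (ha | ⟨rfl, rfl⟩ | ⟨rfl, rfl⟩) hm
    · have hx' : x ∈ F.inner := hx.resolve_left (ne_v (h.arc_vis ha).2)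
      rw [H.dist_eq h (h.arc_vis ha).1]
      have e : (F.add u v t k).label x b = F.label x b :=
        setLabel_of_ne fun e => ne_v (h.arc_vis ha).2 e.1
      rw [e]
      exact h.label_lt hx' ha hm
    · obtain rfl := h.matching.eq_of_adj_left hm H.matched
      rw [H.dist_eq h hu.1]
      have e : (F.add a x b k).label x b = k := setLabel_self
      rw [e]
      exact ⟨H.dist_lt, H.le⟩
    · rcases hx with e | hx
      · exact absurd e.symm hvt
      · exact absurd hx hti
  · rintro x y (ha | ⟨rfl, rfl⟩ | ⟨rfl, rfl⟩) hne
    · rcases h.crossing ha hne with ⟨h1, h2, h3⟩ | ⟨h1, h2, h3⟩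
      · exact .inl ⟨fun h' => h'.elim (ne_v (h.arc_vis ha).1) h1, .inr h2, h3⟩
      · exact .inr ⟨.inr h1, fun h' => h'.elim (ne_v (h.arc_vis ha).2) h2, h3⟩
    · exact .inl ⟨fun h' => h'.elim (ne_v hu.1) hu.2, .inl rfl, H.not_matched⟩
    · exact .inr ⟨.inl rfl, fun h' => h'.elim (fun e => hvt e.symm) hti, H.matched⟩
  · rintro x y ⟨hx | rfl | rfl, hx'⟩ hm
    · rcases h.mate ⟨hx, fun h => hx' (.inr h)⟩ hm with h1 | h1
      · exact .inl h1
      · exact .inr (.inr h1)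
    · exact absurd (.inl rfl) hx'
    · exact .inr (.inl (h.matching.eq_of_adj_left hm H.matched.symm))
  · rintro x ⟨hx | rfl | rfl, hx'⟩
    · obtain ⟨b, hb, hbm, hp⟩ := h.blossom ⟨hx, fun h => hx' (.inr h)⟩
      refine ⟨b, hb, hbm, fun y hy => ?_⟩
      obtain ⟨S, hS, hpS⟩ := hp y hy
      exact ⟨S, hS, hpS.mono fun _ _ _ _ => .inl⟩
    · exact absurd (.inl rfl) hx'
    · refine ⟨x, h.mem_om x, ?_, ?_⟩
      · intro m hm h'
        have h'' : m ∈ F.om x := h'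
        rw [H.om_t] at h''
        exact hm.ne h''.symm
      · intro y hy
        have h'' : y ∈ F.om x := hy
        rw [H.om_t] at h''
        obtain rfl : y = x := h''
        exact ⟨{y}, Set.singleton_subset_iff.2 (h.mem_om y), .nil _⟩
  · rintro x (⟨hx, -⟩ | rfl)
    · have := h.work_outer hx
      exact ⟨.inl this.1, fun h' => h'.elim (ne_v this.1) this.2⟩
    · exact ⟨.inr (.inr rfl), fun h' => h'.elim (fun e => hvt e.symm) hti⟩
  · rintro x y (⟨hx, hx'⟩ | rfl) (e : F.om y = F.om x)
    · refine .inl ⟨h.work_om hx e, fun h' => hx' ?_⟩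
      rw [← h.om_eq h', e]
      exact h.mem_om x
    · right
      have := h.mem_om y
      rwa [e, H.om_t] at this

theorem anc_iff (H : AddHyp M ℓ F u v t k) (h : F.OK M ℓ) (hy : y ∈ F.vis) :
    (F.add u v t k).Anc x y ↔ F.Anc x y := by
  constructor
  · intro ha
    induction ha with
    | refl => exact .refl
    | @tail z y h1 hs ih =>
      rcases hs with (e : F.om z = F.om y) | h2 | ⟨rfl, rfl⟩ | ⟨rfl, rfl⟩
      · exact (ih (h.om_vis hy (h.om_eq_iff.1 e))).tail (.inl e)
      · exact (ih (h.arc_vis h2).1).tail (.inr h2)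
      · exact absurd hy H.not_vis
      · exact absurd hy (H.t_not_vis h)
  · intro ha
    exact Relation.ReflTransGen.mono (fun a b hs => hs.imp_right .inl) _ _ ha

theorem vis_of_anc (h : F.OK M ℓ) (hy : y ∈ F.vis) (ha : F.Anc x y) : x ∈ F.vis := by
  induction ha with
  | refl => exact hy
  | tail _ hs ih =>
    rcases hs with e | e
    · exact ih (h.om_vis hy (h.om_eq_iff.1 e))
    · exact ih (h.arc_vis e).1

theorem anc_v (H : AddHyp M ℓ F u v t k) (h : F.OK M ℓ) (ha : (F.add u v t k).Anc x v) :
    x = v ∨ F.Anc x u := by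
  have key : ∀ y, (F.add u v t k).Anc x y → y = v → x = v ∨ F.Anc x u := by
    intro y ha
    induction ha with
    | refl => exact .inl
    | @tail z y h1 hs ih =>
      rintro rfl
      rcases hs with (e : F.om z = F.om y) | h2 | ⟨rfl, -⟩ | ⟨rfl, e⟩
      · have := h.mem_om z
        rw [e, H.om_v] at this
        exact ih this
      · exact absurd (h.arc_vis h2).2 H.not_vis
      · exact .inr ((H.anc_iff h (h.work_outer H.work).1).1 h1)
      · exact absurd e H.matched.ne
  exact key v ha rfl

theorem anc_t (H : AddHyp M ℓ F u v t k) (h : F.OK M ℓ) (ha : (F.add u v t k).Anc x t) :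
    x = t ∨ x = v ∨ F.Anc x u := by
  have key : ∀ y, (F.add u v t k).Anc x y → y = t → x = t ∨ x = v ∨ F.Anc x u := by
    intro y ha
    induction ha with
    | refl => exact .inl
    | @tail z y h1 hs ih =>
      rintro rfl
      rcases hs with (e : F.om z = F.om y) | h2 | ⟨rfl, e⟩ | ⟨rfl, e⟩
      · have := h.mem_om z
        rw [e, H.om_t] at this
        exact ih this
      · exact absurd (h.arc_vis h2).2 (H.t_not_vis h)
      · exact absurd e.symm H.matched.ne
      · exact .inr (H.anc_v h h1)
  exact key t ha rfl

/-- The working vertex moves downwards, from the blossom of `u` to the new leaf `t` below it. -/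
theorem act_of_act (H : AddHyp M ℓ F u v t k) (h : F.OK M ℓ) (hx : F.Act x) :
    (F.add u v t k).Act x := by
  obtain ⟨w, hw, ha⟩ := hx
  have ha' := (H.anc_iff h (h.work_outer hw).1).2 ha
  by_cases e : w ∈ F.om u
  · refine ⟨t, .inr rfl, ha'.trans (.head (.inl (h.om_eq e)) ?_)⟩
    exact .head (.inr (.inr (.inl ⟨rfl, rfl⟩))) (.single (.inr (.inr (.inr ⟨rfl, rfl⟩))))
  · exact ⟨w, .inl ⟨hw, e⟩, ha'⟩

theorem crit_subset (H : AddHyp M ℓ F u v t k) (h : F.OK M ℓ) :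
    (F.add u v t k).crit M ⊆ insert (v, t) (F.crit M) := by
  rintro ⟨v', t'⟩ ⟨hm, hi, w, hw, ha⟩
  dsimp only at hm hi ha
  rcases hi with rfl | hi
  · left
    rw [h.matching.eq_of_adj_left hm H.matched]
  · refine .inr ⟨hm, hi, ?_⟩
    rcases hw with ⟨hw, -⟩ | rfl
    · exact ⟨w, hw, (H.anc_iff h (h.work_outer hw).1).1 ha⟩
    · rcases H.anc_t h ha with rfl | rfl | h1
      · rw [h.matching.eq_of_adj_left hm.symm H.matched.symm] at hi
        exact absurd (h.inner_vis hi) H.not_vis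
      · rw [h.matching.eq_of_adj_left hm.symm H.matched] at hi
        exact absurd (h.inner_vis hi) (H.t_not_vis h)
      · exact ⟨u, H.work, h1⟩

theorem sub_subset_union (H : AddHyp M ℓ F u v t k) (h : F.OK M ℓ) (hx : x ∈ F.vis) :
    (F.add u v t k).sub x ⊆ F.sub x ∪ {v, t} := by
  intro y hy
  rcases (H.ok h).anc_vis (.inl hx) hy with h1 | h1
  · exact .inl ((H.anc_iff h h1).1 hy)
  · exact .inr h1

theorem sub_subset (H : AddHyp M ℓ F u v t k) (h : F.OK M ℓ) (hx : x ∈ F.vis)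
    (hxu : ¬ F.Anc x u) : (F.add u v t k).sub x ⊆ F.sub x := by
  intro y hy
  rcases H.sub_subset_union h hx hy with h1 | rfl | rfl
  · exact h1
  · rcases H.anc_v h hy with rfl | h1
    · exact absurd hx H.not_vis
    · exact absurd h1 hxu
  · rcases H.anc_t h hy with rfl | rfl | h1
    · exact absurd hx (H.t_not_vis h)
    · exact absurd hx H.not_vis
    · exact absurd h1 hxu

theorem sub_v_subset (H : AddHyp M ℓ F u v t k) (h : F.OK M ℓ) :
    (F.add u v t k).sub v ⊆ {v, t} := by
  intro y hy
  rcases (H.ok h).anc_vis (.inr (.inl rfl)) hy with h1 | h1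
  · exact absurd (vis_of_anc h h1 ((H.anc_iff h h1).1 hy)) H.not_vis
  · exact h1

end AddHyp
end Forest
end MatchingPhase

namespace MatchingPhase

variable {V : Type*} {G : SimpleGraph V} {M : G.Subgraph}

namespace Forest

variable {F : Forest V} {ℓ : ℕ} {u v x y z p t b c q : V} {B : Set V}

/-! ### Contracting a cycle -/

open Classical in
/-- The vertex set `B` becomes a blossom, after the arc `(u, v)` has been added. -/
noncomputable def contract (M : G.Subgraph) (F : Forest V) (u v : V) (B : Set V) : Forest V where
  om := fun x => if x ∈ B then B else F.om x
  arc := fun x y => F.arc x y ∨ (x = u ∧ y = v)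
  inner := F.inner \ B
  vis := F.vis
  label := fun x y => if M.Adj x y ∧ x ∈ B ∧ y ∈ B then 0 else F.label x y
  work := (F.work \ F.om u) ∪ B

/-- `B` is the vertex set of the cycle closed by `(u, v)`, whose top blossom contains `c` and has the
base `b`. -/
structure CycleHyp (M : G.Subgraph) (F : Forest V) (u v : V) (B : Set V) (c b : V) : Prop where
  vis : B ⊆ F.vis
  closed : ∀ {x y}, x ∈ B → F.om y = F.om x → y ∈ B
  work : u ∈ F.work
  u_mem : u ∈ B
  v_mem : v ∈ B
  adj : G.Adj u v
  c_mem : c ∈ B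
  c_outer : c ∈ F.outer
  top : ∀ {x}, x ∈ B → F.Anc c x
  entry : ∀ {x y}, F.arc x y → x ∉ B → y ∈ B → F.om y = F.om c
  child : ∀ {x y}, x ∈ B → x ∈ F.inner → M.Adj x y → y ∈ B
  b_mem : b ∈ B
  base : ∀ m, M.Adj b m → m ∉ B
  path : ∀ y ∈ B, ∃ S ⊆ B, AltPath M (fun x y => F.arc x y ∨ (x = u ∧ y = v)) b y S
  exists_inner : ∃ x ∈ B, x ∈ F.inner

theorem contract_om_mem (hx : x ∈ B) : (F.contract M u v B).om x = B := if_pos hx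

theorem contract_om_not_mem (hx : x ∉ B) : (F.contract M u v B).om x = F.om x := if_neg hx

theorem contract_label_le (x y : V) : (F.contract M u v B).label x y ≤ F.label x y := by
  simp only [contract]
  split_ifs
  · exact Nat.zero_le _
  · exact le_rfl

theorem contract_label_eq (h : ¬ (x ∈ B ∧ y ∈ B)) :
    (F.contract M u v B).label x y = F.label x y :=
  if_neg fun h' => h h'.2

namespace CycleHyp

theorem om_subset (H : CycleHyp M F u v B c b) (h : F.OK M ℓ) (hx : x ∈ B) : F.om x ⊆ B :=
  fun _ hy => H.closed hx (h.om_eq hy)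

theorem not_mem_of_om (H : CycleHyp M F u v B c b) (hx : x ∉ B) (e : F.om y = F.om x) : y ∉ B :=
  fun hy => hx (H.closed hy e.symm)

/-- A matched edge leaving `B` leaves it at the base. -/
theorem cross (H : CycleHyp M F u v B c b) (h : F.OK M ℓ) {m d : V} (hm : M.Adj m d) (hd : d ∈ B)
    (hmB : m ∉ B) : F.om d = F.om c ∧ m ∈ F.inner := by
  have hdi : d ∉ F.inner := fun hi => hmB (H.child hd hi hm.symm)
  rcases h.mate ⟨H.vis hd, hdi⟩ hm.symm with e | hi
  · exact absurd (H.closed hd e) hmB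
  · exact ⟨H.entry (h.mate_of_inner hi hm).2 hmB hd, hi⟩

theorem dist_eq (H : CycleHyp M F u v B c b) (h : F.OK M ℓ) (hx : x ∉ B) :
    (F.contract M u v B).dist M x = F.dist M x := by
  rw [dist, contract_om_not_mem hx, dist]
  exact distOf_congr fun m d _ h2 _ => contract_label_eq fun h' =>
    H.not_mem_of_om hx (h.om_eq h2) h'.2

/-- A matched arc that enters `B` enters its top blossom, so the distance of `B` is at most that of
`c`; and `c`, lying above all of `B`, has the least rank there. -/
theorem dist_le (H : CycleHyp M F u v B c b) (h : F.OK M ℓ) (hx : x ∈ B) (hxi : x ∉ F.inner) :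
    (F.contract M u v B).dist M x ≤ F.dist M x := by
  have hcx : F.dist M c ≤ F.dist M x := by
    rcases h.anc_rank (H.top hx) with e | e
    · rw [OK.dist_om e]
    · rw [OK.rank_outer H.c_outer.2, OK.rank_outer hxi] at e
      omega
  refine le_trans ?_ hcx
  rw [dist, contract_om_mem hx]
  by_cases hE : ∃ m d, M.Adj m d ∧ d ∈ B ∧ m ∉ B
  · obtain ⟨m, d, h1, h2, h3⟩ := hE
    have key : ∀ {m d}, d ∈ B → m ∉ B → M.Adj m d → d ∈ F.om c ∧ m ∉ F.om c :=
      fun h2 h3 h1 => ⟨h.om_eq_iff.1 (H.cross h h1 h2 h3).1, fun h' => h3 (H.om_subset h H.c_mem h')⟩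
    obtain ⟨k1, k2⟩ := key h2 h3 h1
    rw [distOf_eq h1 h2 h3, h.dist_of_cross H.c_outer h1 k1 k2]
    · exact contract_label_le _ _
    · intro m' d' h1' h2' h3'
      obtain ⟨k1', k2'⟩ := key h2' h3' h1'
      exact h.cross_unique H.c_outer h1 k1 k2 h1' k1' k2'
  · push Not at hE
    rw [distOf_eq_zero hE]
    exact Nat.zero_le _

theorem ok (H : CycleHyp M F u v B c b) (h : F.OK M ℓ) : (F.contract M u v B).OK M ℓ := by
  have om_in : ∀ {x}, x ∈ B → (F.contract M u v B).om x = B := fun hx => contract_om_mem hx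
  have om_out : ∀ {x}, x ∉ B → (F.contract M u v B).om x = F.om x :=
    fun hx => contract_om_not_mem hx
  refine
  { matching := h.matching, mem_om := ?_, om_eq := ?_, om_vis := ?_, arc_vis := ?_,
    arc_adj := ?_, inner_vis := fun x hx => h.inner_vis hx.1, inner_om := ?_, inner_parent := ?_,
    inner_child := ?_, arc_unique := ?_, label_lt := ?_, crossing := ?_, mate := ?_, blossom := ?_,
    work_outer := ?_, work_om := ?_ }
  · intro x
    by_cases hx : x ∈ B
    · rwa [om_in hx]
    · rw [om_out hx]; exact h.mem_om x
  · intro x y hy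
    by_cases hx : x ∈ B
    · rw [om_in hx] at hy
      rw [om_in hx, om_in hy]
    · rw [om_out hx] at hy
      rw [om_out hx, om_out (H.not_mem_of_om hx (h.om_eq hy)), h.om_eq hy]
  · intro x y hx hy
    by_cases hxB : x ∈ B
    · rw [om_in hxB] at hy; exact H.vis hy
    · rw [om_out hxB] at hy; exact h.om_vis hx hy
  · rintro x y (ha | ⟨rfl, rfl⟩)
    · exact h.arc_vis ha
    · exact ⟨H.vis H.u_mem, H.vis H.v_mem⟩
  · rintro x y (ha | ⟨rfl, rfl⟩)
    · exact h.arc_adj ha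
    · exact H.adj
  · intro x hx
    rw [om_out hx.2]; exact h.inner_om hx.1
  · intro x hx
    exact (h.inner_parent hx.1).imp fun _ => .inl
  · intro x hx
    exact (h.inner_child hx.1).imp fun _ h => ⟨h.1, .inl h.2⟩
  · rintro x a a' hx (ha | ⟨-, e⟩) (ha' | ⟨-, e'⟩)
    · exact h.arc_unique hx.1 ha ha'
    · exact absurd H.v_mem (e' ▸ hx.2)
    · exact absurd H.v_mem (e ▸ hx.2)
    · exact absurd H.v_mem (e ▸ hx.2)
  · rintro x a d hx (ha | ⟨rfl, rfl⟩) hm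
    · have h1 := h.label_lt hx.1 ha hm
      rw [contract_label_eq fun h' => hx.2 h'.1]
      refine ⟨lt_of_le_of_lt ?_ h1.1, h1.2⟩
      by_cases haB : a ∈ B
      · exact H.dist_le h haB (h.parent hx.1 ha).1.2
      · rw [H.dist_eq h haB]
    · exact absurd H.v_mem hx.2
  · rintro x y (ha | ⟨rfl, rfl⟩) hne
    · have hne' : F.om x ≠ F.om y := by
        intro e
        apply hne
        by_cases hx : x ∈ B
        · rw [om_in hx, om_in (H.closed hx e.symm)]
        · rw [om_out hx, om_out (H.not_mem_of_om hx e.symm), e]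
      have hB : ¬ (x ∈ B ∧ y ∈ B) := fun h' => hne (by rw [om_in h'.1, om_in h'.2])
      rcases h.crossing ha hne' with ⟨h1, h2, h3⟩ | ⟨h1, h2, h3⟩
      · refine .inl ⟨fun h' => h1 h'.1, ⟨h2, fun hy => ?_⟩, h3⟩
        by_cases hx : x ∈ B
        · exact hB ⟨hx, hy⟩
        · exact H.c_outer.2 (h.eq_of_om_inner h2 (H.entry ha hx hy).symm ▸ h2)
      · refine .inr ⟨⟨h1, fun hx => ?_⟩, fun h' => h2 h'.1, h3⟩
        exact hB ⟨hx, H.child hx h1 h3⟩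
    · exact absurd (by rw [om_in H.u_mem, om_in H.v_mem]) hne
  · rintro x y ⟨hx, hxi⟩ hm
    have key : x ∉ F.inner ∨ x ∈ B := by
      by_contra hcon
      push Not at hcon
      exact hxi hcon
    by_cases hi : x ∈ F.inner
    · have hxB := key.resolve_left (not_not.2 hi)
      left
      rw [om_in hxB, om_in (H.child hxB hi hm)]
    · rcases h.mate ⟨hx, hi⟩ hm with e | hy
      · left
        by_cases hxB : x ∈ B
        · rw [om_in hxB, om_in (H.closed hxB e)]
        · rw [om_out hxB, om_out (H.not_mem_of_om hxB e), e]
      · by_cases hyB : y ∈ B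
        · left
          rw [om_in hyB, om_in (H.child hyB hy hm.symm)]
        · exact .inr ⟨hy, hyB⟩
  · rintro x ⟨hx, hxi⟩
    by_cases hxB : x ∈ B
    · rw [om_in hxB]
      exact ⟨b, H.b_mem, H.base, H.path⟩
    · rw [om_out hxB]
      obtain ⟨b', hb, hbm, hp⟩ := h.blossom ⟨hx, fun h' => hxi ⟨h', hxB⟩⟩
      refine ⟨b', hb, hbm, fun y hy => ?_⟩
      obtain ⟨S, hS, hpS⟩ := hp y hy
      exact ⟨S, hS, hpS.mono fun _ _ _ _ => .inl⟩
  · rintro x (⟨hx, -⟩ | hx)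
    · exact ⟨(h.work_outer hx).1, fun h' => (h.work_outer hx).2 h'.1⟩
    · exact ⟨H.vis hx, fun h' => h'.2 hx⟩
  · rintro x y hx e
    by_cases hxB : x ∈ B
    · rw [om_in hxB] at e
      by_cases hy : y ∈ B
      · exact .inr hy
      · rw [om_out hy] at e
        exact .inr (e ▸ h.mem_om y)
    · rw [om_out hxB] at e
      obtain ⟨hx, hxu⟩ := hx.resolve_right hxB
      have hyB : y ∉ B := fun hy => by
        rw [om_in hy] at e
        exact hxB (e ▸ h.mem_om x)
      rw [om_out hyB] at e
      refine .inl ⟨h.work_om hx e, fun h' => hxu ?_⟩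
      rw [← h.om_eq h', e]
      exact h.mem_om x

theorem anc_of_anc (H : CycleHyp M F u v B c b) (ha : F.Anc x y) :
    (F.contract M u v B).Anc x y := by
  refine Relation.ReflTransGen.mono (fun a b hs => ?_) _ _ ha
  rcases hs with e | hs
  · left
    by_cases hx : a ∈ B
    · rw [contract_om_mem hx, contract_om_mem (H.closed hx e.symm)]
    · rw [contract_om_not_mem hx, contract_om_not_mem (H.not_mem_of_om hx e.symm), e]
  · exact .inr (.inl hs)

/-- The only way into `B` leads to the top blossom. -/
theorem anc_c (H : CycleHyp M F u v B c b) (hx : x ∉ B) (ha : F.Anc x y) (hy : y ∈ B) :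
    F.Anc x c := by
  induction ha with
  | refl => exact absurd hy hx
  | @tail z y h1 hs ih =>
    by_cases hz : z ∈ B
    · exact ih hz
    · rcases hs with e | hs
      · exact absurd (H.closed hy e) hz
      · exact (h1.tail (.inr hs)).tail (.inl (H.entry hs hz hy))

theorem anc_of_anc' (H : CycleHyp M F u v B c b) (hx : x ∉ B)
    (ha : (F.contract M u v B).Anc x y) (h : F.OK M ℓ) : F.Anc x y := by
  induction ha with
  | refl => exact .refl
  | @tail z y h1 hs ih =>
    rcases hs with e | hs | ⟨rfl, rfl⟩
    · by_cases hz : z ∈ B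
      · have hy : y ∈ B := by
          by_contra hy
          rw [contract_om_mem hz, contract_om_not_mem hy] at e
          exact hy (e ▸ h.mem_om y)
        exact (H.anc_c hx ih hz).trans (H.top hy)
      · by_cases hy : y ∈ B
        · rw [contract_om_mem hy, contract_om_not_mem hz] at e
          exact absurd (e ▸ h.mem_om z) hz
        · rw [contract_om_not_mem hy, contract_om_not_mem hz] at e
          exact ih.tail (.inl e)
    · exact ih.tail (.inr hs)
    · exact (H.anc_c hx ih H.u_mem).trans (H.top H.v_mem)

theorem act_of_mem (hx : x ∈ B) : (F.contract M u v B).Act x := ⟨x, .inr hx, .refl⟩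

theorem act_of_act (H : CycleHyp M F u v B c b) (h : F.OK M ℓ) (hx : F.Act x) :
    (F.contract M u v B).Act x := by
  obtain ⟨w, hw, ha⟩ := hx
  refine ⟨w, ?_, H.anc_of_anc ha⟩
  by_cases hwu : w ∈ F.om u
  · exact .inr (H.om_subset h H.u_mem hwu)
  · exact .inl ⟨hw, hwu⟩

/-- What is above some vertex of `B` from outside is above its top blossom and hence was already
above the old working vertex `u`. Matched arcs inside `B` cease to be critical, as their tails are
no longer inner. -/
theorem crit_subset (H : CycleHyp M F u v B c b) (h : F.OK M ℓ) :
    (F.contract M u v B).crit M ⊆ F.crit M := by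
  rintro ⟨v', t'⟩ ⟨hm, hi, w, hw, ha⟩
  dsimp only at hm hi ha
  refine ⟨hm, hi.1, ?_⟩
  dsimp only
  by_cases ht : t' ∈ B
  · have e := (H.cross h hm ht hi.2).1
    exact ⟨u, H.work, .head (.inl e) (H.top H.u_mem)⟩
  · have ha' := H.anc_of_anc' ht ha h
    rcases hw with ⟨hw, -⟩ | hw
    · exact ⟨w, hw, ha'⟩
    · exact ⟨u, H.work, (H.anc_c ht ha' hw).trans (H.top H.u_mem)⟩

theorem sub_subset (H : CycleHyp M F u v B c b) (h : F.OK M ℓ) (hx : x ∉ B) :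
    (F.contract M u v B).sub x ⊆ F.sub x := fun _ hy => H.anc_of_anc' hx hy h

end CycleHyp

/-! ### Cycles from tree paths -/

/-- The arcs of the contracted forest. -/
def TArc (F : Forest V) (X Y : Set V) : Prop := X ≠ Y ∧ ∃ x y, F.arc x y ∧ F.om x = X ∧ F.om y = Y

namespace OK

theorem chain_mem (h : F.OK M ℓ) {l : List (Set V)} (hl : (F.om x :: l).IsChain F.TArc) {Y : Set V}
    (hY : Y ∈ l) : ∃ y ∈ F.vis, F.om y = Y ∧ F.Anc x y ∧ F.rank M x < F.rank M y := by
  induction l generalizing x with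
  | nil => simp at hY
  | cons Z l ih =>
    rw [List.isChain_cons_cons] at hl
    obtain ⟨⟨hne, a, d, had, e1, e2⟩, hl⟩ := hl
    have h1 : F.Anc x d := (OK.anc_of_om e1.symm).trans (OK.anc_of_arc had)
    have h2 : F.rank M x < F.rank M d := by
      rw [← h.rank_om e1]
      exact h.rank_lt had (by rw [e1, e2]; exact hne)
    rcases List.mem_cons.1 hY with rfl | hY
    · exact ⟨d, (h.arc_vis had).2, e2, h1, h2⟩
    · rw [← e2] at hl
      obtain ⟨y, hy, e, h3, h4⟩ := ih hl hY
      exact ⟨y, hy, e, h1.trans h3, h2.trans h4⟩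

/-- A vertex of the first blossom of a tree path is in no later blossom. -/
theorem not_mem_chain (h : F.OK M ℓ) {l : List (Set V)} (hl : (F.om x :: l).IsChain F.TArc)
    (hy : y ∈ F.om x) : ∀ Y ∈ l, y ∉ Y := by
  intro Y hY hyY
  obtain ⟨z, -, rfl, -, h1⟩ := h.chain_mem hl hY
  rw [← h.rank_om ((h.om_eq hyY).symm.trans (h.om_eq hy))] at h1
  exact lt_irrefl _ h1

/-- The mate `t` of an inner vertex is matched to the outside of its blossom, so it must be the
base. -/
theorem base_mate (h : F.OK M ℓ) (hv : v ∈ F.inner) (hm : M.Adj v t) :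
    ∀ y ∈ F.om t, ∃ S ⊆ F.om t, AltPath M F.arc t y S := by
  obtain ⟨h1, h2⟩ := h.mate_of_inner hv hm
  obtain ⟨b', hb, hbm, hp⟩ := h.blossom h1
  have : t = b' := by
    by_contra hne
    obtain ⟨S, hS, hpS⟩ := hp t (h.mem_om t)
    obtain ⟨z, hz, hcz⟩ := hpS.mate_mem hpS.right_mem hne
    obtain rfl := h.matching.eq_of_adj_left hcz hm.symm
    exact h.om_ne_of_inner_arc hv h2 (h.om_eq (hS hz))
  subst this
  exact hp

/-- An arc of the contracted forest that leaves an outer blossom. -/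
theorem tArc_outer (h : F.OK M ℓ) {Y : Set V} (hx : x ∈ F.outer) (hT : F.TArc (F.om x) Y) :
    ∃ p v, F.om p = F.om x ∧ v ∈ F.inner ∧ F.arc p v ∧ ¬ M.Adj p v ∧ Y = F.om v := by
  obtain ⟨hne, a, d, had, e1, rfl⟩ := hT
  have ha := (h.outer_om hx e1).2
  rcases h.crossing had (by rwa [e1]) with h1 | h1
  · exact ⟨a, d, e1, h1.2.1, had, h1.2.2, rfl⟩
  · exact absurd h1.1 ha

/-- An arc of the contracted forest that leaves an inner vertex. -/
theorem tArc_inner (h : F.OK M ℓ) {Y : Set V} (hv : v ∈ F.inner) (hT : F.TArc (F.om v) Y) :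
    ∃ t, M.Adj v t ∧ F.arc v t ∧ t ∈ F.outer ∧ Y = F.om t := by
  obtain ⟨hne, a, d, had, e1, rfl⟩ := hT
  obtain rfl := h.eq_of_om_inner hv e1
  exact ⟨d, (h.child hv had).2, had, (h.child hv had).1, rfl⟩

/-- The chain is consumed two arcs at a time: cross the outer blossom from its base to the tail `p`
of the next arc, take the unmatched arc to an inner `v` and the matched arc to its mate, which is
the base of the next outer blossom. A chain with a single arc would end at an inner vertex. -/
theorem chain_path (h : F.OK M ℓ) : ∀ (l : List (Set V)) {x b z : V}, x ∈ F.outer →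
    (∀ y ∈ F.om x, ∃ S ⊆ F.om x, AltPath M F.arc b y S) → (F.om x :: l).IsChain F.TArc →
    (F.om x :: l).getLast? = some (F.om z) → z ∈ F.outer → ∀ y ∈ F.om z,
    ∃ S ⊆ {a | ∃ Y ∈ F.om x :: l, a ∈ Y}, AltPath M F.arc b y S
  | [], x, b, z, hx, hb, _, hlast, hz, y, hy => by
    simp only [List.getLast?_singleton, Option.some.injEq] at hlast
    rw [← hlast] at hy
    obtain ⟨S, hS, hp⟩ := hb y hy
    exact ⟨S, fun a ha => ⟨_, by simp, hS ha⟩, hp⟩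
  | [Y], x, b, z, hx, hb, hl, hlast, hz, y, hy => by
    rw [List.isChain_cons_cons] at hl
    obtain ⟨p, v, -, hv, -, -, rfl⟩ := h.tArc_outer hx hl.1
    simp at hlast
    exact absurd (h.eq_of_om_inner hv hlast.symm ▸ hv) hz.2
  | Y :: Z :: l, x, b, z, hx, hb, hl, hlast, hz, y, hy => by
    have hl0 := hl
    rw [List.isChain_cons_cons, List.isChain_cons_cons] at hl
    obtain ⟨hT1, hT2, hl⟩ := hl
    obtain ⟨p, v, ep, hv, hpv, hnm, rfl⟩ := h.tArc_outer hx hT1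
    obtain ⟨t, hm, hvt, ht, rfl⟩ := h.tArc_inner hv hT2
    obtain ⟨S', hS', hp'⟩ := chain_path h l ht (h.base_mate hv hm) hl
      (by simpa using hlast) hz y hy
    obtain ⟨S, hS, hp⟩ := hb p (h.om_eq_iff.1 ep)
    refine ⟨S ∪ insert v S', ?_, hp.trans (.inl hpv) hnm hm (.inl hvt) hp' ?_ ?_ ?_⟩
    · rintro a (ha | rfl | ha)
      · exact ⟨_, by simp, hS ha⟩
      · exact ⟨_, by simp, h.mem_om a⟩
      · obtain ⟨Y, hY, haY⟩ := hS' ha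
        exact ⟨Y, List.mem_cons_of_mem _ (List.mem_cons_of_mem _ hY), haY⟩
    · intro hvS
      exact h.not_mem_chain hl0 (hS hvS) (F.om v) (by simp) (h.mem_om v)
    · intro hvS
      obtain ⟨Y, hY, haY⟩ := hS' hvS
      exact h.not_mem_chain hl0.tail (h.mem_om v) Y hY haY
    · rw [Set.disjoint_left]
      intro a ha ha'
      obtain ⟨Y, hY, haY⟩ := hS' ha'
      exact h.not_mem_chain hl0 (hS ha) Y (by simp only [List.mem_cons] at hY ⊢; tauto) haY

theorem exists_tArc_to {T : Set V → Set V → Prop} {X Y : Set V} {l : List (Set V)}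
    (hl : (X :: l).IsChain T) (hY : Y ∈ l) : ∃ Z ∈ X :: l, T Z Y := by
  induction l generalizing X with
  | nil => simp at hY
  | cons Z l ih =>
    rw [List.isChain_cons_cons] at hl
    rcases List.mem_cons.1 hY with rfl | hY
    · exact ⟨X, by simp, hl.1⟩
    · obtain ⟨W, hW, hT⟩ := ih hl.2 hY
      exact ⟨W, List.mem_cons_of_mem _ hW, hT⟩

theorem exists_tArc_from {T : Set V → Set V → Prop} {X Y L : Set V} {l : List (Set V)}
    (hl : (X :: l).IsChain T) (hlast : (X :: l).getLast? = some L) (hY : Y ∈ X :: l)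
    (hne : Y ≠ L) : ∃ Z ∈ l, T Y Z := by
  induction l generalizing X with
  | nil =>
    simp only [List.getLast?_singleton, Option.some.injEq] at hlast
    simp only [List.mem_singleton] at hY
    exact absurd (hY.trans hlast) hne
  | cons Z l ih =>
    rw [List.isChain_cons_cons] at hl
    rcases List.mem_cons.1 hY with rfl | hY
    · exact ⟨Z, by simp, hl.1⟩
    · obtain ⟨W, hW, hT⟩ := ih hl.2 (by simpa using hlast) hY
      exact ⟨W, List.mem_cons_of_mem _ hW, hT⟩

/-- The even alternating paths from the base of the top blossom of a cycle to the vertices of one of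
its two sides. -/
theorem cycle_path (h : F.OK M ℓ) {A : V → V → Prop} (hA : ∀ x y, F.arc x y → A x y)
    {l₁ l₂ : List (Set V)} (hu : u ∈ F.outer) (hv : v ∈ F.outer) (huv : A v u ∨ A u v)
    (hn : ¬ M.Adj v u) (hc : c ∈ F.outer)
    (hb : ∀ y ∈ F.om c, ∃ S ⊆ F.om c, AltPath M F.arc b y S)
    (hl₁ : (F.om c :: l₁).IsChain F.TArc) (hl₁' : (F.om c :: l₁).getLast? = some (F.om u))
    (hl₂ : (F.om c :: l₂).IsChain F.TArc) (hl₂' : (F.om c :: l₂).getLast? = some (F.om v))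
    (hd : l₁.Disjoint l₂) {Y : Set V} (hY : Y ∈ F.om c :: l₁) (hy : y ∈ Y) :
    ∃ S ⊆ {a | ∃ X ∈ F.om c :: (l₁ ++ l₂), a ∈ X}, AltPath M A b y S := by
  have hYom : Y = F.om y ∧ y ∈ F.vis := by
    rcases List.mem_cons.1 hY with rfl | hY
    · exact ⟨(h.om_eq hy).symm, h.om_vis hc.1 hy⟩
    · obtain ⟨z, hz, rfl, -, -⟩ := h.chain_mem hl₁ hY
      exact ⟨(h.om_eq hy).symm, h.om_vis hz hy⟩
  obtain ⟨rfl, hyv⟩ := hYom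
  -- An outer `y` is reached straight down its own side. An inner `y` is reached the other way
  -- round: down the opposite side to `v`, across the closing edge to `u`, and up to the mate of
  -- `y`.
  by_cases hyi : y ∈ F.inner
  · have hyl : F.om y ∈ l₁ := by
      rcases List.mem_cons.1 hY with e | h'
      · exact absurd (h.eq_of_om_inner hyi e.symm ▸ hyi) hc.2
      · exact h'
    obtain ⟨l', l'', rfl⟩ := List.append_of_mem hyl
    have hch : (F.om y :: l'').IsChain F.TArc :=
      (List.isChain_append.1 (show ((F.om c :: l') ++ F.om y :: l'').IsChain _ from hl₁)).2.1
    have hlast : (F.om y :: l'').getLast? = some (F.om u) := by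
      rwa [← List.cons_append, List.getLast?_append_of_ne_nil _ (by simp)] at hl₁'
    have hyu : F.om y ≠ F.om u := fun e => hu.2 (h.eq_of_om_inner hyi e.symm ▸ hyi)
    match l'', hch, hlast with
    | [], _, hlast => exact absurd (by simpa using hlast) hyu
    | Z :: l'', hch, hlast =>
      have hch0 := hch
      rw [List.isChain_cons_cons] at hch
      obtain ⟨t, hm, hyt, ht, rfl⟩ := h.tArc_inner hyi hch.1
      obtain ⟨S', hS', hp'⟩ := h.chain_path l'' ht (h.base_mate hyi hm) hch.2
        (by simpa using hlast) hu u (h.mem_om u)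
      obtain ⟨S, hS, hp⟩ := h.chain_path l₂ hc hb hl₂ hl₂' hv v (h.mem_om v)
      -- The two sides are disjoint below the top by `hd`, and the top blossom is not repeated since
      -- the rank grows along the chain.
      have disj : ∀ {a}, (∃ Y ∈ F.om c :: l₂, a ∈ Y) → (∃ Y ∈ F.om y :: F.om t :: l'', a ∈ Y) →
          False := by
        rintro a ⟨Y, hY, ha⟩ ⟨Z, hZ, ha'⟩
        have hZ1 : Z ∈ l' ++ F.om y :: F.om t :: l'' := List.mem_append_right _ hZ
        rcases List.mem_cons.1 hY with rfl | hY
        · exact h.not_mem_chain hl₁ ha Z hZ1 ha'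
        · obtain ⟨y1, -, rfl, -, -⟩ := h.chain_mem hl₂ hY
          obtain ⟨z1, -, rfl, -, -⟩ := h.chain_mem hl₁ hZ1
          rw [← h.om_eq ha', h.om_eq ha] at hZ1
          exact hd hZ1 hY
      refine ⟨S ∪ insert y S', ?_, hp'.mono (fun a _ d _ => hA a d) |>.turn
        (hp.mono fun a _ d _ => hA a d) huv hn hm.symm (.inr (hA _ _ hyt)) ?_ ?_ ?_⟩
      · rintro a (ha | rfl | ha)
        · obtain ⟨Y, hY, haY⟩ := hS ha
          refine ⟨Y, ?_, haY⟩
          simp only [List.mem_cons, List.mem_append] at hY ⊢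
          tauto
        · exact ⟨_, by simp, hy⟩
        · obtain ⟨Y, hY, haY⟩ := hS' ha
          refine ⟨Y, ?_, haY⟩
          simp only [List.mem_cons, List.mem_append] at hY ⊢
          tauto
      · intro hyS
        exact disj (hS hyS) ⟨F.om y, by simp, hy⟩
      · intro hyS
        obtain ⟨Y, hY, haY⟩ := hS' hyS
        exact h.not_mem_chain hch0 hy Y hY haY
      · rw [Set.disjoint_left]
        intro a ha ha'
        obtain ⟨Y, hY, haY⟩ := hS' ha'
        exact disj (hS ha) ⟨Y, List.mem_cons_of_mem _ hY, haY⟩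
  · have : ∃ l' l'', l₁ = l' ++ l'' ∧ (F.om c :: l').getLast? = some (F.om y) := by
      rcases List.mem_cons.1 hY with e | h'
      · exact ⟨[], l₁, rfl, by simp [e]⟩
      · obtain ⟨l', l'', rfl⟩ := List.append_of_mem h'
        exact ⟨l' ++ [F.om y], l'', by simp, by
          rw [← List.cons_append, List.getLast?_append]; simp⟩
    obtain ⟨l', l'', rfl, hlast⟩ := this
    have hch : (F.om c :: l').IsChain F.TArc :=
      (List.isChain_append.1 (show ((F.om c :: l') ++ l'').IsChain _ from hl₁)).1
    obtain ⟨S, hS, hp⟩ := h.chain_path l' hc hb hch hlast ⟨hyv, hyi⟩ y hy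
    refine ⟨S, ?_, hp.mono fun a _ d _ => hA a d⟩
    intro a ha
    obtain ⟨Y, hY, haY⟩ := hS ha
    refine ⟨Y, ?_, haY⟩
    simp only [List.mem_cons, List.mem_append] at hY ⊢
    tauto

/-- From the raw tree paths of Contract to everything needed about the new blossom. Its base is the
base of the top blossom `C`, and the even alternating paths are those of `cycle_path` for either
side. -/
theorem cycleHyp (h : F.OK M ℓ) {C : Set V} {l₁ l₂ : List (Set V)} (hu : u ∈ F.work)
    (hv : v ∈ F.outer) (huv : G.Adj u v) (hn : ¬ M.Adj u v) (hne : F.om u ≠ F.om v)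
    (hl₁ : (C :: l₁).IsChain F.TArc) (hl₁' : (C :: l₁).getLast? = some (F.om u))
    (hl₂ : (C :: l₂).IsChain F.TArc) (hl₂' : (C :: l₂).getLast? = some (F.om v))
    (hd : l₁.Disjoint l₂) :
    ∃ c b, CycleHyp M F u v {x | ∃ X ∈ C :: (l₁ ++ l₂), x ∈ X} c b := by
  have huo := h.work_outer hu
  have hc0 : ∃ c ∈ F.vis, F.om c = C := by
    by_cases hCu : C = F.om u
    · exact ⟨u, huo.1, hCu.symm⟩
    · obtain ⟨Z, -, -, a, d, had, e, -⟩ := exists_tArc_from hl₁ hl₁' (by simp) hCu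
      exact ⟨a, (h.arc_vis had).1, e⟩
  obtain ⟨c, hcv, rfl⟩ := hc0
  -- An inner vertex has its mate as only child, so below an inner top both sides would begin with
  -- the same blossom.
  have hc : c ∈ F.outer := by
    refine ⟨hcv, fun hci => ?_⟩
    obtain ⟨Z₁, hZ₁, hT₁⟩ := exists_tArc_from hl₁ hl₁' (List.mem_cons_self ..)
      fun e => huo.2 (h.eq_of_om_inner hci e.symm ▸ hci)
    obtain ⟨Z₂, hZ₂, hT₂⟩ := exists_tArc_from hl₂ hl₂' (List.mem_cons_self ..)
      fun e => hv.2 (h.eq_of_om_inner hci e.symm ▸ hci)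
    obtain ⟨t₁, hm₁, -, -, rfl⟩ := h.tArc_inner hci hT₁
    obtain ⟨t₂, hm₂, -, -, rfl⟩ := h.tArc_inner hci hT₂
    rw [h.matching.eq_of_adj_left hm₁ hm₂] at hZ₁
    exact hd hZ₁ hZ₂
  obtain ⟨b, hb, hbm, hbp⟩ := h.blossom hc
  set B := {x | ∃ X ∈ F.om c :: (l₁ ++ l₂), x ∈ X} with hB
  have mem_of : ∀ {Y : Set V}, Y ∈ F.om c :: (l₁ ++ l₂) →
      ∃ y ∈ F.vis, F.om y = Y ∧ F.Anc c y ∧ (Y ≠ F.om c → F.rank M c < F.rank M y) := by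
    intro Y hY
    rcases List.mem_cons.1 hY with rfl | hY
    · exact ⟨c, hcv, rfl, .refl, fun h => absurd rfl h⟩
    · rcases List.mem_append.1 hY with hY | hY
      · obtain ⟨y, h1, h2, h3, h4⟩ := h.chain_mem hl₁ hY
        exact ⟨y, h1, h2, h3, fun _ => h4⟩
      · obtain ⟨y, h1, h2, h3, h4⟩ := h.chain_mem hl₂ hY
        exact ⟨y, h1, h2, h3, fun _ => h4⟩
  have om_of : ∀ {x : V}, x ∈ B → F.om x ∈ F.om c :: (l₁ ++ l₂) := by
    rintro x ⟨X, hX, hx⟩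
    obtain ⟨y, -, rfl, -⟩ := mem_of hX
    rwa [h.om_eq hx]
  have of_om : ∀ {x : V}, F.om x ∈ F.om c :: (l₁ ++ l₂) → x ∈ B := fun hx => ⟨_, hx, h.mem_om _⟩
  have hvis : B ⊆ F.vis := by
    intro x hx
    obtain ⟨y, h1, h2, -⟩ := mem_of (om_of hx)
    exact h.om_vis h1 (h2 ▸ h.mem_om x)
  have htop : ∀ {x}, x ∈ B → F.Anc c x := by
    intro x hx
    obtain ⟨y, -, h2, h3, -⟩ := mem_of (om_of hx)
    exact h3.tail (.inl h2)
  have to_of : ∀ {Y : Set V}, Y ∈ F.om c :: (l₁ ++ l₂) → Y ≠ F.om c →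
      ∃ Z ∈ F.om c :: (l₁ ++ l₂), F.TArc Z Y := by
    intro Y hY hYc
    rcases List.mem_append.1 ((List.mem_cons.1 hY).resolve_left hYc) with hY | hY
    · obtain ⟨Z, h1, h2⟩ := exists_tArc_to hl₁ hY
      refine ⟨Z, ?_, h2⟩
      simp only [List.mem_cons, List.mem_append] at h1 ⊢
      tauto
    · obtain ⟨Z, h1, h2⟩ := exists_tArc_to hl₂ hY
      refine ⟨Z, ?_, h2⟩
      simp only [List.mem_cons, List.mem_append] at h1 ⊢
      tauto
  have hmem : ∀ {l : List (Set V)} {L : Set V}, (F.om c :: l).getLast? = some L →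
      L ∈ F.om c :: l := fun hl => List.mem_of_getLast? hl
  refine ⟨c, b,
  { vis := hvis, closed := ?_, work := hu, u_mem := ?_, v_mem := ?_, adj := huv, c_mem := ?_,
    c_outer := hc, top := htop, entry := ?_, child := ?_, b_mem := ?_, base := ?_, path := ?_,
    exists_inner := ?_ }⟩
  · intro x y hx e
    exact of_om (e ▸ om_of hx)
  · refine of_om ?_
    have := hmem hl₁'
    simp only [List.mem_cons, List.mem_append] at this ⊢
    tauto
  · refine of_om ?_
    have := hmem hl₂'
    simp only [List.mem_cons, List.mem_append] at this ⊢
    tauto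
  · exact of_om (by simp)
  -- Every blossom of the cycle other than the top is entered by an arc of the cycle, hence by no
  -- arc from outside.
  · intro x y ha hx hy
    by_contra hyc
    obtain ⟨Z, hZ, hne', a, d, had, rfl, e⟩ := to_of (om_of hy) hyc
    have hxy : F.om x ≠ F.om y := fun e => hx (of_om (e ▸ om_of hy))
    obtain ⟨rfl, -⟩ := h.entry_unique ha hxy had (by rw [e]; exact hne') e.symm
    exact hx (of_om hZ)
  -- The ends of both sides are outer, so an inner vertex of the cycle is followed by a further
  -- blossom, which is that of its mate.
  · intro x y hx hxi hm
    have hxu : F.om x ≠ F.om u := fun e => huo.2 (h.eq_of_om_inner hxi e.symm ▸ hxi)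
    have hxv : F.om x ≠ F.om v := fun e => hv.2 (h.eq_of_om_inner hxi e.symm ▸ hxi)
    have : ∃ Z ∈ F.om c :: (l₁ ++ l₂), F.TArc (F.om x) Z := by
      have hx' := om_of hx
      rw [← List.cons_append, List.mem_append] at hx'
      rcases hx' with hx' | hx'
      · obtain ⟨Z, h1, h2⟩ := exists_tArc_from hl₁ hl₁' hx' hxu
        exact ⟨Z, by simp [h1], h2⟩
      · obtain ⟨Z, h1, h2⟩ := exists_tArc_from hl₂ hl₂' (List.mem_cons_of_mem _ hx') hxv
        exact ⟨Z, by simp [h1], h2⟩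
    obtain ⟨Z, hZ, hT⟩ := this
    obtain ⟨t, hm', -, -, rfl⟩ := h.tArc_inner hxi hT
    rw [h.matching.eq_of_adj_left hm hm']
    exact of_om hZ
  · exact of_om (by rw [h.om_eq hb]; simp)
  -- The mate of the base is the parent of the top blossom, so its rank is smaller than all ranks in
  -- the cycle.
  · intro m hm hmB
    obtain ⟨hi, harc⟩ := h.cross_inner hc hm.symm hb (hbm m hm)
    have hr := h.rank_lt harc (h.om_ne_of_inner_arc hi harc)
    rw [h.rank_om (h.om_eq hb)] at hr
    rcases h.anc_rank (htop hmB) with e | e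
    · rw [h.rank_om e] at hr; exact lt_irrefl _ hr
    · omega
  · intro y hy
    have hy' := om_of hy
    rw [← List.cons_append, List.mem_append] at hy'
    rcases hy' with hy' | hy'
    · exact h.cycle_path (fun _ _ => .inl) huo hv (.inr (.inr ⟨rfl, rfl⟩)) (fun h => hn h.symm) hc
        hbp hl₁ hl₁' hl₂ hl₂' hd hy' (h.mem_om y)
    · obtain ⟨S, hS, hp⟩ := h.cycle_path (A := fun x y => F.arc x y ∨ (x = u ∧ y = v))
        (fun _ _ => .inl) hv huo (.inl (.inr ⟨rfl, rfl⟩)) hn hc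
        hbp hl₂ hl₂' hl₁ hl₁' hd.symm (List.mem_cons_of_mem _ hy') (h.mem_om y)
      refine ⟨S, fun a ha => ?_, hp⟩
      obtain ⟨Y, hY, haY⟩ := hS ha
      refine ⟨Y, ?_, haY⟩
      simp only [List.mem_cons, List.mem_append] at hY ⊢
      tauto
  -- As `u` and `v` lie in different blossoms, at least one side is nonempty; its first blossom is
  -- an inner vertex.
  · have : ∃ Z ∈ l₁ ++ l₂, F.TArc (F.om c) Z := by
      by_cases hcu : F.om c = F.om u
      · obtain ⟨Z, h1, h2⟩ := exists_tArc_from hl₂ hl₂' (List.mem_cons_self ..)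
          fun e => hne (hcu.symm.trans e)
        exact ⟨Z, by simp [h1], h2⟩
      · obtain ⟨Z, h1, h2⟩ := exists_tArc_from hl₁ hl₁' (List.mem_cons_self ..) hcu
        exact ⟨Z, by simp [h1], h2⟩
    obtain ⟨Z, hZ, hT⟩ := this
    obtain ⟨p, q, -, hq, -, -, rfl⟩ := h.tArc_outer hc hT
    exact ⟨q, of_om (List.mem_cons_of_mem _ hZ), hq⟩

end OK
end Forest
end MatchingPhase

namespace MatchingPhase

variable {V : Type*} {G : SimpleGraph V} {M : G.Subgraph}

namespace Forest

variable {F : Forest V} {ℓ : ℕ} {u v x y z p t b c q r m : V} {X : Set V}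

/-! ### Deleting structures -/

open Classical in
/-- The vertices of `X` are removed. -/
noncomputable def delete (F : Forest V) (X : Set V) : Forest V where
  om := fun x => if x ∈ X then {x} else F.om x
  arc := fun x y => F.arc x y ∧ x ∉ X
  inner := F.inner \ X
  vis := F.vis \ X
  label := F.label
  work := F.work \ X

/-- `X` is a union of trees of the forest. -/
structure DeleteHyp (F : Forest V) (X : Set V) : Prop where
  om : ∀ {x y}, F.om y = F.om x → x ∈ X → y ∈ X
  arc : ∀ {x y}, F.arc x y → (x ∈ X ↔ y ∈ X)

namespace DeleteHyp

theorem om_eq (hx : x ∉ X) : (F.delete X).om x = F.om x := if_neg hx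

theorem om_eq_of_mem (hx : x ∈ X) : (F.delete X).om x = {x} := if_pos hx

theorem dist_eq (hx : x ∉ X) : (F.delete X).dist M x = F.dist M x := by
  rw [dist, om_eq hx]; rfl

/-- No blossom or arc crosses the boundary of `X`, so each invariant restricts to the complement. -/
theorem ok (H : DeleteHyp F X) (h : F.OK M ℓ) : (F.delete X).OK M ℓ := by
  have om_X : ∀ {x y}, x ∉ X → F.om y = F.om x → y ∉ X := fun hx e hy => hx (H.om e.symm hy)
  refine
  { matching := h.matching, mem_om := ?_, om_eq := ?_, om_vis := ?_, arc_vis := ?_,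
    arc_adj := fun ha => h.arc_adj ha.1, inner_vis := fun x hx => ⟨h.inner_vis hx.1, hx.2⟩,
    inner_om := ?_, inner_parent := ?_,
    inner_child := ?_, arc_unique := fun hx ha hb => h.arc_unique hx.1 ha.1 hb.1,
    label_lt := ?_, crossing := ?_, mate := ?_, blossom := ?_,
    work_outer := fun x hx => ⟨⟨(h.work_outer hx.1).1, hx.2⟩, fun h' => (h.work_outer hx.1).2 h'.1⟩,
    work_om := ?_ }
  · intro x
    by_cases hx : x ∈ X
    · rw [om_eq_of_mem hx]; rfl
    · rw [om_eq hx]; exact h.mem_om x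
  · intro x y hy
    by_cases hx : x ∈ X
    · rw [om_eq_of_mem hx] at hy
      rw [hy]
    · rw [om_eq hx] at hy
      rw [om_eq hx, om_eq (om_X hx (h.om_eq hy)), h.om_eq hy]
  · intro x y hx hy
    rw [om_eq hx.2] at hy
    exact ⟨h.om_vis hx.1 hy, om_X hx.2 (h.om_eq hy)⟩
  · intro x y ha
    have := h.arc_vis ha.1
    exact ⟨⟨this.1, ha.2⟩, ⟨this.2, fun h' => ha.2 ((H.arc ha.1).2 h')⟩⟩
  · intro x hx
    rw [om_eq hx.2]; exact h.inner_om hx.1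
  · intro x hx
    obtain ⟨p, hp⟩ := h.inner_parent hx.1
    exact ⟨p, hp, fun h' => hx.2 ((H.arc hp).1 h')⟩
  · intro x hx
    obtain ⟨t, h1, h2⟩ := h.inner_child hx.1
    exact ⟨t, h1, h2, hx.2⟩
  · intro x p t hx ha hm
    rw [dist_eq ha.2]
    exact h.label_lt hx.1 ha.1 hm
  · intro x y ha hne
    have hy : y ∉ X := fun h' => ha.2 ((H.arc ha.1).2 h')
    rw [om_eq ha.2, om_eq hy] at hne
    rcases h.crossing ha.1 hne with ⟨h1, h2, h3⟩ | ⟨h1, h2, h3⟩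
    · exact .inl ⟨fun h' => h1 h'.1, ⟨h2, hy⟩, h3⟩
    · exact .inr ⟨⟨h1, ha.2⟩, fun h' => h2 h'.1, h3⟩
  · intro x y hx hm
    have hx' : x ∈ F.outer := ⟨hx.1.1, fun h' => hx.2 ⟨h', hx.1.2⟩⟩
    rcases h.mate hx' hm with e | hy
    · left
      rw [om_eq hx.1.2, om_eq (om_X hx.1.2 e), e]
    · exact .inr ⟨hy, fun h' => hx.1.2 ((H.arc (h.mate_of_inner hy hm.symm).2).1 h')⟩
  · intro x hx
    have hx' : x ∈ F.outer := ⟨hx.1.1, fun h' => hx.2 ⟨h', hx.1.2⟩⟩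
    rw [om_eq hx.1.2]
    obtain ⟨b', hb, hbm, hp⟩ := h.blossom hx'
    refine ⟨b', hb, hbm, fun y hy => ?_⟩
    obtain ⟨S, hS, hpS⟩ := hp y hy
    exact ⟨S, hS, hpS.mono fun a ha _ _ harc => ⟨harc, om_X hx.1.2 (h.om_eq (hS ha))⟩⟩
  · intro x y hx e
    rw [om_eq hx.2] at e
    by_cases hy : y ∈ X
    · rw [om_eq_of_mem hy] at e
      have := h.mem_om x
      rw [← e] at this
      exact absurd (this ▸ hy) hx.2
    · rw [om_eq hy] at e
      exact ⟨h.work_om hx.1 e, hy⟩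

theorem anc_iff (H : DeleteHyp F X) (h : F.OK M ℓ) (hx : x ∉ X) : (F.delete X).Anc x y ↔ F.Anc x y := by
  constructor
  · intro ha
    have : y ∉ X ∧ F.Anc x y := by
      induction ha with
      | refl => exact ⟨hx, .refl⟩
      | @tail z y h1 hs ih =>
        rcases hs with e | ⟨hs, hz⟩
        · rw [om_eq ih.1] at e
          by_cases hy : y ∈ X
          · rw [om_eq_of_mem hy] at e
            have := h.mem_om z
            rw [e] at this
            exact absurd (this ▸ hy) ih.1
          · rw [om_eq hy] at e
            exact ⟨hy, ih.2.tail (.inl e)⟩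
        · exact ⟨fun h' => hz ((H.arc hs).2 h'), ih.2.tail (.inr hs)⟩
    exact this.2
  · intro ha
    have : y ∉ X ∧ (F.delete X).Anc x y := by
      induction ha with
      | refl => exact ⟨hx, .refl⟩
      | @tail z y h1 hs ih =>
        rcases hs with e | hs
        · have hy : y ∉ X := fun h' => ih.1 (H.om e h')
          exact ⟨hy, ih.2.tail (.inl (by rw [om_eq ih.1, om_eq hy, e]))⟩
        · exact ⟨fun h' => ih.1 ((H.arc hs).2 h'), ih.2.tail (.inr ⟨hs, ih.1⟩)⟩
    exact this.2

theorem anc_mem (H : DeleteHyp F X) (ha : F.Anc x y) : x ∈ X ↔ y ∈ X := by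
  induction ha with
  | refl => rfl
  | @tail z y h1 hs ih =>
    rw [ih]
    rcases hs with e | hs
    · exact ⟨H.om e.symm, H.om e⟩
    · exact H.arc hs

theorem act_iff (H : DeleteHyp F X) (h : F.OK M ℓ) (hx : x ∉ X) : (F.delete X).Act x ↔ F.Act x := by
  constructor
  · rintro ⟨w, hw, ha⟩
    exact ⟨w, hw.1, (H.anc_iff h hx).1 ha⟩
  · rintro ⟨w, hw, ha⟩
    exact ⟨w, ⟨hw, fun h' => hx ((H.anc_mem ha).2 h')⟩, (H.anc_iff h hx).2 ha⟩

theorem crit_subset (H : DeleteHyp F X) (h : F.OK M ℓ) : (F.delete X).crit M ⊆ F.crit M := by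
  rintro ⟨v, t⟩ ⟨hm, hi, ha⟩
  have ht : t ∉ X := fun h' => hi.2 ((H.arc (h.mate_of_inner hi.1 hm).2).2 h')
  exact ⟨hm, hi.1, (H.act_iff h ht).1 ha⟩

theorem sub_subset (H : DeleteHyp F X) (h : F.OK M ℓ) (hx : x ∉ X) : (F.delete X).sub x ⊆ F.sub x :=
  fun _ hy => (H.anc_iff h hx).1 hy

end DeleteHyp

/-! ### Tree paths -/

namespace OK

/-- Being unmatched inside the blossom characterises the base, which turns the existential base of
the invariant into any such vertex at hand. -/
theorem eq_base (h : F.OK M ℓ) (hx : x ∈ F.outer) (hy : y ∈ F.om x)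
    (hn : ∀ m, M.Adj y m → m ∉ F.om x) :
    ∀ z ∈ F.om x, ∃ S ⊆ F.om x, AltPath M F.arc y z S := by
  obtain ⟨b', hb, hbm, hp⟩ := h.blossom hx
  have : y = b' := by
    by_contra hne
    obtain ⟨S, hS, hpS⟩ := hp y hy
    obtain ⟨z, hz, hcz⟩ := hpS.mate_mem hpS.right_mem hne
    exact hn z hcz (hS hz)
  subst this
  exact hp

/-- The base of an outer blossom is unique. -/
theorem base_unique (h : F.OK M ℓ) (hx : x ∈ F.outer) (hy : y ∈ F.om x) (hz : z ∈ F.om x)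
    (hny : ∀ m, M.Adj y m → m ∉ F.om x) (hnz : ∀ m, M.Adj z m → m ∉ F.om x) : z = y := by
  by_contra hne
  obtain ⟨S, hS, hpS⟩ := h.eq_base hx hy hny z hz
  obtain ⟨a, ha, hza⟩ := hpS.mate_mem hpS.right_mem hne
  exact hnz a hza (hS ha)

theorem chain_of_anc (ha : F.Anc x y) :
    ∃ l, (F.om x :: l).IsChain F.TArc ∧ (F.om x :: l).getLast? = some (F.om y) := by
  induction ha with
  | refl => exact ⟨[], by simp, by simp⟩
  | @tail z y h1 hs ih =>
    obtain ⟨l, h2, h3⟩ := ih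
    by_cases e : F.om z = F.om y
    · exact ⟨l, h2, by rw [h3, e]⟩
    · refine ⟨l ++ [F.om y], ?_, ?_⟩
      · rw [← List.cons_append, List.isChain_append]
        refine ⟨h2, by simp, ?_⟩
        intro a ha d hd
        rw [h3] at ha
        simp only [Option.mem_def, Option.some.injEq, List.head?_cons] at ha hd
        subst ha hd
        exact ⟨e, z, y, hs.resolve_left e, rfl, rfl⟩
      · rw [← List.cons_append, List.getLast?_append]; simp

theorem anc_last (h : F.OK M ℓ) {l : List (Set V)} (hl : (F.om x :: l).IsChain F.TArc)
    (hlast : (F.om x :: l).getLast? = some (F.om z)) (hy : F.om y ∈ F.om x :: l) :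
    F.Anc y z := by
  rcases List.mem_cons.1 hy with e | hy
  · rcases l.eq_nil_or_concat with rfl | ⟨l', Z, rfl⟩
    · simp only [List.getLast?_singleton, Option.some.injEq] at hlast
      exact anc_of_om (e.trans hlast)
    · have : Z = F.om z := by
        rw [List.concat_eq_append, ← List.cons_append, List.getLast?_append] at hlast
        simpa using hlast
      obtain ⟨z', -, e', ha, -⟩ := h.chain_mem hl (Y := Z) (by simp)
      exact ((anc_of_om e).trans ha).tail (.inl (e'.trans this))
  · obtain ⟨l', l'', rfl⟩ := List.append_of_mem hy
    have hch : (F.om y :: l'').IsChain F.TArc :=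
      (List.isChain_append.1 (show ((F.om x :: l') ++ F.om y :: l'').IsChain _ from hl)).2.1
    have hlast' : (F.om y :: l'').getLast? = some (F.om z) := by
      rwa [← List.cons_append, List.getLast?_append_of_ne_nil _ (by simp)] at hlast
    rcases l''.eq_nil_or_concat with rfl | ⟨l', Z, rfl⟩
    · simp only [List.getLast?_singleton, Option.some.injEq] at hlast'
      exact anc_of_om hlast'
    · have : Z = F.om z := by
        rw [List.concat_eq_append, ← List.cons_append, List.getLast?_append] at hlast'
        simpa using hlast'
      obtain ⟨z', -, e', ha, -⟩ := h.chain_mem hch (Y := Z) (by simp)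
      exact ha.tail (.inl (e'.trans this))

/-- Two vertices of a tree are joined by two tree paths that start at a common blossom and are
otherwise disjoint. -/
theorem exists_cycle (h : F.OK M ℓ) (hx : F.Anc r x) (hy : F.Anc r y) :
    ∃ c l₁ l₂, F.Anc r c ∧
      (F.om c :: l₁).IsChain F.TArc ∧ (F.om c :: l₁).getLast? = some (F.om x) ∧
      (F.om c :: l₂).IsChain F.TArc ∧ (F.om c :: l₂).getLast? = some (F.om y) ∧
      l₁.Disjoint l₂ := by
  induction hn : F.rank M x - F.rank M r using Nat.strong_induction_on generalizing r with
  | _ n ih =>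
  obtain ⟨l₁, h1, h2⟩ := chain_of_anc hx
  obtain ⟨l₂, h3, h4⟩ := chain_of_anc hy
  by_cases hd : l₁.Disjoint l₂
  · exact ⟨r, l₁, l₂, .refl, h1, h2, h3, h4, hd⟩
  -- If the two descents from `r` share a later blossom, restart from it. Its rank exceeds that of
  -- `r` but not that of `x`, so this ends at the lowest common ancestor.
  · simp only [List.Disjoint, not_forall] at hd
    obtain ⟨Z, hZ1, hZ2, -⟩ := hd
    obtain ⟨z, -, rfl, ha, hr⟩ := h.chain_mem h1 hZ1
    have hzx := h.anc_last h1 h2 (List.mem_cons_of_mem _ hZ1)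
    have hzy := h.anc_last h3 h4 (List.mem_cons_of_mem _ hZ2)
    have hzr : F.rank M z ≤ F.rank M x := by
      rcases h.anc_rank hzx with e | e
      · rw [h.rank_om e]
      · exact e.le
    obtain ⟨c, l₁, l₂, h5, h6⟩ := ih _ (by omega) hzx hzy rfl
    exact ⟨c, l₁, l₂, ha.trans h5, h6⟩

/-- The even alternating path from a root to an outer vertex of its tree. -/
theorem root_path (h : F.OK M ℓ) (hr : r ∈ F.outer) (hf : Free M r) (hx : x ∈ F.outer)
    (ha : F.Anc r x) : ∃ S ⊆ F.sub r, AltPath M F.arc r x S := by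
  obtain ⟨l, h1, h2⟩ := chain_of_anc ha
  obtain ⟨S, hS, hp⟩ := h.chain_path l hr
    (h.eq_base hr (h.mem_om r) fun m hm => absurd hm (hf m)) h1 h2 hx x (h.mem_om x)
  refine ⟨S, fun a haS => ?_, hp⟩
  obtain ⟨Y, hY, haY⟩ := hS haS
  rcases List.mem_cons.1 hY with rfl | hY
  · exact anc_of_om (h.om_eq haY).symm
  · obtain ⟨y, -, rfl, h3, -⟩ := h.chain_mem h1 hY
    exact h3.tail (.inl (h.om_eq haY).symm)

end OK
end Forest
end MatchingPhase

namespace MatchingPhase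

variable {V : Type*} {G : SimpleGraph V} {M : G.Subgraph}

/-! ### The forest of a state -/

/-- The forest of all structures of the state `s`, with `I` as the set of inner vertices. -/
def State.forest (s : State M) (I : Set V) : Forest V where
  om := s.Om
  arc := fun x y => ∃ α, (x, y) ∈ (s.struct α).arcs
  inner := I
  vis := {x | ∃ α, x ∈ (s.struct α).verts}
  label := s.label
  work := {x | ∃ α, (s.struct α).working = some (s.Om x)}

/-- The invariants on the division of the forest into structures, and on labels. -/
structure Own (ℓ : ℕ) (s : State M) (I : Set V) : Prop where
  disj : ∀ {x α β}, x ∈ (s.struct α).verts → x ∈ (s.struct β).verts → α = β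
  arcs : ∀ {x y α}, (x, y) ∈ (s.struct α).arcs → x ∈ (s.struct α).verts ∧ y ∈ (s.struct α).verts
  blossom_subset : ∀ {B α}, B ∈ (s.struct α).blossoms → B ⊆ (s.struct α).verts
  blossom_nonempty : ∀ {B α}, B ∈ (s.struct α).blossoms → B.Nonempty
  root_free : ∀ {x α}, x ∈ (s.struct α).verts → Free M α
  root_mem : ∀ {x α}, x ∈ (s.struct α).verts → α ∈ (s.struct α).verts
  free_eq : ∀ {x α}, x ∈ (s.struct α).verts → Free M x → x = α
  cover : ∀ {x}, Free M x → x ∉ s.removed → x ∈ (s.struct x).verts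
  not_removed : ∀ {x α}, x ∈ (s.struct α).verts → x ∉ s.removed
  removed_mate : ∀ {x y}, x ∈ s.removed → M.Adj x y → y ∈ s.removed
  working : ∀ {α W}, (s.struct α).working = some W →
    ∃ w ∈ (s.struct α).verts, w ∉ I ∧ W = s.Om w
  label_le : ∀ {x y}, M.Adj x y → s.label x y ≤ ℓ + 1
  label_vis : ∀ {x y}, M.Adj x y → s.label x y ≤ ℓ → (∃ α, x ∈ (s.struct α).verts) ∨ x ∈ s.removed

/-- The structural invariants of a state. -/
structure Inv (ℓ : ℕ) (s : State M) (I : Set V) : Prop where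
  ok : (s.forest I).OK M ℓ
  own : Own ℓ s I

theorem State.mem_Om (s : State M) (x : V) : x ∈ s.Om x := .inl rfl

namespace Inv

variable {ℓ : ℕ} {s : State M} {I : Set V} {u v x y z p t w α β : V} {X Y : Set V}

theorem om_verts (h : Inv ℓ s I) (hx : x ∈ (s.struct α).verts) (hy : y ∈ s.Om x) :
    y ∈ (s.struct α).verts := by
  rcases hy with rfl | ⟨B, ⟨hxB, γ, hB⟩, hyB⟩
  · exact hx
  · have := h.own.disj hx (h.own.blossom_subset hB hxB)
    subst this
    exact h.own.blossom_subset hB hyB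

theorem verts_of_om (h : Inv ℓ s I) (hx : x ∈ (s.struct α).verts) (e : s.Om y = s.Om x) :
    y ∈ (s.struct α).verts :=
  h.om_verts hx (e ▸ s.mem_Om y)

theorem om_unvisited (h : Inv ℓ s I) (hx : ∀ α, x ∉ (s.struct α).verts) : s.Om x = {x} := by
  ext y
  constructor
  · rintro (rfl | ⟨B, ⟨hxB, γ, hB⟩, hyB⟩)
    · rfl
    · exact absurd (h.own.blossom_subset hB hxB) (hx γ)
  · rintro rfl
    exact s.mem_Om y

theorem arc_verts (h : Inv ℓ s I) (ha : (s.forest I).arc x y) :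
    x ∈ (s.struct α).verts ↔ y ∈ (s.struct α).verts := by
  obtain ⟨γ, hγ⟩ := ha
  obtain ⟨h1, h2⟩ := h.own.arcs hγ
  constructor
  · intro hx
    rwa [h.own.disj hx h1]
  · intro hx
    rwa [h.own.disj hx h2]

theorem arc_struct (h : Inv ℓ s I) (ha : (s.forest I).arc x y) (hx : x ∈ (s.struct α).verts) :
    (x, y) ∈ (s.struct α).arcs := by
  obtain ⟨γ, hγ⟩ := ha
  rwa [h.own.disj hx (h.own.arcs hγ).1]

theorem anc_verts (h : Inv ℓ s I) (ha : (s.forest I).Anc x y) :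
    x ∈ (s.struct α).verts ↔ y ∈ (s.struct α).verts := by
  induction ha with
  | refl => rfl
  | tail _ hs ih =>
    rw [ih]
    rcases hs with e | hs
    · exact ⟨fun hx => h.verts_of_om hx e.symm, fun hx => h.verts_of_om hx e⟩
    · exact h.arc_verts hs

theorem tArc_forest (hT : s.TArc α X Y) : (s.forest I).TArc X Y := by
  obtain ⟨hne, x, y, hxy, e1, e2⟩ := hT
  exact ⟨hne, x, y, ⟨α, hxy⟩, e1, e2⟩

theorem tArc_of_forest (h : Inv ℓ s I) (hx : x ∈ (s.struct α).verts)
    (hT : (s.forest I).TArc (s.Om x) Y) : s.TArc α (s.Om x) Y ∧ ∃ y ∈ (s.struct α).verts, s.Om y = Y := by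
  obtain ⟨hne, a, d, had, e1, e2⟩ := hT
  have ha := h.verts_of_om hx e1
  exact ⟨⟨hne, a, d, h.arc_struct had ha, e1, e2⟩, d, (h.arc_verts had).1 ha, e2⟩

theorem chain_of_forest (h : Inv ℓ s I) {l : List (Set V)} (hx : x ∈ (s.struct α).verts)
    (hl : (s.Om x :: l).IsChain (s.forest I).TArc) : (s.Om x :: l).IsChain (s.TArc α) := by
  induction l generalizing x with
  | nil => simp
  | cons Y l ih =>
    rw [List.isChain_cons_cons] at hl ⊢
    obtain ⟨h1, y, hy, rfl⟩ := h.tArc_of_forest hx hl.1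
    exact ⟨h1, ih hy hl.2⟩

theorem inSubtree_iff (h : Inv ℓ s I) (hx : x ∈ (s.struct α).verts) :
    s.InSubtree α (s.Om x) (s.Om y) ↔ (s.forest I).Anc x y := by
  constructor
  · intro ha
    have : ∀ Y, s.InSubtree α (s.Om x) Y → ∀ y, s.Om y = Y → (s.forest I).Anc x y := by
      intro Y hY
      induction hY with
      | refl => exact fun y e => .single (.inl e.symm)
      | tail _ hT ih =>
        rintro y rfl
        obtain ⟨-, a, d, had, e1, e2⟩ := hT
        exact ((ih a e1).tail (.inr ⟨α, had⟩)).tail (.inl e2)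
    exact this _ ha y rfl
  · intro ha
    induction ha with
    | refl => exact .refl
    | @tail y z h1 hs ih =>
      by_cases e : s.Om y = s.Om z
      · rwa [← e]
      · have hy := (h.anc_verts (α := α) h1).1 hx
        have := hs.resolve_left e
        exact ih.tail ⟨e, y, z, h.arc_struct this hy, rfl, rfl⟩

theorem moved_eq (h : Inv ℓ s I) (hx : x ∈ (s.struct α).verts) :
    s.moved α x = (s.forest I).sub x := by
  ext y
  constructor
  · rintro ⟨-, h2⟩
    exact (h.inSubtree_iff hx).1 h2
  · intro hy
    exact ⟨(h.anc_verts hy).1 hx, (h.inSubtree_iff hx).2 hy⟩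

theorem root_outer (h : Inv ℓ s I) (hx : x ∈ (s.struct α).verts) :
    α ∈ (s.forest I).outer := by
  refine ⟨⟨α, h.own.root_mem hx⟩, fun hi => ?_⟩
  obtain ⟨t, ht, -⟩ := h.ok.inner_child hi
  exact h.own.root_free hx t ht

/-- The free vertex found above `x` lies in the same structure, whose only free vertex is `α`. -/
theorem root_anc (h : Inv ℓ s I) (hx : x ∈ (s.struct α).verts) : (s.forest I).Anc α x := by
  obtain ⟨r, -, hf, ha⟩ := h.ok.exists_root (x := x) ⟨α, hx⟩
  have := h.own.free_eq ((h.anc_verts ha).2 hx) hf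
  rwa [this] at ha

theorem mate_verts (h : Inv ℓ s I) (hx : x ∈ (s.struct α).verts) (hm : M.Adj x y) :
    y ∈ (s.struct α).verts := by
  by_cases hi : x ∈ I
  · exact (h.arc_verts (h.ok.mate_of_inner hi hm).2).1 hx
  · rcases h.ok.mate ⟨⟨α, hx⟩, hi⟩ hm with e | hi'
    · exact h.verts_of_om hx e
    · exact (h.arc_verts (h.ok.mate_of_inner hi' hm.symm).2).2 hx

theorem exists_dirPath {T : Set V → Set V → Prop} (ha : Relation.ReflTransGen T X Y) :
    ∃ n, DirPath T X Y n := by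
  induction ha with
  | refl => exact ⟨0, .nil _⟩
  | tail _ hT ih => exact ih.imp' (· + 1) fun _ h => h.snoc hT

/-- The root blossom is outer and each arc of the contracted tree switches between inner and outer,
so membership in `I` follows the parity of the depth. -/
theorem dirPath_parity (h : Inv ℓ s I) (hx : x ∈ (s.struct α).verts) {n : ℕ}
    (hp : DirPath (s.TArc α) (s.Om α) Y n) : ∀ y, s.Om y = Y → (y ∈ I ↔ Odd n) := by
  induction hp with
  | nil =>
    intro y e
    have := h.ok.not_inner_om (h.root_outer hx).2 e
    simp only [Nat.not_odd_zero, iff_false]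
    exact this
  | @snoc X Y n _ hT ih =>
    rintro y rfl
    obtain ⟨hne, a, d, had, e1, e2⟩ := hT
    have h1 := ih a e1
    have h2 : y ∈ I ↔ d ∈ I := by
      constructor
      · intro hy
        rwa [h.ok.eq_of_om_inner hy e2]
      · intro hd
        rwa [h.ok.eq_of_om_inner hd e2.symm]
    rw [h2, Nat.odd_add_one, ← h1]
    rcases h.ok.crossing ⟨α, had⟩ (by
      change s.Om a ≠ s.Om d
      rw [e1, e2]; exact hne) with h3 | h3
    · exact ⟨fun _ => h3.1, fun _ => h3.2.1⟩
    · exact ⟨fun h4 => absurd h4 h3.2.1, fun h4 => absurd h3.1 h4⟩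

/-- This identifies the set `I` carried by the invariants with the notion used by the algorithm;
from here on the depth in the tree plays no role. -/
theorem inner_iff (h : Inv ℓ s I) : s.Inner α v ↔ v ∈ (s.struct α).verts ∧ v ∈ I := by
  constructor
  · rintro ⟨hv, n, hn, hp⟩
    exact ⟨hv, (h.dirPath_parity hv hp v rfl).2 hn⟩
  · rintro ⟨hv, hi⟩
    obtain ⟨n, hp⟩ := exists_dirPath ((h.inSubtree_iff (h.own.root_mem hv)).2 (h.root_anc hv))
    exact ⟨hv, n, (h.dirPath_parity hv hp v rfl).1 hi, hp⟩

theorem outer_iff (h : Inv ℓ s I) : s.Outer α v ↔ v ∈ (s.struct α).verts ∧ v ∉ I := by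
  rw [State.Outer, h.inner_iff]
  tauto

theorem exists_outer_iff (h : Inv ℓ s I) : (∃ α, s.Outer α v) ↔ v ∈ (s.forest I).outer := by
  constructor
  · rintro ⟨α, hα⟩
    rw [h.outer_iff] at hα
    exact ⟨⟨α, hα.1⟩, hα.2⟩
  · rintro ⟨⟨α, hα⟩, hi⟩
    exact ⟨α, h.outer_iff.2 ⟨hα, hi⟩⟩

/-- `distance` of an outer vertex is its distance in the forest. -/
theorem distance_iff (h : Inv ℓ s I) (hu : u ∈ (s.forest I).outer) {d : ℕ} :
    s.Distance u d ↔ d = (s.forest I).dist M u := by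
  obtain ⟨b, hb, hbm, hp⟩ := h.ok.blossom hu
  have free_base : ∀ x ∈ s.Om u, Free M x → x = b := fun x hx hf =>
    h.ok.base_unique hu hb hx hbm fun m hm => absurd hm (hf m)
  by_cases hf : Free M b
  · have h0 : (s.forest I).dist M u = 0 := by
      refine distOf_eq_zero fun m c hm hc => ?_
      by_contra hmo
      have : c = b := h.ok.base_unique hu hb hc hbm
        fun m' hm' => h.ok.matching.eq_of_adj_left hm' hm.symm ▸ hmo
      exact hf m (this ▸ hm.symm)
    rw [h0]
    constructor
    · rintro (⟨-, rfl⟩ | ⟨h1, -⟩)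
      · rfl
      · exact absurd hf (h1 b hb)
    · rintro rfl
      exact .inl ⟨⟨b, hb, hf⟩, rfl⟩
  · have hnf : ∀ x ∈ s.Om u, ¬ Free M x := fun x hx hfx => hf (free_base x hx hfx ▸ hfx)
    simp only [Free, not_forall, not_not] at hf
    obtain ⟨m, hm⟩ := hf
    have hd := h.ok.dist_of_cross hu hm.symm hb (hbm m hm)
    rw [hd]
    constructor
    · rintro (⟨⟨x, hx, hfx⟩, -⟩ | ⟨-, x, y, hxy, hx, hy, rfl⟩)
      · exact absurd hfx (hnf x hx)
      · exact (h.ok.dist_of_cross hu hxy hy hx).symm.trans hd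
    · rintro rfl
      exact .inr ⟨hnf, m, b, hm.symm, hbm m hm, hb, rfl⟩

theorem work_iff (h : Inv ℓ s I) : x ∈ (s.forest I).work ↔
    ∃ α, x ∈ (s.struct α).verts ∧ (s.struct α).working = some (s.Om x) := by
  constructor
  · rintro ⟨α, hα⟩
    obtain ⟨w, hw, -, e⟩ := h.own.working hα
    exact ⟨α, h.verts_of_om hw e, hα⟩
  · rintro ⟨α, -, hα⟩
    exact ⟨α, hα⟩

theorem working_verts (h : Inv ℓ s I) (hα : (s.struct α).working = some (s.Om x)) :
    x ∈ (s.struct α).verts ∧ x ∉ I := by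
  obtain ⟨w, hw, hwi, e⟩ := h.own.working hα
  exact ⟨h.verts_of_om hw e, h.ok.not_inner_om hwi e⟩

/-- The root is the base of its blossom and is free, so no matched arc enters the blossom. -/
theorem dist_root (h : Inv ℓ s I) (hx : x ∈ (s.struct α).verts) : (s.forest I).dist M α = 0 := by
  have hα := h.root_outer hx
  refine distOf_eq_zero fun m c hm hc => ?_
  by_contra hmo
  have : c = α := h.ok.base_unique hα (h.ok.mem_om α) hc
    (fun m hm => absurd hm (h.own.root_free hx m))
    fun m' hm' => h.ok.matching.eq_of_adj_left hm' hm.symm ▸ hmo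
  exact h.own.root_free hx m (this ▸ hm.symm)

/-- No inner vertex is an ancestor of a root. -/
theorem not_anc_free (h : Inv ℓ s I) (hv : v ∈ I) (hf : Free M x) : ¬ (s.forest I).Anc v x := by
  intro ha
  obtain ⟨α, hα⟩ := h.ok.inner_vis hv
  obtain ⟨t, hm, -⟩ := h.ok.inner_child hv
  have hx := (h.anc_verts ha).1 hα
  obtain rfl := h.own.free_eq hx hf
  have h1 := h.ok.label_le_dist hv hm (h.root_outer hx).2 ha
  have h2 := h.ok.label_pos hv hm
  rw [h.dist_root hx] at h1
  omega

end Inv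
end MatchingPhase

namespace MatchingPhase

variable {V : Type*} {G : SimpleGraph V} {M : G.Subgraph}

/-! ### The basic operations preserve the invariants -/

/-- Root blossoms depend only on the union of all blossom families, and trivial blossoms never
enlarge them. -/
theorem Om_congr {s s' : State M}
    (h1 : ∀ γ B, B ∈ (s.struct γ).blossoms → ∃ γ', B ∈ (s'.struct γ').blossoms)
    (h2 : ∀ γ B, B ∈ (s'.struct γ).blossoms →
      (∃ γ', B ∈ (s.struct γ').blossoms) ∨ ∃ x, B = {x}) : s'.Om = s.Om := by
  ext x y
  constructor
  · rintro (rfl | ⟨B, ⟨hx, γ, hB⟩, hy⟩)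
    · exact s.mem_Om y
    · rcases h2 γ B hB with h | ⟨z, rfl⟩
      · exact .inr ⟨B, ⟨hx, h⟩, hy⟩
      · obtain rfl : x = z := hx
        obtain rfl : y = x := hy
        exact s.mem_Om y
  · rintro (rfl | ⟨B, ⟨hx, γ, hB⟩, hy⟩)
    · exact s'.mem_Om y
    · exact .inr ⟨B, ⟨hx, h1 γ B hB⟩, hy⟩

variable {ℓ : ℕ} {s s' : State M} {I : Set V} {α β u v t p x y : V} {k : ℕ}

open Classical in
/-- The state after an unvisited matched arc has been added. -/
noncomputable def State.addArc (s : State M) (α u v t : V) (k : ℕ) : State M :=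
  { s with
    label := s.setLabel v t k
    struct := fun γ => if γ = α then
        { verts := (s.struct α).verts ∪ {v, t}
          arcs := (s.struct α).arcs ∪ {(u, v), (v, t)}
          blossoms := (s.struct α).blossoms ∪ {{v}, {t}}
          working := some (s.Om t) }
      else s.struct γ
    modified := insert α s.modified }

/-! ### Overtaking an arc that is in no structure. -/

section AddArc

theorem addArc_verts {γ : V} : x ∈ ((s.addArc α u v t k).struct γ).verts ↔
    x ∈ (s.struct γ).verts ∨ (γ = α ∧ (x = v ∨ x = t)) := by
  by_cases h : γ = α
  · subst h; simp [State.addArc]; tauto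
  · simp [State.addArc, h]

theorem addArc_arcs {γ : V} : (x, y) ∈ ((s.addArc α u v t k).struct γ).arcs ↔
    (x, y) ∈ (s.struct γ).arcs ∨ (γ = α ∧ ((x = u ∧ y = v) ∨ (x = v ∧ y = t))) := by
  by_cases h : γ = α
  · subst h; simp [State.addArc]; tauto
  · simp [State.addArc, h]

theorem addArc_blossoms {γ : V} {B : Set V} : B ∈ ((s.addArc α u v t k).struct γ).blossoms ↔
    B ∈ (s.struct γ).blossoms ∨ (γ = α ∧ (B = {v} ∨ B = {t})) := by
  by_cases h : γ = α
  · subst h; simp [State.addArc]; tauto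
  · simp [State.addArc, h]

theorem addArc_working_self : ((s.addArc α u v t k).struct α).working = some (s.Om t) := by
  simp [State.addArc]

theorem addArc_struct_ne {γ : V} (h : γ ≠ α) : (s.addArc α u v t k).struct γ = s.struct γ := by
  simp [State.addArc, h]

theorem addArc_Om : (s.addArc α u v t k).Om = s.Om := by
  refine Om_congr (fun γ B hB => ⟨γ, addArc_blossoms.2 (.inl hB)⟩) fun γ B hB => ?_
  rcases addArc_blossoms.1 hB with h | ⟨-, h | h⟩
  · exact .inl ⟨γ, h⟩
  · exact .inr ⟨v, h⟩
  · exact .inr ⟨t, h⟩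

theorem Inv.addHyp (h : Inv ℓ s I) (hv : ∀ β, v ∉ (s.struct β).verts)
    (hw : (s.struct α).working = some (s.Om u)) (hadj : G.Adj u v) (hn : ¬ M.Adj u v)
    (hm : M.Adj v t) (hk : (s.forest I).dist M u < k) (hkl : k ≤ ℓ) :
    (s.forest I).AddHyp M ℓ u v t k where
  not_vis := fun ⟨β, hβ⟩ => hv β hβ
  om_v := h.om_unvisited hv
  om_t := h.om_unvisited fun β hβ => hv β (h.mate_verts hβ hm.symm)
  work := ⟨α, hw⟩
  adj := hadj
  not_matched := hn
  matched := hm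
  dist_lt := hk
  le := hkl

theorem Inv.addArc_forest (h : Inv ℓ s I) (hv : ∀ β, v ∉ (s.struct β).verts)
    (hw : (s.struct α).working = some (s.Om u)) (hm : M.Adj v t) :
    (s.addArc α u v t k).forest (insert v I) = (s.forest I).add u v t k := by
  have ht : ∀ β, t ∉ (s.struct β).verts := fun β hβ => hv β (h.mate_verts hβ hm.symm)
  have hot := h.om_unvisited ht
  have huw := h.working_verts hw
  ext1
  · exact addArc_Om
  · ext x y
    simp only [State.forest, addArc_arcs, Forest.add]
    constructor
    · rintro ⟨γ, h1 | ⟨-, h1⟩⟩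
      · exact .inl ⟨γ, h1⟩
      · exact .inr h1
    · rintro (⟨γ, h1⟩ | h1)
      · exact ⟨γ, .inl h1⟩
      · exact ⟨α, .inr ⟨rfl, h1⟩⟩
  · rfl
  · ext x
    simp only [State.forest, addArc_verts, Forest.add, Set.mem_ofPred_eq, Set.mem_union,
      Set.mem_insert_iff, Set.mem_singleton_iff]
    constructor
    · rintro ⟨γ, h1 | ⟨-, h1⟩⟩
      · exact .inl ⟨γ, h1⟩
      · exact .inr h1
    · rintro (⟨γ, h1⟩ | h1)
      · exact ⟨γ, .inl h1⟩
      · exact ⟨α, .inr ⟨rfl, h1⟩⟩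
  · rfl
  · ext x
    change (∃ γ, ((s.addArc α u v t k).struct γ).working = some ((s.addArc α u v t k).Om x)) ↔
      ((∃ γ, (s.struct γ).working = some (s.Om x)) ∧ x ∉ s.Om u) ∨ x = t
    rw [addArc_Om]
    constructor
    · rintro ⟨γ, hγ⟩
      by_cases e : γ = α
      · subst e
        rw [addArc_working_self, hot, Option.some.injEq] at hγ
        right
        have := s.mem_Om x
        rwa [← hγ] at this
      · rw [addArc_struct_ne e] at hγ
        left
        refine ⟨⟨γ, hγ⟩, fun hx => e ?_⟩
        exact h.own.disj (h.working_verts hγ).1 (h.om_verts huw.1 hx)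
    · rintro (⟨⟨γ, hγ⟩, hx⟩ | rfl)
      · refine ⟨γ, ?_⟩
        rw [addArc_struct_ne]
        · exact hγ
        · rintro rfl
          rw [hγ, Option.some.injEq] at hw
          exact hx (hw ▸ s.mem_Om x)
      · exact ⟨α, addArc_working_self⟩

theorem setLabel_le (hk : k ≤ s.label v t) (x y : V) : s.setLabel v t k x y ≤ s.label x y :=
  Forest.setLabel_le (F := s.forest ∅) hk x y

theorem Inv.addArc (h : Inv ℓ s I) (hv : ∀ β, v ∉ (s.struct β).verts) (hvr : v ∉ s.removed)
    (hw : (s.struct α).working = some (s.Om u)) (hadj : G.Adj u v) (hn : ¬ M.Adj u v)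
    (hm : M.Adj v t) (hk : (s.forest I).dist M u < k) (hkl : k < s.label v t) :
    Inv ℓ (s.addArc α u v t k) (insert v I) := by
  have ht : ∀ β, t ∉ (s.struct β).verts := fun β hβ => hv β (h.mate_verts hβ hm.symm)
  have hu := h.working_verts hw
  have hle := h.own.label_le hm
  have H := h.addHyp hv hw hadj hn hm hk (by omega)
  refine ⟨?_, ?_⟩
  · rw [h.addArc_forest hv hw hm]
    exact H.ok h.ok
  · have vt_free : ∀ {x}, x = v ∨ x = t → ¬ Free M x := by
      rintro x (rfl | rfl) hf
      · exact hf _ hm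
      · exact hf _ hm.symm
    have vt_vis : ∀ {x} γ, x = v ∨ x = t → x ∉ (s.struct γ).verts := by
      rintro x γ (rfl | rfl)
      · exact hv γ
      · exact ht γ
    refine
    { disj := ?_, arcs := ?_, blossom_subset := ?_, blossom_nonempty := ?_, root_free := ?_,
      root_mem := ?_, free_eq := ?_, cover := ?_, not_removed := ?_,
      removed_mate := h.own.removed_mate, working := ?_, label_le := ?_, label_vis := ?_ }
    · intro x γ δ hγ hδ
      rcases addArc_verts.1 hγ with h1 | ⟨rfl, h1⟩ <;> rcases addArc_verts.1 hδ with h2 | ⟨rfl, h2⟩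
      · exact h.own.disj h1 h2
      · exact absurd h1 (vt_vis _ h2)
      · exact absurd h2 (vt_vis _ h1)
      · rfl
    · intro x y γ hγ
      rw [addArc_verts, addArc_verts]
      rcases addArc_arcs.1 hγ with h1 | ⟨rfl, ⟨rfl, rfl⟩ | ⟨rfl, rfl⟩⟩
      · exact (h.own.arcs h1).imp .inl .inl
      · exact ⟨.inl hu.1, .inr ⟨rfl, .inl rfl⟩⟩
      · exact ⟨.inr ⟨rfl, .inl rfl⟩, .inr ⟨rfl, .inr rfl⟩⟩
    · intro B γ hγ x hx
      rw [addArc_verts]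
      rcases addArc_blossoms.1 hγ with h1 | ⟨rfl, rfl | rfl⟩
      · exact .inl (h.own.blossom_subset h1 hx)
      · exact .inr ⟨rfl, .inl hx⟩
      · exact .inr ⟨rfl, .inr hx⟩
    · intro B γ hγ
      rcases addArc_blossoms.1 hγ with h1 | ⟨rfl, rfl | rfl⟩
      · exact h.own.blossom_nonempty h1
      · exact ⟨v, rfl⟩
      · exact ⟨t, rfl⟩
    · intro x γ hγ
      rcases addArc_verts.1 hγ with h1 | ⟨rfl, -⟩
      · exact h.own.root_free h1
      · exact h.own.root_free hu.1
    · intro x γ hγ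
      rw [addArc_verts]
      rcases addArc_verts.1 hγ with h1 | ⟨rfl, -⟩
      · exact .inl (h.own.root_mem h1)
      · exact .inl (h.own.root_mem hu.1)
    · intro x γ hγ hf
      rcases addArc_verts.1 hγ with h1 | ⟨rfl, h1⟩
      · exact h.own.free_eq h1 hf
      · exact absurd hf (vt_free h1)
    · intro x hf hx
      exact addArc_verts.2 (.inl (h.own.cover hf hx))
    · intro x γ hγ
      rcases addArc_verts.1 hγ with h1 | ⟨rfl, rfl | rfl⟩
      · exact h.own.not_removed h1
      · exact hvr
      · exact fun hx => hvr (h.own.removed_mate hx hm.symm)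
    · intro γ W hW
      rw [addArc_Om]
      by_cases e : γ = α
      · subst e
        rw [addArc_working_self, Option.some.injEq] at hW
        refine ⟨t, addArc_verts.2 (.inr ⟨rfl, .inr rfl⟩), ?_, hW.symm⟩
        rintro (e | hi)
        · exact hm.ne e.symm
        · obtain ⟨δ, hδ⟩ := h.ok.inner_vis hi
          exact ht δ hδ
      · rw [addArc_struct_ne e] at hW
        obtain ⟨w, h1, h2, h3⟩ := h.own.working hW
        refine ⟨w, addArc_verts.2 (.inl h1), ?_, h3⟩
        rintro (rfl | hi)
        · exact hv _ h1
        · exact h2 hi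
    · intro x y hxy
      exact (setLabel_le hkl.le x y).trans (h.own.label_le hxy)
    · intro x y hxy hl
      by_cases e : x = v ∧ y = t
      · exact .inl ⟨α, addArc_verts.2 (.inr ⟨rfl, .inl e.1⟩)⟩
      · have hl' : s.label x y ≤ ℓ := by
          have : (s.addArc α u v t k).label x y = s.label x y := if_neg e
          rwa [this] at hl
        refine (h.own.label_vis hxy hl').imp_left ?_
        rintro ⟨γ, hγ⟩
        exact ⟨γ, addArc_verts.2 (.inl hγ)⟩

end AddArc

/-! Moving a subtree. -/

/-- A description of the state `s'` after the subtree of `v` has been moved from `p` to `u`. -/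
structure MoveSpec (s s' : State M) (I : Set V) (α p u v t : V) (k : ℕ) (W : Set V) : Prop where
  removed : s'.removed = s.removed
  label : s'.label = s.setLabel v t k
  verts : ∀ {x γ}, x ∈ (s'.struct γ).verts ↔ (x ∈ (s.forest I).sub v ∧ γ = α) ∨
    (x ∉ (s.forest I).sub v ∧ x ∈ (s.struct γ).verts)
  arcs : ∀ {x y γ}, (x, y) ∈ (s'.struct γ).arcs ↔ (x = u ∧ y = v ∧ γ = α) ∨
    (y ∈ (s.forest I).sub v ∧ γ = α ∧ (s.forest I).arc x y ∧ ¬ (x = p ∧ y = v)) ∨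
    (y ∉ (s.forest I).sub v ∧ (x, y) ∈ (s.struct γ).arcs)
  om : s'.Om = s.Om
  blossom_subset : ∀ {B γ}, B ∈ (s'.struct γ).blossoms → B ⊆ (s'.struct γ).verts
  blossom_nonempty : ∀ {B γ}, B ∈ (s'.struct γ).blossoms → B.Nonempty
  working : ∀ {γ W}, (s'.struct γ).working = some W →
    ∃ w ∈ (s'.struct γ).verts, w ∉ I ∧ W = s.Om w
  work : ∀ {x}, x ∈ W ↔ ∃ γ, (s'.struct γ).working = some (s.Om x)

namespace MoveSpec

variable {W : Set V}

theorem forest_eq (S : MoveSpec s s' I α p u v t k W) (h : Inv ℓ s I)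
    (H : (s.forest I).MoveHyp M p u v t k) :
    s'.forest I = (s.forest I).move p u v t k W := by
  ext1
  · exact S.om
  · ext x y
    simp only [State.forest, S.arcs, Forest.move]
    constructor
    · rintro ⟨γ, ⟨rfl, rfl, rfl⟩ | ⟨-, -, h1⟩ | ⟨h1, h2⟩⟩
      · exact .inr ⟨rfl, rfl⟩
      · exact .inl h1
      · refine .inl ⟨⟨γ, h2⟩, ?_⟩
        rintro ⟨-, rfl⟩
        exact h1 .refl
    · rintro (⟨⟨γ, h1⟩, h2⟩ | ⟨rfl, rfl⟩)
      · by_cases hy : y ∈ (s.forest I).sub v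
        · exact ⟨α, .inr (.inl ⟨hy, rfl, ⟨γ, h1⟩, h2⟩)⟩
        · exact ⟨γ, .inr (.inr ⟨hy, h1⟩)⟩
      · exact ⟨α, .inl ⟨rfl, rfl, rfl⟩⟩
  · rfl
  · ext x
    simp only [State.forest, S.verts, Forest.move, Set.mem_ofPred_eq]
    constructor
    · rintro ⟨γ, ⟨h1, -⟩ | ⟨-, h1⟩⟩
      · exact h.ok.anc_vis (h.ok.inner_vis H.inner) h1
      · exact ⟨γ, h1⟩
    · rintro ⟨γ, h1⟩
      by_cases hx : x ∈ (s.forest I).sub v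
      · exact ⟨α, .inl ⟨hx, rfl⟩⟩
      · exact ⟨γ, .inr ⟨hx, h1⟩⟩
  · exact S.label
  · ext x
    simp only [State.forest, Forest.move, Set.mem_ofPred_eq, S.om]
    exact S.work.symm

theorem inv (S : MoveSpec s s' I α p u v t k W) (h : Inv ℓ s I)
    (H : (s.forest I).MoveHyp M p u v t k) (hu : u ∈ (s.struct α).verts) : Inv ℓ s' I := by
  have hW : ∀ x, x ∈ W ↔ x ∈ (s'.forest I).work := by
    intro x
    rw [S.work]
    simp only [State.forest, Set.mem_ofPred_eq, S.om]
  have sub_vis : ∀ {x}, x ∈ (s.forest I).sub v → ∃ γ, x ∈ (s.struct γ).verts := fun hx =>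
    h.ok.anc_vis (h.ok.inner_vis H.inner) hx
  -- Roots are never moved, which is why each structure keeps its own root.
  have free_sub : ∀ {x}, Free M x → x ∉ (s.forest I).sub v := fun hf ha =>
    h.not_anc_free H.inner hf ha
  have vis' : ∀ {x}, (∃ γ, x ∈ (s.struct γ).verts) → ∃ γ, x ∈ (s'.struct γ).verts := by
    rintro x ⟨γ, hγ⟩
    by_cases hx : x ∈ (s.forest I).sub v
    · exact ⟨α, S.verts.2 (.inl ⟨hx, rfl⟩)⟩
    · exact ⟨γ, S.verts.2 (.inr ⟨hx, hγ⟩)⟩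
  refine ⟨?_, ?_⟩
  · rw [S.forest_eq h H]
    refine H.ok h.ok ?_ ?_
    · intro x hx
      obtain ⟨γ, hγ⟩ := S.work.1 hx
      obtain ⟨w, h1, h2, h3⟩ := S.working hγ
      refine h.ok.outer_om ⟨?_, h2⟩ h3
      rcases S.verts.1 h1 with h4 | h4
      · exact sub_vis h4.1
      · exact ⟨γ, h4.2⟩
    · intro x y hx e
      rw [S.work] at hx ⊢
      have e' : s.Om y = s.Om x := e
      rwa [e']
  · refine
    { disj := ?_, arcs := ?_, blossom_subset := S.blossom_subset,
      blossom_nonempty := S.blossom_nonempty, root_free := ?_,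
      root_mem := ?_, free_eq := ?_, cover := ?_, not_removed := ?_,
      removed_mate := ?_, working := ?_, label_le := ?_, label_vis := ?_ }
    · intro x γ δ hγ hδ
      rcases S.verts.1 hγ with ⟨h1, rfl⟩ | ⟨h1, h2⟩ <;> rcases S.verts.1 hδ with ⟨h3, rfl⟩ | ⟨h3, h4⟩
      · rfl
      · exact absurd h1 h3
      · exact absurd h3 h1
      · exact h.own.disj h2 h4
    · intro x y γ hγ
      rw [S.verts, S.verts]
      rcases S.arcs.1 hγ with ⟨rfl, rfl, rfl⟩ | ⟨h1, rfl, h2, h3⟩ | ⟨h1, h2⟩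
      · exact ⟨.inr ⟨H.not_anc_u h.ok, hu⟩, .inl ⟨.refl, rfl⟩⟩
      · refine ⟨.inl ⟨?_, rfl⟩, .inl ⟨h1, rfl⟩⟩
        by_cases e : s.Om x = s.Om y
        · exact h1.tail (.inl e.symm)
        · refine h.ok.anc_parent h1 h2 e fun e' => ?_
          obtain rfl := h.ok.eq_of_om_inner H.inner e'.symm
          exact h3 ⟨h.ok.arc_unique H.inner h2 H.arc, rfl⟩
      · refine ⟨.inr ⟨fun hx => h1 (hx.tail (.inr ⟨γ, h2⟩)), (h.own.arcs h2).1⟩,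
          .inr ⟨h1, (h.own.arcs h2).2⟩⟩
    · intro x γ hγ
      rcases S.verts.1 hγ with ⟨-, rfl⟩ | ⟨-, h1⟩
      · exact h.own.root_free hu
      · exact h.own.root_free h1
    · intro x γ hγ
      rw [S.verts]
      rcases S.verts.1 hγ with ⟨-, rfl⟩ | ⟨-, h1⟩
      · exact .inr ⟨free_sub (h.own.root_free hu), h.own.root_mem hu⟩
      · exact .inr ⟨free_sub (h.own.root_free h1), h.own.root_mem h1⟩
    · intro x γ hγ hf
      rcases S.verts.1 hγ with ⟨h1, rfl⟩ | ⟨-, h1⟩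
      · exact absurd h1 (free_sub hf)
      · exact h.own.free_eq h1 hf
    · intro x hf hx
      rw [S.removed] at hx
      exact S.verts.2 (.inr ⟨free_sub hf, h.own.cover hf hx⟩)
    · intro x γ hγ
      rw [S.removed]
      rcases S.verts.1 hγ with ⟨h1, rfl⟩ | ⟨-, h1⟩
      · obtain ⟨δ, hδ⟩ := sub_vis h1
        exact h.own.not_removed hδ
      · exact h.own.not_removed h1
    · rw [S.removed]
      exact h.own.removed_mate
    · rw [S.om]
      exact S.working
    · intro x y hxy
      rw [S.label]
      exact (setLabel_le H.lt_label.le x y).trans (h.own.label_le hxy)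
    · intro x y hxy hl
      rw [S.removed]
      by_cases e : x = v ∧ y = t
      · exact .inl (vis' (e.1 ▸ h.ok.inner_vis H.inner))
      · have hl' : s.label x y ≤ ℓ := by
          have : s'.label x y = s.label x y := by rw [S.label]; exact if_neg e
          rwa [this] at hl
        exact (h.own.label_vis hxy hl').imp_left vis'

end MoveSpec
end MatchingPhase

namespace MatchingPhase

variable {V : Type*} {G : SimpleGraph V} {M : G.Subgraph}
variable {ℓ : ℕ} {s s' : State M} {I : Set V} {α β u v t p x y : V} {k : ℕ}

open Classical in
/-- The state after a subtree has been moved inside the structure of `α`. -/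
noncomputable def State.moveSame (s : State M) (α u v t : V) (k : ℕ) (p : V) : State M :=
  { s with
    label := s.setLabel v t k
    struct := fun γ => if γ = α then
        { verts := (s.struct α).verts
          arcs := ((s.struct α).arcs \ {(p, v)}) ∪ {(u, v)}
          blossoms := (s.struct α).blossoms
          working := some (s.Om t) }
      else s.struct γ
    modified := insert α s.modified }

open Classical in
/-- The state after a subtree has been moved from the structure of `β` to that of `α`. -/
noncomputable def State.moveOther (s : State M) (α u v t : V) (k : ℕ) (β p : V) : State M :=
  { s with
    label := s.setLabel v t k
    struct := fun γ =>
      if γ = α then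
        { verts := (s.struct α).verts ∪ s.moved β v
          arcs := (s.struct α).arcs ∪ {(u, v)} ∪
            {e | e ∈ (s.struct β).arcs ∧ e.1 ∈ s.moved β v ∧ e.2 ∈ s.moved β v}
          blossoms := (s.struct α).blossoms ∪
            {B | B ∈ (s.struct β).blossoms ∧ B ⊆ s.moved β v}
          working :=
            if ∃ W, (s.struct β).working = some W ∧ s.InSubtree β (s.Om t) W
            then (s.struct β).working else some (s.Om t) }
      else if γ = β then
        { verts := (s.struct β).verts \ s.moved β v
          arcs := {e | e ∈ (s.struct β).arcs ∧ e ≠ (p, v) ∧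
            ¬ (e.1 ∈ s.moved β v ∧ e.2 ∈ s.moved β v)}
          blossoms := {B | B ∈ (s.struct β).blossoms ∧ ¬ B ⊆ s.moved β v}
          working :=
            if ∃ W, (s.struct β).working = some W ∧ s.InSubtree β (s.Om t) W
            then some (s.Om p) else (s.struct β).working }
      else s.struct γ
    modified := s.modified ∪ {α, β} }

theorem Inv.act_iff (h : Inv ℓ s I) (hx : x ∈ (s.struct α).verts) :
    (s.forest I).Act x ↔ ∃ w, (s.struct α).working = some (s.Om w) ∧ (s.forest I).Anc x w := by
  constructor
  · rintro ⟨w, hw, ha⟩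
    obtain ⟨γ, hγ, hγ'⟩ := h.work_iff.1 hw
    obtain rfl := h.own.disj hγ ((h.anc_verts ha).1 hx)
    exact ⟨w, hγ', ha⟩
  · rintro ⟨w, hw, ha⟩
    exact ⟨w, ⟨α, hw⟩, ha⟩

/-! ### Overtaking inside a single structure. -/

section MoveSame

variable (h : Inv ℓ s I) (H : (s.forest I).MoveHyp M p u v t k)
  (hw : (s.struct α).working = some (s.Om u)) (hv : v ∈ (s.struct α).verts)
include h H hw hv

/-- The only working vertex of the structure is the blossom of `u`, and that is not below `v`. So
here the working vertex never travels with the subtree. -/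
theorem Inv.moveSame_not_act : ¬ (s.forest I).Act t := by
  rw [h.act_iff (h.mate_verts hv H.matched)]
  rintro ⟨w, hw', ha⟩
  rw [hw, Option.some.injEq] at hw'
  exact H.not_anc_u h.ok (((H.anc_v_t h.ok).trans ha).tail (.inl hw'.symm))

theorem Inv.moveSame_spec :
    MoveSpec s (s.moveSame α u v t k p) I α p u v t k
      (((s.forest I).work \ s.Om u) ∪ s.Om t) := by
  have hu := h.working_verts hw
  have ht := h.ok.mate_of_inner H.inner H.matched
  have sub_α : ∀ {x}, x ∈ (s.forest I).sub v → x ∈ (s.struct α).verts :=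
    fun hx => (h.anc_verts hx).1 hv
  have st_α : (s.moveSame α u v t k p).struct α =
    { verts := (s.struct α).verts
      arcs := ((s.struct α).arcs \ {(p, v)}) ∪ {(u, v)}
      blossoms := (s.struct α).blossoms
      working := some (s.Om t) } := if_pos rfl
  have st_ne : ∀ {γ}, γ ≠ α → (s.moveSame α u v t k p).struct γ = s.struct γ := fun e => if_neg e
  have hverts : ∀ γ, ((s.moveSame α u v t k p).struct γ).verts = (s.struct γ).verts := by
    intro γ
    by_cases e : γ = α
    · subst e; rw [st_α]
    · rw [st_ne e]
  have hbl : ∀ γ, ((s.moveSame α u v t k p).struct γ).blossoms = (s.struct γ).blossoms := by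
    intro γ
    by_cases e : γ = α
    · subst e; rw [st_α]
    · rw [st_ne e]
  refine
  { removed := rfl, label := rfl, verts := ?_, arcs := ?_, om := ?_, blossom_subset := ?_,
    blossom_nonempty := ?_, working := ?_, work := ?_ }
  · intro x γ
    rw [hverts]
    constructor
    · intro hx
      by_cases e : x ∈ (s.forest I).sub v
      · exact .inl ⟨e, h.own.disj hx (sub_α e)⟩
      · exact .inr ⟨e, hx⟩
    · rintro (⟨hx, rfl⟩ | ⟨-, hx⟩)
      · exact sub_α hx
      · exact hx
  · intro x y γ
    by_cases e : γ = α
    · subst e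
      rw [st_α]
      simp only [Set.mem_union, Set.mem_sdiff, Set.mem_singleton_iff, Prod.mk.injEq, and_true,
        true_and]
      constructor
      · rintro (⟨h1, h2⟩ | h1)
        · by_cases hy : y ∈ (s.forest I).sub v
          · exact .inr (.inl ⟨hy, ⟨γ, h1⟩, h2⟩)
          · exact .inr (.inr ⟨hy, h1⟩)
        · exact .inl h1
      · rintro (h1 | ⟨h1, h2, h3⟩ | ⟨h1, h2⟩)
        · exact .inr h1
        · exact .inl ⟨h.arc_struct h2 ((h.arc_verts h2).2 (sub_α h1)), h3⟩
        · refine .inl ⟨h2, ?_⟩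
          rintro ⟨-, rfl⟩
          exact h1 .refl
    · rw [st_ne e]
      simp only [e, and_false, false_and, false_or]
      exact ⟨fun h1 => ⟨fun h2 => e (h.own.disj (h.own.arcs h1).2 (sub_α h2)), h1⟩, fun h1 => h1.2⟩
  · refine Om_congr (fun γ B hB => ⟨γ, ?_⟩) fun γ B hB => .inl ⟨γ, ?_⟩
    · rwa [hbl]
    · rwa [hbl] at hB
  · intro B γ
    rw [hbl, hverts]
    exact h.own.blossom_subset
  · intro B γ
    rw [hbl]
    exact h.own.blossom_nonempty
  · intro γ W hW
    rw [hverts]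
    by_cases e : γ = α
    · subst e
      rw [st_α] at hW
      exact ⟨t, h.mate_verts hv H.matched, ht.1.2, (Option.some.inj hW).symm⟩
    · rw [st_ne e] at hW
      exact h.own.working hW
  · intro x
    constructor
    · rintro (⟨⟨γ, hγ⟩, hx⟩ | hx)
      · refine ⟨γ, ?_⟩
        rw [st_ne]
        · exact hγ
        · rintro rfl
          rw [hγ, Option.some.injEq] at hw
          exact hx (hw ▸ s.mem_Om x)
      · exact ⟨α, by rw [st_α]; exact congrArg some (h.ok.om_eq (x := t) hx).symm⟩
    · rintro ⟨γ, hγ⟩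
      by_cases e : γ = α
      · subst e
        rw [st_α, Option.some.injEq] at hγ
        exact .inr (hγ ▸ s.mem_Om x)
      · rw [st_ne e] at hγ
        refine .inl ⟨⟨γ, hγ⟩, fun hx => e ?_⟩
        exact h.own.disj (h.working_verts hγ).1 (h.om_verts hu.1 hx)

end MoveSame

/-! ### Overtaking from another structure. -/

section MoveOther

variable (h : Inv ℓ s I) (H : (s.forest I).MoveHyp M p u v t k)
  (hw : (s.struct α).working = some (s.Om u)) (hβ : β ≠ α) (hv : v ∈ (s.struct β).verts)
include h H hw hβ hv

-- No structure other than that of `β` has a working vertex below `t`, so the test made by the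
-- operation decides whether `t` is active in the whole forest.
omit hw hβ in
theorem Inv.carry_iff : (∃ W, (s.struct β).working = some W ∧ s.InSubtree β (s.Om t) W) ↔
    (s.forest I).Act t := by
  have ht := h.mate_verts hv H.matched
  rw [h.act_iff ht]
  constructor
  · rintro ⟨W, h1, h2⟩
    obtain ⟨w, -, -, rfl⟩ := h.own.working h1
    exact ⟨w, h1, (h.inSubtree_iff ht).1 h2⟩
  · rintro ⟨w, h1, h2⟩
    exact ⟨_, h1, (h.inSubtree_iff ht).2 h2⟩

-- The set of vertices in working blossoms always loses the blossom of `u`. It gains that of `p` if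
-- the working vertex of `β` is handed over to `α`, and that of `t` otherwise.
open Classical in
theorem Inv.moveOther_spec :
    MoveSpec s (s.moveOther α u v t k β p) I α p u v t k
      (((s.forest I).work \ s.Om u) ∪ (if (s.forest I).Act t then s.Om p else s.Om t)) := by
  have hu := h.working_verts hw
  have ht := h.ok.mate_of_inner H.inner H.matched
  have htβ := h.mate_verts hv H.matched
  have hp := h.ok.parent H.inner H.arc
  have hpβ := (h.arc_verts H.arc).2 hv
  have hmv : s.moved β v = (s.forest I).sub v := h.moved_eq hv
  have hcarry := h.carry_iff H hv
  have sub_β : ∀ {x}, x ∈ (s.forest I).sub v → x ∈ (s.struct β).verts :=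
    fun hx => (h.anc_verts hx).1 hv
  have hact := h.act_iff (I := I) htβ
  have st_α : (s.moveOther α u v t k β p).struct α =
      { verts := (s.struct α).verts ∪ (s.forest I).sub v
        arcs := (s.struct α).arcs ∪ {(u, v)} ∪
          {e | e ∈ (s.struct β).arcs ∧ e.1 ∈ (s.forest I).sub v ∧ e.2 ∈ (s.forest I).sub v}
        blossoms := (s.struct α).blossoms ∪
          {B | B ∈ (s.struct β).blossoms ∧ B ⊆ (s.forest I).sub v}
        working := if (s.forest I).Act t then (s.struct β).working else some (s.Om t) } := by
    simp only [State.moveOther, if_pos, hcarry, hmv]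
  have st_β : (s.moveOther α u v t k β p).struct β =
      { verts := (s.struct β).verts \ (s.forest I).sub v
        arcs := {e | e ∈ (s.struct β).arcs ∧ e ≠ (p, v) ∧
          ¬ (e.1 ∈ (s.forest I).sub v ∧ e.2 ∈ (s.forest I).sub v)}
        blossoms := {B | B ∈ (s.struct β).blossoms ∧ ¬ B ⊆ (s.forest I).sub v}
        working := if (s.forest I).Act t then some (s.Om p) else (s.struct β).working } := by
    simp only [State.moveOther, if_pos, if_neg hβ, hcarry, hmv]
  have st_ne : ∀ {γ}, γ ≠ α → γ ≠ β → (s.moveOther α u v t k β p).struct γ = s.struct γ :=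
    fun e e' => by simp only [State.moveOther, if_neg e, if_neg e']
  have not_sub : ∀ {x γ}, x ∈ (s.struct γ).verts → γ ≠ β → x ∉ (s.forest I).sub v :=
    fun hx e hs => e (h.own.disj hx (sub_β hs))
  have hbl : ∀ {B γ}, B ∈ ((s.moveOther α u v t k β p).struct γ).blossoms →
      ∃ δ, B ∈ (s.struct δ).blossoms := by
    intro B γ hB
    by_cases e : γ = α
    · subst e
      rw [st_α] at hB
      rcases hB with hB | hB
      · exact ⟨_, hB⟩
      · exact ⟨_, hB.1⟩
    · by_cases e' : γ = β
      · subst e'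
        rw [st_β] at hB
        exact ⟨_, hB.1⟩
      · rw [st_ne e e'] at hB
        exact ⟨_, hB⟩
  refine
  { removed := rfl, label := rfl, verts := ?_, arcs := ?_, om := ?_, blossom_subset := ?_,
    blossom_nonempty := ?_, working := ?_, work := ?_ }
  · intro x γ
    by_cases e : γ = α
    · subst e
      rw [st_α]
      simp only [Set.mem_union, and_true]
      constructor
      · rintro (h1 | h1)
        · exact .inr ⟨not_sub h1 hβ.symm, h1⟩
        · exact .inl h1
      · rintro (h1 | h1)
        · exact .inr h1
        · exact .inl h1.2
    · by_cases e' : γ = β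
      · subst e'
        rw [st_β]
        simp only [Set.mem_sdiff, e, and_false, false_or]
        exact and_comm
      · rw [st_ne e e']
        simp only [e, and_false, false_or]
        exact ⟨fun h1 => ⟨not_sub h1 e', h1⟩, fun h1 => h1.2⟩
  · intro x y γ
    by_cases e : γ = α
    · subst e
      rw [st_α]
      simp only [Set.mem_union, Set.mem_singleton_iff, Prod.mk.injEq, Set.mem_ofPred_eq, and_true,
        true_and]
      constructor
      · rintro ((h1 | h1) | ⟨h1, h2, h3⟩)
        · exact .inr (.inr ⟨not_sub (h.own.arcs h1).2 hβ.symm, h1⟩)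
        · exact .inl h1
        · refine .inr (.inl ⟨h3, ⟨β, h1⟩, ?_⟩)
          rintro ⟨rfl, rfl⟩
          exact H.not_anc_p h.ok h2
      · rintro (h1 | ⟨h1, h2, h3⟩ | ⟨h1, h2⟩)
        · exact .inl (.inr h1)
        · refine .inr ⟨h.arc_struct h2 ((h.arc_verts h2).2 (sub_β h1)), ?_, h1⟩
          by_cases e : s.Om x = s.Om y
          · exact h1.tail (.inl e.symm)
          · refine h.ok.anc_parent h1 h2 e fun e' => ?_
            obtain rfl := h.ok.eq_of_om_inner H.inner e'.symm
            exact h3 ⟨h.ok.arc_unique H.inner h2 H.arc, rfl⟩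
        · exact .inl (.inl h2)
    · by_cases e' : γ = β
      · subst e'
        rw [st_β]
        simp only [Set.mem_ofPred_eq, e, and_false, false_and, false_or, ne_eq, Prod.mk.injEq]
        constructor
        · rintro ⟨h1, h2, h3⟩
          refine ⟨fun h4 => h3 ⟨?_, h4⟩, h1⟩
          by_cases e : s.Om x = s.Om y
          · exact h4.tail (.inl e.symm)
          · refine h.ok.anc_parent h4 ⟨_, h1⟩ e fun e' => ?_
            obtain rfl := h.ok.eq_of_om_inner H.inner e'.symm
            exact h2 ⟨h.ok.arc_unique H.inner ⟨_, h1⟩ H.arc, rfl⟩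
        · rintro ⟨h1, h2⟩
          refine ⟨h2, ?_, fun h3 => h1 h3.2⟩
          rintro ⟨-, rfl⟩
          exact h1 .refl
      · rw [st_ne e e']
        simp only [e, and_false, false_and, false_or]
        exact ⟨fun h1 => ⟨not_sub (h.own.arcs h1).2 e', h1⟩, fun h1 => h1.2⟩
  · refine Om_congr (fun γ B hB => ?_) fun γ B hB => .inl (hbl hB)
    by_cases e : γ = α
    · subst e
      exact ⟨γ, by rw [st_α]; exact .inl hB⟩
    · by_cases e' : γ = β
      · subst e'
        by_cases e2 : B ⊆ (s.forest I).sub v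
        · exact ⟨α, by rw [st_α]; exact .inr ⟨hB, e2⟩⟩
        · exact ⟨γ, by rw [st_β]; exact ⟨hB, e2⟩⟩
      · exact ⟨γ, by rwa [st_ne e e']⟩
  · intro B γ hB
    by_cases e : γ = α
    · subst e
      rw [st_α] at hB ⊢
      rcases hB with hB | hB
      · exact fun x hx => .inl (h.own.blossom_subset hB hx)
      · exact fun x hx => .inr (hB.2 hx)
    · by_cases e' : γ = β
      · subst e'
        rw [st_β] at hB ⊢
        intro x hx
        -- A blossom lies within one root blossom, so it is contained in the moved subtree as soon
        -- as it meets it.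
        refine ⟨h.own.blossom_subset hB.1 hx, fun hs => hB.2 fun y hy => ?_⟩
        have : y ∈ s.Om x := .inr ⟨B, ⟨hx, _, hB.1⟩, hy⟩
        exact Relation.ReflTransGen.tail hs (.inl (h.ok.om_eq this).symm)
      · rw [st_ne e e'] at hB ⊢
        exact h.own.blossom_subset hB
  · intro B γ hB
    obtain ⟨δ, hδ⟩ := hbl hB
    exact h.own.blossom_nonempty hδ
  · intro γ W hW
    by_cases e : γ = α
    · subst e
      rw [st_α] at hW ⊢
      by_cases ha : (s.forest I).Act t
      · simp only [if_pos ha] at hW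
        obtain ⟨w, h1, h2⟩ := hact.1 ha
        rw [h1, Option.some.injEq] at hW
        exact ⟨w, .inr ((H.anc_v_t h.ok).trans h2), (h.working_verts h1).2, hW.symm⟩
      · simp only [if_neg ha, Option.some.injEq] at hW
        exact ⟨t, .inr (H.anc_v_t h.ok), ht.1.2, hW.symm⟩
    · by_cases e' : γ = β
      · subst e'
        rw [st_β] at hW ⊢
        by_cases ha : (s.forest I).Act t
        · simp only [if_pos ha, Option.some.injEq] at hW
          exact ⟨p, ⟨hpβ, H.not_anc_p h.ok⟩, hp.1.2, hW.symm⟩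
        · simp only [if_neg ha] at hW
          obtain ⟨w, h1, h2, rfl⟩ := h.own.working hW
          refine ⟨w, ⟨h1, fun hs => ha ?_⟩, h2, rfl⟩
          refine hact.2 ⟨w, hW, h.ok.anc_mate H.inner H.matched hs ?_⟩
          rintro rfl
          exact h2 H.inner
      · rw [st_ne e e'] at hW ⊢
        exact h.own.working hW
  · intro x
    have hαu : ∀ {γ}, (s.struct γ).working = some (s.Om x) → (γ = α ↔ x ∈ s.Om u) := by
      intro γ hγ
      constructor
      · rintro rfl
        rw [hγ, Option.some.injEq] at hw
        exact hw ▸ s.mem_Om x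
      · intro hx
        exact h.own.disj (h.working_verts hγ).1 (h.om_verts hu.1 hx)
    by_cases ha : (s.forest I).Act t
    · rw [if_pos ha]
      simp only [if_pos ha] at st_α st_β
      constructor
      · rintro (⟨⟨γ, hγ⟩, hx⟩ | hx)
        · have e : γ ≠ α := fun e => hx ((hαu hγ).1 e)
          by_cases e' : γ = β
          · subst e'
            exact ⟨α, by rw [st_α]; exact hγ⟩
          · exact ⟨γ, by rw [st_ne e e']; exact hγ⟩
        · exact ⟨β, by rw [st_β]; exact congrArg some (h.ok.om_eq (x := p) hx).symm⟩
      · rintro ⟨γ, hγ⟩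
        by_cases e : γ = α
        · subst e
          rw [st_α] at hγ
          exact .inl ⟨⟨β, hγ⟩, fun hx => hβ ((hαu hγ).2 hx)⟩
        · by_cases e' : γ = β
          · subst e'
            rw [st_β, Option.some.injEq] at hγ
            exact .inr (hγ ▸ s.mem_Om x)
          · rw [st_ne e e'] at hγ
            exact .inl ⟨⟨γ, hγ⟩, fun hx => e ((hαu hγ).2 hx)⟩
    · rw [if_neg ha]
      simp only [if_neg ha] at st_α st_β
      constructor
      · rintro (⟨⟨γ, hγ⟩, hx⟩ | hx)
        · have e : γ ≠ α := fun e => hx ((hαu hγ).1 e)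
          by_cases e' : γ = β
          · subst e'
            exact ⟨γ, by rw [st_β]; exact hγ⟩
          · exact ⟨γ, by rw [st_ne e e']; exact hγ⟩
        · exact ⟨α, by rw [st_α]; exact congrArg some (h.ok.om_eq (x := t) hx).symm⟩
      · rintro ⟨γ, hγ⟩
        by_cases e : γ = α
        · subst e
          rw [st_α, Option.some.injEq] at hγ
          exact .inr (hγ ▸ s.mem_Om x)
        · by_cases e' : γ = β
          · subst e'
            rw [st_β] at hγ
            exact .inl ⟨⟨γ, hγ⟩, fun hx => e ((hαu hγ).2 hx)⟩
          · rw [st_ne e e'] at hγ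
            exact .inl ⟨⟨γ, hγ⟩, fun hx => e ((hαu hγ).2 hx)⟩

end MoveOther
end MatchingPhase

namespace MatchingPhase

variable {V : Type*} {G : SimpleGraph V} {M : G.Subgraph}
variable {ℓ : ℕ} {s s' : State M} {I : Set V} {α β u v t p x y b c : V} {k : ℕ} {B : Set V}

open Classical in
/-- The state after `B` has been contracted. -/
noncomputable def State.contract (s : State M) (α u v : V) (B : Set V) : State M :=
  { s with
    label := fun x y => if M.Adj x y ∧ x ∈ B ∧ y ∈ B then 0 else s.label x y
    struct := fun γ => if γ = α then
        { verts := (s.struct α).verts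
          arcs := insert (u, v) (s.struct α).arcs
          blossoms := insert B (s.struct α).blossoms
          working := some B }
      else s.struct γ
    modified := insert α s.modified }

/-! ### The effect of Contract on a state. -/

section Contract

theorem contract_verts {γ : V} : ((s.contract α u v B).struct γ).verts = (s.struct γ).verts := by
  by_cases e : γ = α
  · subst e; simp [State.contract]
  · simp [State.contract, e]

theorem contract_struct_ne {γ : V} (e : γ ≠ α) : (s.contract α u v B).struct γ = s.struct γ :=
  if_neg e

theorem contract_working : ((s.contract α u v B).struct α).working = some B := by
  simp [State.contract]

theorem contract_arcs {γ : V} : (x, y) ∈ ((s.contract α u v B).struct γ).arcs ↔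
    (x, y) ∈ (s.struct γ).arcs ∨ (γ = α ∧ x = u ∧ y = v) := by
  by_cases e : γ = α
  · subst e; simp [State.contract]; tauto
  · simp [State.contract, e]

theorem contract_blossoms {γ : V} {B' : Set V} :
    B' ∈ ((s.contract α u v B).struct γ).blossoms ↔
    B' ∈ (s.struct γ).blossoms ∨ (γ = α ∧ B' = B) := by
  by_cases e : γ = α
  · subst e; simp [State.contract]; tauto
  · simp [State.contract, e]

variable (h : Inv ℓ s I) (hw : (s.struct α).working = some (s.Om u))
  (H : (s.forest I).CycleHyp M u v B c b)
include h hw H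

theorem Inv.cycle_verts (hx : x ∈ B) : x ∈ (s.struct α).verts := by
  have hu := h.working_verts hw
  exact (h.anc_verts (H.top hx)).1 ((h.anc_verts (H.top H.u_mem)).2 hu.1)

omit hw in
theorem Inv.contract_Om : (s.contract α u v B).Om = ((s.forest I).contract M u v B).om := by
  ext x y
  by_cases hx : x ∈ B
  · rw [Forest.contract_om_mem hx]
    constructor
    · rintro (rfl | ⟨B', ⟨hxB, γ, hB⟩, hy⟩)
      · exact hx
      · rcases contract_blossoms.1 hB with hB | ⟨-, rfl⟩
        · exact H.om_subset h.ok hx (.inr ⟨B', ⟨hxB, γ, hB⟩, hy⟩)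
        · exact hy
    · intro hy
      exact .inr ⟨B, ⟨hx, α, contract_blossoms.2 (.inr ⟨rfl, rfl⟩)⟩, hy⟩
  · rw [Forest.contract_om_not_mem hx]
    constructor
    · rintro (rfl | ⟨B', ⟨hxB, γ, hB⟩, hy⟩)
      · exact s.mem_Om y
      · rcases contract_blossoms.1 hB with hB | ⟨-, rfl⟩
        · exact .inr ⟨B', ⟨hxB, γ, hB⟩, hy⟩
        · exact absurd hxB hx
    · rintro (rfl | ⟨B', ⟨hxB, γ, hB⟩, hy⟩)
      · exact State.mem_Om _ y
      · exact .inr ⟨B', ⟨hxB, γ, contract_blossoms.2 (.inl hB)⟩, hy⟩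

theorem Inv.contract_forest :
    (s.contract α u v B).forest (I \ B) = (s.forest I).contract M u v B := by
  have hu := h.working_verts hw
  have hOm := h.contract_Om (α := α) H
  ext1
  · exact hOm
  · ext x y
    simp only [State.forest, contract_arcs, Forest.contract]
    constructor
    · rintro ⟨γ, h1 | ⟨-, h1⟩⟩
      · exact .inl ⟨γ, h1⟩
      · exact .inr h1
    · rintro (⟨γ, h1⟩ | h1)
      · exact ⟨γ, .inl h1⟩
      · exact ⟨α, .inr ⟨rfl, h1⟩⟩
  · rfl
  · ext x
    simp only [State.forest, contract_verts, Forest.contract]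
  · rfl
  · ext x
    change (∃ γ, ((s.contract α u v B).struct γ).working = some ((s.contract α u v B).Om x)) ↔
      ((∃ γ, (s.struct γ).working = some (s.Om x)) ∧ x ∉ s.Om u) ∨ x ∈ B
    rw [hOm]
    by_cases hx : x ∈ B
    · rw [Forest.contract_om_mem hx]
      exact ⟨fun _ => .inr hx, fun _ => ⟨α, contract_working⟩⟩
    · rw [Forest.contract_om_not_mem hx]
      have hxu : x ∉ s.Om u := fun h' => hx (H.om_subset h.ok H.u_mem h')
      simp only [hxu, not_false_eq_true, and_true, hx, or_false]
      constructor
      · rintro ⟨γ, hγ⟩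
        by_cases e : γ = α
        · subst e
          rw [contract_working, Option.some.injEq] at hγ
          exact absurd (hγ ▸ s.mem_Om x) hx
        · rw [contract_struct_ne e] at hγ
          exact ⟨γ, hγ⟩
      · rintro ⟨γ, hγ⟩
        refine ⟨γ, ?_⟩
        rw [contract_struct_ne]
        · exact hγ
        · rintro rfl
          rw [hγ, Option.some.injEq] at hw
          exact hxu (hw ▸ s.mem_Om x)

theorem Inv.contract : Inv ℓ (s.contract α u v B) (I \ B) := by
  have hu := h.working_verts hw
  have hB : ∀ {x}, x ∈ B → x ∈ (s.struct α).verts := fun hx => h.cycle_verts hw H hx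
  have hl : ∀ x y, (s.contract α u v B).label x y ≤ s.label x y := fun x y =>
    Forest.contract_label_le (M := M) (F := s.forest I) (u := u) (v := v) (B := B) x y
  refine ⟨?_, ?_⟩
  · rw [h.contract_forest hw H]
    exact H.ok h.ok
  · refine
    { disj := ?_, arcs := ?_, blossom_subset := ?_, blossom_nonempty := ?_, root_free := ?_,
      root_mem := ?_, free_eq := ?_, cover := ?_, not_removed := ?_,
      removed_mate := h.own.removed_mate, working := ?_, label_le := ?_, label_vis := ?_ }
    · intro x γ δ
      rw [contract_verts, contract_verts]
      exact h.own.disj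
    · intro x y γ hγ
      rw [contract_verts]
      rcases contract_arcs.1 hγ with h1 | ⟨rfl, rfl, rfl⟩
      · exact h.own.arcs h1
      · exact ⟨hu.1, hB H.v_mem⟩
    · intro B' γ hγ
      rw [contract_verts]
      rcases contract_blossoms.1 hγ with h1 | ⟨rfl, rfl⟩
      · exact h.own.blossom_subset h1
      · exact fun x => hB
    · intro B' γ hγ
      rcases contract_blossoms.1 hγ with h1 | ⟨rfl, rfl⟩
      · exact h.own.blossom_nonempty h1
      · exact ⟨u, H.u_mem⟩
    · intro x γ
      rw [contract_verts]
      exact h.own.root_free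
    · intro x γ
      rw [contract_verts]
      exact h.own.root_mem
    · intro x γ
      rw [contract_verts]
      exact h.own.free_eq
    · intro x
      rw [contract_verts]
      exact h.own.cover
    · intro x γ
      rw [contract_verts]
      exact h.own.not_removed
    · intro γ W hW
      rw [contract_verts]
      by_cases e : γ = α
      · subst e
        rw [contract_working, Option.some.injEq] at hW
        refine ⟨u, hu.1, fun h' => hu.2 h'.1, ?_⟩
        rw [h.contract_Om H, Forest.contract_om_mem H.u_mem, hW]
      · rw [contract_struct_ne e] at hW
        obtain ⟨w, h1, h2, h3⟩ := h.own.working hW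
        refine ⟨w, h1, fun h' => h2 h'.1, ?_⟩
        rw [h.contract_Om (α := α) H, Forest.contract_om_not_mem]
        · exact h3
        · exact fun hwB => e (h.own.disj h1 (hB hwB))
    · intro x y hxy
      exact (hl x y).trans (h.own.label_le hxy)
    · intro x y hxy hle
      simp only [contract_verts]
      by_cases e : x ∈ B ∧ y ∈ B
      · exact .inl ⟨α, hB e.1⟩
      · have hl' : (s.contract α u v B).label x y = s.label x y := if_neg fun h' => e h'.2
        rw [hl'] at hle
        exact h.own.label_vis hxy hle

end Contract

/-- Tree paths of one structure are chains of the merged forest, so every outcome of Contract is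
covered by the analysis of cycles there. -/
theorem contractOp_eq {s s' : State M} (h : Inv ℓ s I)
    (hw : (s.struct α).working = some (s.Om u)) (hv : v ∈ (s.struct α).verts) (hvI : v ∉ I)
    (hadj : G.Adj u v) (hn : ¬ M.Adj u v) (hne : s.Om u ≠ s.Om v) (hop : ContractOp s α u v s') :
    ∃ B c b, (s.forest I).CycleHyp M u v B c b ∧ s' = s.contract α u v B := by
  obtain ⟨C, l₁, l₂, B, h1, h2, h3, h4, h5, rfl, rfl⟩ := hop
  obtain ⟨c, b, H⟩ := h.ok.cycleHyp (l₁ := l₁) (l₂ := l₂) (C := C) (v := v) (u := u)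
    ⟨α, hw⟩ ⟨⟨α, hv⟩, hvI⟩ hadj hn hne (h1.imp fun {_ _} => Inv.tArc_forest) h2
    (h3.imp fun {_ _} => Inv.tArc_forest) h4 h5
  exact ⟨_, c, b, H, rfl⟩

/-- The root of the structure is a common ancestor of both ends, and the cycle hangs from their
lowest common ancestor. -/
theorem exists_contractOp {s : State M} (h : Inv ℓ s I)
    (hw : (s.struct α).working = some (s.Om u)) (hv : v ∈ (s.struct α).verts) :
    ∃ s', ContractOp s α u v s' := by
  have hu := h.working_verts hw
  obtain ⟨c, l₁, l₂, h0, h1, h2, h3, h4, h5⟩ := h.ok.exists_cycle (h.root_anc hu.1) (h.root_anc hv)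
  have hc := (h.anc_verts h0).1 (h.own.root_mem hv)
  exact ⟨_, s.Om c, l₁, l₂, _, h.chain_of_forest hc h1, h2, h.chain_of_forest hc h3, h4, h5,
    rfl, rfl⟩

/-! Removing two structures. -/

open Classical in
/-- The state after the structures of `α` and `β` have been removed. -/
noncomputable def State.delete (s : State M) (α β : V) (q : AugPath M) : State M :=
  { s with
    removed := s.removed ∪ ((s.struct α).verts ∪ (s.struct β).verts)
    struct := fun γ => if γ = α ∨ γ = β then Struct.empty else s.struct γ
    modified := s.modified ∪ {α, β}
    paths := insert q s.paths }

section Delete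

variable {q : AugPath M} {γ : V}

theorem delete_struct_of (e : γ = α ∨ γ = β) : (s.delete α β q).struct γ = Struct.empty := if_pos e

theorem delete_struct_ne (e : ¬ (γ = α ∨ γ = β)) : (s.delete α β q).struct γ = s.struct γ :=
  if_neg e

theorem mem_delete_verts (hx : x ∈ ((s.delete α β q).struct γ).verts) :
    x ∈ (s.struct γ).verts ∧ ¬ (γ = α ∨ γ = β) := by
  by_cases e : γ = α ∨ γ = β
  · rw [delete_struct_of e] at hx
    exact absurd hx (Set.notMem_empty x)
  · rw [delete_struct_ne e] at hx
    exact ⟨hx, e⟩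

theorem delete_verts_iff (h : Inv ℓ s I) : x ∈ ((s.delete α β q).struct γ).verts ↔
    x ∈ (s.struct γ).verts ∧ x ∉ (s.struct α).verts ∪ (s.struct β).verts := by
  constructor
  · intro hx
    obtain ⟨h1, h2⟩ := mem_delete_verts hx
    refine ⟨h1, fun h3 => h2 ?_⟩
    rcases h3 with h3 | h3
    · exact .inl (h.own.disj h1 h3)
    · exact .inr (h.own.disj h1 h3)
  · rintro ⟨h1, h2⟩
    rw [delete_struct_ne]
    · exact h1
    · rintro (rfl | rfl)
      · exact h2 (.inl h1)
      · exact h2 (.inr h1)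

theorem Inv.deleteHyp (h : Inv ℓ s I) :
    (s.forest I).DeleteHyp ((s.struct α).verts ∪ (s.struct β).verts) where
  om := by
    rintro x y e (hx | hx)
    · exact .inl (h.verts_of_om hx e)
    · exact .inr (h.verts_of_om hx e)
  arc := fun ha => or_congr (h.arc_verts ha) (h.arc_verts ha)

theorem Inv.delete_Om (h : Inv ℓ s I) : (s.delete α β q).Om =
    ((s.forest I).delete ((s.struct α).verts ∪ (s.struct β).verts)).om := by
  ext x y
  have key : ∀ {B γ}, B ∈ ((s.delete α β q).struct γ).blossoms → x ∈ B →
      x ∉ (s.struct α).verts ∪ (s.struct β).verts ∧ B ∈ (s.struct γ).blossoms := by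
    intro B γ hB hx
    by_cases e : γ = α ∨ γ = β
    · rw [delete_struct_of e] at hB
      exact absurd hB (Set.notMem_empty B)
    · rw [delete_struct_ne e] at hB
      have hxγ := h.own.blossom_subset hB hx
      refine ⟨fun h' => e ?_, hB⟩
      exact h'.imp (fun h' => h.own.disj hxγ h') fun h' => h.own.disj hxγ h'
  by_cases hx : x ∈ (s.struct α).verts ∪ (s.struct β).verts
  · rw [Forest.DeleteHyp.om_eq_of_mem hx]
    constructor
    · rintro (rfl | ⟨B, ⟨hxB, γ, hB⟩, hy⟩)
      · rfl
      · exact absurd hx (key hB hxB).1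
    · rintro rfl
      exact State.mem_Om _ y
  · rw [Forest.DeleteHyp.om_eq hx]
    constructor
    · rintro (rfl | ⟨B, ⟨hxB, γ, hB⟩, hy⟩)
      · exact s.mem_Om y
      · exact .inr ⟨B, ⟨hxB, γ, (key hB hxB).2⟩, hy⟩
    · rintro (rfl | ⟨B, ⟨hxB, γ, hB⟩, hy⟩)
      · exact State.mem_Om _ y
      · refine .inr ⟨B, ⟨hxB, γ, ?_⟩, hy⟩
        rw [delete_struct_ne]
        · exact hB
        · rintro (rfl | rfl)
          · exact hx (.inl (h.own.blossom_subset hB hxB))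
          · exact hx (.inr (h.own.blossom_subset hB hxB))

theorem Inv.delete_forest (h : Inv ℓ s I) :
    (s.delete α β q).forest (I \ ((s.struct α).verts ∪ (s.struct β).verts)) =
      (s.forest I).delete ((s.struct α).verts ∪ (s.struct β).verts) := by
  have hOm := h.delete_Om (α := α) (β := β) (q := q)
  ext1
  · exact hOm
  · ext x y
    constructor
    · rintro ⟨γ, hγ⟩
      by_cases e : γ = α ∨ γ = β
      · rw [delete_struct_of e] at hγ
        exact absurd hγ (Set.notMem_empty _)
      · rw [delete_struct_ne e] at hγ
        refine ⟨⟨γ, hγ⟩, fun h' => e ?_⟩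
        have := (h.own.arcs hγ).1
        exact h'.imp (fun h' => h.own.disj this h') fun h' => h.own.disj this h'
    · rintro ⟨⟨γ, hγ⟩, hx⟩
      refine ⟨γ, ?_⟩
      rw [delete_struct_ne]
      · exact hγ
      · rintro (rfl | rfl)
        · exact hx (.inl (h.own.arcs hγ).1)
        · exact hx (.inr (h.own.arcs hγ).1)
  · rfl
  · ext x
    simp only [State.forest, delete_verts_iff h, Forest.delete, Set.mem_ofPred_eq, Set.mem_sdiff,
      exists_and_right]
  · rfl
  · ext x
    change (∃ γ, ((s.delete α β q).struct γ).working = some ((s.delete α β q).Om x)) ↔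
      (∃ γ, (s.struct γ).working = some (s.Om x)) ∧ x ∉ (s.struct α).verts ∪ (s.struct β).verts
    rw [hOm]
    constructor
    · rintro ⟨γ, hγ⟩
      by_cases e : γ = α ∨ γ = β
      · rw [delete_struct_of e] at hγ
        cases hγ
      · rw [delete_struct_ne e] at hγ
        obtain ⟨w, hw, -, e'⟩ := h.own.working hγ
        have hx : x ∉ (s.struct α).verts ∪ (s.struct β).verts := by
          intro hx
          rw [Forest.DeleteHyp.om_eq_of_mem hx] at e'
          have := h.ok.mem_om w
          change w ∈ s.Om w at this
          rw [← e'] at this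
          rw [← (show w = x from this)] at hx
          exact e (hx.imp (fun h' => h.own.disj hw h') fun h' => h.own.disj hw h')
        rw [Forest.DeleteHyp.om_eq hx] at hγ
        exact ⟨⟨γ, hγ⟩, hx⟩
    · rintro ⟨⟨γ, hγ⟩, hx⟩
      rw [Forest.DeleteHyp.om_eq hx]
      refine ⟨γ, ?_⟩
      rw [delete_struct_ne]
      · exact hγ
      · rintro (rfl | rfl)
        · exact hx (.inl (h.working_verts hγ).1)
        · exact hx (.inr (h.working_verts hγ).1)

theorem Inv.delete (h : Inv ℓ s I) :
    Inv ℓ (s.delete α β q) (I \ ((s.struct α).verts ∪ (s.struct β).verts)) := by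
  have vis' : ∀ {x}, (∃ γ, x ∈ (s.struct γ).verts) →
      (∃ γ, x ∈ ((s.delete α β q).struct γ).verts) ∨ x ∈ (s.delete α β q).removed := by
    rintro x ⟨γ, hγ⟩
    by_cases hx : x ∈ (s.struct α).verts ∪ (s.struct β).verts
    · exact .inr (.inr hx)
    · exact .inl ⟨γ, (delete_verts_iff h).2 ⟨hγ, hx⟩⟩
  refine ⟨?_, ?_⟩
  · rw [h.delete_forest]
    exact h.deleteHyp.ok h.ok
  · refine
    { disj := ?_, arcs := ?_, blossom_subset := ?_, blossom_nonempty := ?_, root_free := ?_,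
      root_mem := ?_, free_eq := ?_, cover := ?_, not_removed := ?_,
      removed_mate := ?_, working := ?_, label_le := h.own.label_le, label_vis := ?_ }
    · intro x γ δ h1 h2
      exact h.own.disj (mem_delete_verts h1).1 (mem_delete_verts h2).1
    · intro x y γ hγ
      by_cases e : γ = α ∨ γ = β
      · rw [delete_struct_of e] at hγ
        exact absurd hγ (Set.notMem_empty _)
      · rw [delete_struct_ne e] at hγ ⊢
        exact h.own.arcs hγ
    · intro B γ hγ
      by_cases e : γ = α ∨ γ = β
      · rw [delete_struct_of e] at hγ
        exact absurd hγ (Set.notMem_empty _)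
      · rw [delete_struct_ne e] at hγ ⊢
        exact h.own.blossom_subset hγ
    · intro B γ hγ
      by_cases e : γ = α ∨ γ = β
      · rw [delete_struct_of e] at hγ
        exact absurd hγ (Set.notMem_empty _)
      · rw [delete_struct_ne e] at hγ
        exact h.own.blossom_nonempty hγ
    · intro x γ hγ
      exact h.own.root_free (mem_delete_verts hγ).1
    · intro x γ hγ
      obtain ⟨h1, h2⟩ := mem_delete_verts hγ
      rw [delete_struct_ne h2]
      exact h.own.root_mem h1
    · intro x γ hγ
      exact h.own.free_eq (mem_delete_verts hγ).1
    · intro x hf hx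
      have h1 : x ∉ s.removed := fun h' => hx (.inl h')
      have h2 : x ∉ (s.struct α).verts ∪ (s.struct β).verts := fun h' => hx (.inr h')
      exact (delete_verts_iff h).2 ⟨h.own.cover hf h1, h2⟩
    · intro x γ hγ
      obtain ⟨h1, h2⟩ := (delete_verts_iff h).1 hγ
      exact fun h' => h'.elim (h.own.not_removed h1) h2
    · rintro x y (hx | hx | hx) hm
      · exact .inl (h.own.removed_mate hx hm)
      · exact .inr (.inl (h.mate_verts hx hm))
      · exact .inr (.inr (h.mate_verts hx hm))
    · intro γ W hW
      by_cases e : γ = α ∨ γ = β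
      · rw [delete_struct_of e] at hW
        cases hW
      · rw [delete_struct_ne e] at hW
        obtain ⟨w, h1, h2, h3⟩ := h.own.working hW
        have hw : w ∉ (s.struct α).verts ∪ (s.struct β).verts := fun h' =>
          e (h'.imp (fun h' => h.own.disj h1 h') fun h' => h.own.disj h1 h')
        refine ⟨w, (delete_verts_iff h).2 ⟨h1, hw⟩, fun h' => h2 h'.1, ?_⟩
        rw [h.delete_Om, Forest.DeleteHyp.om_eq hw]
        exact h3
    · intro x y hxy hl
      rcases h.own.label_vis hxy hl with h1 | h1
      · exact vis' h1
      · exact .inr (.inl h1)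

end Delete

theorem augmentOp_eq {s s' : State M} (hop : AugmentOp s α β u v s') :
    ∃ q : AugPath M, q.src = α ∧ q.tgt = β ∧ (∀ e ∈ q.walk.edges, e = s(u, v) ∨
      ∃ x y, ((x, y) ∈ (s.struct α).arcs ∨ (x, y) ∈ (s.struct β).arcs) ∧ e = s(x, y)) ∧
    s' = s.delete α β q := hop

/-- Each end has an even alternating path from its root inside its own structure; the two are
disjoint and are joined by the unmatched edge `uv`. -/
theorem exists_augmentOp {s : State M} (h : Inv ℓ s I) (hu : u ∈ (s.struct α).verts) (huI : u ∉ I)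
    (hv : v ∈ (s.struct β).verts) (hvI : v ∉ I) (hne : α ≠ β) (hadj : G.Adj u v)
    (hn : ¬ M.Adj u v) : ∃ s', AugmentOp s α β u v s' := by
  have key : ∀ {α u}, u ∈ (s.struct α).verts → u ∉ I → ∃ S ⊆ (s.struct α).verts,
      AltPath M (fun x y => (x, y) ∈ (s.struct α).arcs) α u S := by
    intro α u hu huI
    obtain ⟨S, hS, hp⟩ := h.ok.root_path (h.root_outer hu) (h.own.root_free hu) ⟨⟨α, hu⟩, huI⟩
      (h.root_anc hu)
    have hS' : S ⊆ (s.struct α).verts := fun x hx => (h.anc_verts (hS hx)).1 (h.own.root_mem hu)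
    exact ⟨S, hS', hp.mono fun x hx y _ ha => h.arc_struct ha (hS' hx)⟩
  obtain ⟨S, hS, hp⟩ := key hu huI
  obtain ⟨S', hS', hp'⟩ := key hv hvI
  obtain ⟨q, h1, h2, h3⟩ := hp.exists_augPath hp' (fun x z ha => h.ok.arc_adj ⟨α, ha⟩)
    (fun x z ha => h.ok.arc_adj ⟨β, ha⟩) hadj hn (h.own.root_free hu) (h.own.root_free hv)
    (Set.disjoint_left.2 fun x hx hx' => hne (h.own.disj (hS hx) (hS' hx')))
  exact ⟨_, q, h1, h2, h3, rfl⟩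

end MatchingPhase

namespace MatchingPhase

variable {V : Type*} {G : SimpleGraph V} {M : G.Subgraph}
variable {ℓ : ℕ} {s s' : State M} {I I' : Set V} {α β γ u v t p x y b c : V} {k : ℕ} {B W : Set V}

/-! ### What the basic operations change -/

/-- The blossom of `x` is the working vertex of a modified structure. -/
def State.Fresh (s : State M) (x : V) : Prop :=
  ∃ γ ∈ s.modified, (s.struct γ).working = some (s.Om x)

/-- The free vertices whose structure has a working vertex. -/
def State.active (s : State M) : Set V := {γ | (s.struct γ).working ≠ none}

/-! ### The potential and the changes made by one operation. -/

section Potential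

variable [Fintype V]

open Classical in
/-- The sum of all labels. -/
noncomputable def State.labelSum (s : State M) : ℕ :=
  ∑ e : V × V with M.Adj e.1 e.2, s.label e.1 e.2

/-- The potential that decreases whenever a structure is modified. -/
noncomputable def State.potential (s : State M) (I : Set V) : ℕ :=
  3 * s.labelSum + ((s.forest I).crit M).ncard

theorem labelSum_lt (h : ∀ x y, s'.label x y ≤ s.label x y) (hm : M.Adj v t)
    (hlt : s'.label v t < s.label v t) : s'.labelSum < s.labelSum :=
  Finset.sum_lt_sum (fun e _ => h e.1 e.2) ⟨(v, t), by simpa using hm, hlt⟩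

/-- The changes that a basic operation (or a sequence of basic operations) may make. -/
structure Progress (ℓ : ℕ) (s : State M) (I : Set V) (s' : State M) (I' : Set V) : Prop where
  inv : Inv ℓ s' I'
  removed : s.removed ⊆ s'.removed
  outer : ∀ {x}, x ∈ (s.forest I).outer → x ∈ s'.removed ∨ x ∈ (s'.forest I').outer
  label : ∀ x y, s'.label x y ≤ s.label x y
  modified : s.modified ⊆ s'.modified
  struct : ∀ {γ}, γ ∉ s'.modified → s'.struct γ = s.struct γ
  om_same : ∀ {γ x}, γ ∉ s'.modified → x ∈ (s.struct γ).verts → s'.Om x = s.Om x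
  dist_same : ∀ {γ x}, γ ∉ s'.modified → x ∈ (s.struct γ).verts → x ∉ I →
    (s'.forest I').dist M x = (s.forest I).dist M x
  onHold : s'.onHold = s.onHold
  inactive : ∀ {x}, x ∈ (s'.forest I').outer → ¬ (s'.forest I').Act x →
    x ∈ (s.forest I).outer ∧ ¬ (s.forest I).Act x ∧
      (s'.forest I').dist M x = (s.forest I).dist M x
  new : ∀ {x}, x ∈ (s'.forest I').outer → x ∈ (s.forest I).outer ∨ s'.Fresh x
  fresh : ∀ {x}, s.Fresh x → x ∈ s'.removed ∨ s'.Fresh x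
  om : ∀ {x y}, s.Om x = s.Om y → x ∈ s'.removed ∨ s'.Om x = s'.Om y
  active : s'.active ⊆ s.active
  potential : s'.potential I' + (s'.modified ∩ s'.active).ncard ≤
    s.potential I + (s.modified ∩ s.active).ncard

theorem Progress.refl (h : Inv ℓ s I) : Progress ℓ s I s I where
  inv := h
  removed := subset_rfl
  outer := .inr
  label _ _ := le_rfl
  modified := subset_rfl
  struct _ := rfl
  om_same _ _ := rfl
  dist_same _ _ _ := rfl
  onHold := rfl
  inactive h1 h2 := ⟨h1, h2, rfl⟩
  new := .inl
  fresh := .inr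
  om := .inr
  active := subset_rfl
  potential := le_rfl

/-- The bound for the potential if two structures are modified. -/
theorem potential_le (hle : ∀ x y, s'.label x y ≤ s.label x y) (hm : M.Adj v t)
    (hlt : s'.label v t < s.label v t)
    (hc : (s'.forest I').crit M ⊆ insert (v, t) ((s.forest I).crit M))
    (ha : s'.active ⊆ s.active) (hmod : s'.modified ⊆ s.modified ∪ {α, β}) :
    s'.potential I' + (s'.modified ∩ s'.active).ncard ≤
      s.potential I + (s.modified ∩ s.active).ncard := by
  -- The sum of labels drops by at least one. Its weight `3` pays for one new critical arc and two
  -- newly modified active structures.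
  have h1 := labelSum_lt hle hm hlt
  have h2 : ((s'.forest I').crit M).ncard ≤ ((s.forest I).crit M).ncard + 1 :=
    (Set.ncard_le_ncard hc (Set.toFinite _)).trans (Set.ncard_insert_le _ _)
  have h3 : (s'.modified ∩ s'.active).ncard ≤ (s.modified ∩ s.active).ncard + 2 := by
    have : s'.modified ∩ s'.active ⊆ (s.modified ∩ s.active) ∪ {α, β} := fun x hx =>
      (hmod hx.1).imp (fun h => ⟨h, ha hx.2⟩) id
    refine (Set.ncard_le_ncard this (Set.toFinite _)).trans ((Set.ncard_union_le _ _).trans ?_)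
    have : ({α, β} : Set V).ncard ≤ 2 :=
      (Set.ncard_insert_le _ _).trans (by rw [Set.ncard_singleton])
    omega
  unfold State.potential
  omega

/-- The only new outer vertex is `t`, and it is at once the working vertex of a modified structure.
-/
theorem Inv.addArc_progress (h : Inv ℓ s I) (hv : ∀ β, v ∉ (s.struct β).verts)
    (hvr : v ∉ s.removed) (hw : (s.struct α).working = some (s.Om u)) (hadj : G.Adj u v)
    (hn : ¬ M.Adj u v) (hm : M.Adj v t) (hk : (s.forest I).dist M u < k) (hkl : k < s.label v t)
    (hα : α ∉ s.modified) : Progress ℓ s I (s.addArc α u v t k) (insert v I) := by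
  have hle := h.own.label_le hm
  have H := h.addHyp hv hw hadj hn hm hk (by omega)
  have e := h.addArc_forest (k := k) hv hw hm
  have h' := h.addArc hv hvr hw hadj hn hm hk hkl
  have htv : t ∉ (s.forest I).vis := H.t_not_vis h.ok
  have hl : ∀ x y, (s.addArc α u v t k).label x y ≤ s.label x y := setLabel_le hkl.le
  have hact : (s.addArc α u v t k).active ⊆ s.active := by
    intro γ hγ
    by_cases eγ : γ = α
    · subst eγ
      simp [State.active, hw]
    · rwa [State.active, Set.mem_ofPred_eq, addArc_struct_ne eγ] at hγ
  have hdist : ∀ {x}, x ∈ (s.forest I).vis →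
      ((s.addArc α u v t k).forest (insert v I)).dist M x = (s.forest I).dist M x := by
    intro x hx
    rw [e]
    exact H.dist_eq h.ok hx
  have tfresh : (s.addArc α u v t k).Fresh t :=
    ⟨α, .inl rfl, by rw [addArc_working_self, addArc_Om]⟩
  have hnew : ∀ {x}, x ∈ ((s.addArc α u v t k).forest (insert v I)).outer →
      x ∈ (s.forest I).outer ∨ x = t := by
    rintro x ⟨hx, hxi⟩
    rw [e] at hx
    rcases hx with hx | rfl | rfl
    · exact .inl ⟨hx, fun h1 => hxi (.inr h1)⟩
    · exact absurd (.inl rfl) hxi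
    · exact .inr rfl
  have ne : ∀ {γ}, γ ∉ (s.addArc α u v t k).modified → γ ≠ α := by
    rintro γ hγ rfl
    exact hγ (.inl rfl)
  exact
  { inv := h'
    removed := subset_rfl
    outer := by
      intro x hx
      rw [e]
      refine .inr ⟨.inl hx.1, ?_⟩
      rintro (rfl | h1)
      · exact H.not_vis hx.1
      · exact hx.2 h1
    label := hl
    modified := Set.subset_insert _ _
    struct := fun hγ => addArc_struct_ne (ne hγ)
    om_same := fun _ _ => congrFun addArc_Om _
    dist_same := fun {γ _} _ hx _ => hdist ⟨γ, hx⟩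
    onHold := rfl
    inactive := by
      intro x hx hna
      have hxo : x ∈ (s.forest I).outer := by
        refine (hnew hx).resolve_right ?_
        rintro rfl
        refine hna ⟨x, ?_, .refl⟩
        rw [e]
        exact .inr rfl
      refine ⟨hxo, fun ha => hna ?_, hdist hxo.1⟩
      rw [e]
      exact H.act_of_act h.ok ha
    new := fun hx => (hnew hx).imp id fun h1 => by subst h1; exact tfresh
    fresh := by
      rintro x ⟨γ, hγ, hγ'⟩
      refine .inr ⟨γ, .inr hγ, ?_⟩
      rw [addArc_struct_ne (by rintro rfl; exact hα hγ), addArc_Om]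
      exact hγ'
    om := fun {x y} e' => .inr (by rw [addArc_Om]; exact e')
    active := hact
    potential := by
      refine potential_le (α := α) (β := α) hl hm ?_ ?_ hact ?_
      · simpa [State.addArc, State.setLabel] using hkl
      · rw [e]
        exact H.crit_subset h.ok
      · rintro x (rfl | hx)
        · exact .inr (.inl rfl)
        · exact .inl hx }

open Classical in
/-- What moving a subtree changes, in addition to what `MoveSpec` says. -/
structure MoveMarks (s s' : State M) (I : Set V) (α β p u v t : V) (W : Set V) : Prop where
  work_eq : W = ((s.forest I).work \ s.Om u) ∪ (if (s.forest I).Act t then s.Om p else s.Om t)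
  modified : s'.modified = s.modified ∪ {α, β}
  onHold : s'.onHold = s.onHold
  struct : ∀ {γ}, γ ≠ α → γ ≠ β → s'.struct γ = s.struct γ
  active : s'.active ⊆ s.active
  working : ∀ {γ X}, γ ∈ s.modified → (s.struct γ).working = some X →
    ∃ γ' ∈ s'.modified, (s'.struct γ').working = some X

omit [Fintype V] in
theorem MoveSpec.act_of_act (S : MoveSpec s s' I α p u v t k W)
    (T : MoveMarks s s' I α β p u v t W) (h : Inv ℓ s I)
    (H : (s.forest I).MoveHyp M p u v t k) (hx : (s.forest I).Act x) : (s'.forest I).Act x := by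
  rw [S.forest_eq h H, T.work_eq]
  split_ifs with ht
  · exact H.act_of_act' h.ok ht hx
  · exact H.act_of_act h.ok ht hx

-- Whichever working vertex results, the mate of the overtaken vertex is active. As only its blossom
-- changes distance, inactive vertices keep theirs.
omit [Fintype V] in
theorem MoveSpec.act_t (S : MoveSpec s s' I α p u v t k W)
    (T : MoveMarks s s' I α β p u v t W) (h : Inv ℓ s I)
    (H : (s.forest I).MoveHyp M p u v t k) : (s'.forest I).Act t := by
  by_cases ht : (s.forest I).Act t
  · exact S.act_of_act T h H ht
  · refine ⟨t, ?_, .refl⟩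
    rw [S.forest_eq h H, T.work_eq, if_neg ht]
    exact .inr (s.mem_Om t)

theorem MoveSpec.progress (S : MoveSpec s s' I α p u v t k W)
    (T : MoveMarks s s' I α β p u v t W) (h : Inv ℓ s I)
    (H : (s.forest I).MoveHyp M p u v t k) (hw : (s.struct α).working = some (s.Om u))
    (hv : v ∈ (s.struct β).verts) : Progress ℓ s I s' I := by
  have hu := h.working_verts hw
  have e := S.forest_eq h H
  have htβ := h.mate_verts hv H.matched
  have hl : ∀ x y, s'.label x y ≤ s.label x y := by
    rw [S.label]
    exact setLabel_le H.lt_label.le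
  have ne : ∀ {γ}, γ ∉ s'.modified → γ ≠ α ∧ γ ≠ β := by
    intro γ hγ
    rw [T.modified] at hγ
    constructor
    · rintro rfl
      exact hγ (.inr (.inl rfl))
    · rintro rfl
      exact hγ (.inr (.inr rfl))
  have houter : (s'.forest I).outer = (s.forest I).outer := by
    rw [e]; rfl
  exact
  { inv := S.inv h H hu.1
    removed := S.removed.ge
    outer := fun hx => .inr (houter ▸ hx)
    label := hl
    modified := T.modified ▸ Set.subset_union_left
    struct := fun hγ => T.struct (ne hγ).1 (ne hγ).2
    om_same := fun _ _ => congrFun S.om _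
    dist_same := by
      intro γ x hγ hx _
      rw [e]
      refine Forest.MoveHyp.dist_eq fun ht => (ne hγ).2 ?_
      exact h.own.disj (h.om_verts hx ht) htβ
    onHold := T.onHold
    inactive := by
      intro x hx hna
      refine ⟨houter ▸ hx, fun ha => hna (S.act_of_act T h H ha), ?_⟩
      rw [e]
      refine Forest.MoveHyp.dist_eq fun ht => hna ?_
      obtain ⟨w, h1, h2⟩ := S.act_t T h H
      refine ⟨w, h1, .trans (.single (.inl ?_)) h2⟩
      rw [e]
      exact (h.ok.om_eq ht).symm
    new := fun hx => .inl (houter ▸ hx)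
    fresh := by
      rintro x ⟨γ, hγ, hγ'⟩
      obtain ⟨γ', h1, h2⟩ := T.working hγ hγ'
      exact .inr ⟨γ', h1, by rw [h2, S.om]⟩
    om := fun {x y} e' => .inr (by rw [S.om]; exact e')
    active := T.active
    potential := by
      refine potential_le (α := α) (β := β) hl H.matched ?_ ?_ T.active T.modified.le
      · rw [S.label]
        simpa [State.setLabel] using show k < s.label v t from H.lt_label
      · rw [e, T.work_eq]
        split_ifs with ht
        · exact (H.crit_subset' h.ok ⟨α, hw⟩ ht).trans (Set.subset_insert _ _)
        · exact H.crit_subset h.ok ⟨α, hw⟩ ht }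

omit [Fintype V] in
theorem Inv.moveSame_marks (h : Inv ℓ s I) (H : (s.forest I).MoveHyp M p u v t k)
    (hw : (s.struct α).working = some (s.Om u)) (hv : v ∈ (s.struct α).verts)
    (hα : α ∉ s.modified) :
    MoveMarks s (s.moveSame α u v t k p) I α α p u v t
      (((s.forest I).work \ s.Om u) ∪ s.Om t) where
  work_eq := by rw [if_neg (h.moveSame_not_act H hw hv)]
  modified := by
    rw [Set.pair_eq_singleton, Set.union_comm]
    rfl
  onHold := rfl
  struct := fun h1 _ => if_neg h1
  active := by
    intro γ hγ
    by_cases eγ : γ = α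
    · subst eγ
      simp [State.active, hw]
    · simpa [State.active, State.moveSame, eγ] using hγ
  working := by
    intro γ X hγ hX
    refine ⟨γ, .inr hγ, ?_⟩
    have : γ ≠ α := by rintro rfl; exact hα hγ
    simpa [State.moveSame, this] using hX

-- A structure `β` modified earlier may lose its working vertex, but then `α` receives it and is
-- marked as well. So working vertices of modified structures stay such.
omit [Fintype V] in
theorem Inv.moveOther_marks (h : Inv ℓ s I) (H : (s.forest I).MoveHyp M p u v t k)
    (hw : (s.struct α).working = some (s.Om u)) (hβ : β ≠ α) (hv : v ∈ (s.struct β).verts)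
    (hα : α ∉ s.modified) : ∃ W, MoveSpec s (s.moveOther α u v t k β p) I α p u v t k W ∧
    MoveMarks s (s.moveOther α u v t k β p) I α β p u v t W := by
  refine ⟨_, h.moveOther_spec H hw hβ hv, rfl, rfl, rfl, ?_, ?_, ?_⟩
  · intro γ h1 h2
    simp [State.moveOther, h1, h2]
  · intro γ hγ
    by_cases eγ : γ = α
    · subst eγ
      simp [State.active, hw]
    · by_cases eβ : γ = β
      · subst eβ
        intro h0
        simp [State.active, State.moveOther, eγ, h0] at hγ
      · simpa [State.active, State.moveOther, eγ, eβ] using hγ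
  · intro γ X hγ hX
    have eγ : γ ≠ α := by rintro rfl; exact hα hγ
    by_cases eβ : γ = β
    · subst eβ
      by_cases hc : ∃ W, (s.struct γ).working = some W ∧ s.InSubtree γ (s.Om t) W
      · refine ⟨α, .inr (.inl rfl), ?_⟩
        simp only [State.moveOther, ↓reduceIte, if_pos hc]
        exact hX
      · refine ⟨γ, .inl hγ, ?_⟩
        simp only [State.moveOther, ↓reduceIte, if_neg hc, if_neg eγ]
        exact hX
    · refine ⟨γ, .inl hγ, ?_⟩
      simpa [State.moveOther, eγ, eβ] using hX

theorem Inv.contract_progress (h : Inv ℓ s I) (hw : (s.struct α).working = some (s.Om u))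
    (H : (s.forest I).CycleHyp M u v B c b) :
    Progress ℓ s I (s.contract α u v B) (I \ B) := by
  have e := h.contract_forest hw H
  have hOm := h.contract_Om (α := α) H
  have hl : ∀ x y, (s.contract α u v B).label x y ≤ s.label x y := fun x y =>
    Forest.contract_label_le (M := M) (F := s.forest I) (u := u) (v := v) (B := B) x y
  have hB : ∀ {x}, x ∈ B → x ∈ (s.struct α).verts := fun hx => h.cycle_verts hw H hx
  have hact : (s.contract α u v B).active ⊆ s.active := by
    intro γ hγ
    by_cases eγ : γ = α
    · subst eγ
      simp [State.active, hw]
    · rwa [State.active, Set.mem_ofPred_eq, contract_struct_ne eγ] at hγ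
  have ne : ∀ {γ}, γ ∉ (s.contract α u v B).modified → γ ≠ α := by
    rintro γ hγ rfl
    exact hγ (.inl rfl)
  have fresh : ∀ {x}, x ∈ B → (s.contract α u v B).Fresh x := fun hx =>
    ⟨α, .inl rfl, by rw [contract_working, hOm, Forest.contract_om_mem hx]⟩
  have nB : ∀ {γ x}, γ ∉ (s.contract α u v B).modified → x ∈ (s.struct γ).verts → x ∉ B :=
    fun hγ hx hxB => ne hγ (h.own.disj hx (hB hxB))
  exact
  { inv := h.contract hw H
    removed := subset_rfl
    outer := by
      intro x hx
      rw [e]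
      exact .inr ⟨hx.1, fun h1 => hx.2 h1.1⟩
    label := hl
    modified := Set.subset_insert _ _
    struct := fun hγ => contract_struct_ne (ne hγ)
    om_same := fun hγ hx => by rw [hOm]; exact Forest.contract_om_not_mem (nB hγ hx)
    dist_same := fun hγ hx _ => by rw [e]; exact H.dist_eq h.ok (nB hγ hx)
    onHold := rfl
    inactive := by
      intro x hx hna
      rw [e] at hx hna ⊢
      have hxB : x ∉ B := fun hxB => hna (Forest.CycleHyp.act_of_mem hxB)
      exact ⟨⟨hx.1, fun hi => hx.2 ⟨hi, hxB⟩⟩, fun ha => hna (H.act_of_act h.ok ha),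
        H.dist_eq h.ok hxB⟩
    new := by
      intro x hx
      by_cases hxB : x ∈ B
      · exact .inr (fresh hxB)
      · rw [e] at hx
        exact .inl ⟨hx.1, fun hi => hx.2 ⟨hi, hxB⟩⟩
    fresh := by
      rintro x ⟨γ, hγ, hγ'⟩
      right
      by_cases hxB : x ∈ B
      · exact fresh hxB
      · refine ⟨γ, .inr hγ, ?_⟩
        rw [contract_struct_ne, hγ', hOm, Forest.contract_om_not_mem hxB]
        · rfl
        · rintro rfl
          rw [hw, Option.some.injEq] at hγ'
          exact hxB (H.closed H.u_mem hγ'.symm)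
    om := by
      intro x y e'
      right
      rw [hOm]
      by_cases hxB : x ∈ B
      · rw [Forest.contract_om_mem hxB, Forest.contract_om_mem (H.closed hxB e'.symm)]
      · rw [Forest.contract_om_not_mem hxB,
          Forest.contract_om_not_mem (H.not_mem_of_om hxB e'.symm)]
        exact e'
    active := hact
    potential := by
      -- The label of an inner vertex on the cycle is positive and is set to `0`; this pays for
      -- marking `α`.
      obtain ⟨x, hxB, hxi⟩ := H.exists_inner
      obtain ⟨t, hm, -⟩ := h.ok.inner_child hxi
      refine potential_le (α := α) (β := α) hl hm ?_ ?_ hact ?_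
      · have : (s.contract α u v B).label x t = 0 := if_pos ⟨hm, hxB, H.child hxB hxi hm⟩
        rw [this]
        exact h.ok.label_pos hxi hm
      · rw [e]
        exact (H.crit_subset h.ok).trans (Set.subset_insert _ _)
      · rintro x (rfl | hx)
        · exact .inr (.inl rfl)
        · exact .inl hx }

/-- The two structures become marked but lose their working vertices, so the count of modified
active structures does not grow, although no label decreases. -/
theorem Inv.delete_progress (h : Inv ℓ s I) {q : AugPath M} (hu : u ∈ (s.struct α).verts)
    (hv : v ∈ (s.struct β).verts) : Progress ℓ s I (s.delete α β q)
      (I \ ((s.struct α).verts ∪ (s.struct β).verts)) := by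
  have e := h.delete_forest (α := α) (β := β) (q := q)
  have hOm := h.delete_Om (α := α) (β := β) (q := q)
  have H := h.deleteHyp (α := α) (β := β)
  have ne : ∀ {γ}, γ ∉ (s.delete α β q).modified → ¬ (γ = α ∨ γ = β) := by
    rintro γ hγ (rfl | rfl)
    · exact hγ (.inr (.inl rfl))
    · exact hγ (.inr (.inr rfl))
  have nX : ∀ {γ x}, ¬ (γ = α ∨ γ = β) → x ∈ (s.struct γ).verts →
      x ∉ (s.struct α).verts ∪ (s.struct β).verts := by
    rintro γ x hγ hx (h1 | h1)
    · exact hγ (.inl (h.own.disj hx h1))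
    · exact hγ (.inr (h.own.disj hx h1))
  have hact : (s.delete α β q).active ⊆ s.active \ {α, β} := by
    intro γ hγ
    by_cases eγ : γ = α ∨ γ = β
    · rw [State.active, Set.mem_ofPred_eq, delete_struct_of eγ] at hγ
      exact absurd rfl hγ
    · rw [State.active, Set.mem_ofPred_eq, delete_struct_ne eγ] at hγ
      exact ⟨hγ, fun h1 => eγ h1⟩
  exact
  { inv := h.delete
    removed := Set.subset_union_left
    outer := by
      intro x hx
      by_cases hxX : x ∈ (s.struct α).verts ∪ (s.struct β).verts
      · exact .inl (.inr hxX)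
      · rw [e]
        exact .inr ⟨⟨hx.1, hxX⟩, fun h1 => hx.2 h1.1⟩
    label := fun _ _ => le_rfl
    modified := Set.subset_union_left
    struct := fun hγ => delete_struct_ne (ne hγ)
    om_same := fun hγ hx => by rw [hOm]; exact Forest.DeleteHyp.om_eq (nX (ne hγ) hx)
    dist_same := fun hγ hx _ => by rw [e]; exact Forest.DeleteHyp.dist_eq (nX (ne hγ) hx)
    onHold := rfl
    inactive := by
      intro x hx hna
      rw [e] at hx hna ⊢
      have hxX := hx.1.2
      exact ⟨⟨hx.1.1, fun hi => hx.2 ⟨hi, hxX⟩⟩, fun ha => hna ((H.act_iff h.ok hxX).2 ha),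
        Forest.DeleteHyp.dist_eq hxX⟩
    new := by
      intro x hx
      rw [e] at hx
      exact .inl ⟨hx.1.1, fun hi => hx.2 ⟨hi, hx.1.2⟩⟩
    fresh := by
      rintro x ⟨γ, hγ, hγ'⟩
      by_cases eγ : γ = α ∨ γ = β
      · left
        right
        have := (h.working_verts hγ').1
        rcases eγ with rfl | rfl
        · exact .inl this
        · exact .inr this
      · right
        refine ⟨γ, .inl hγ, ?_⟩
        rw [delete_struct_ne eγ, hOm, Forest.DeleteHyp.om_eq (nX eγ (h.working_verts hγ').1)]
        exact hγ'
    om := by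
      intro x y e'
      by_cases hx : x ∈ (s.struct α).verts ∪ (s.struct β).verts
      · exact .inl (.inr hx)
      · right
        rw [hOm, Forest.DeleteHyp.om_eq hx,
          Forest.DeleteHyp.om_eq fun hy => hx (H.om e' hy)]
        exact e'
    active := hact.trans Set.sdiff_subset
    potential := by
      refine Nat.add_le_add (Nat.add_le_add le_rfl ?_) ?_
      · refine Set.ncard_le_ncard ?_ (Set.toFinite _)
        rw [e]
        exact H.crit_subset h.ok
      · refine Set.ncard_le_ncard ?_ (Set.toFinite _)
        rintro γ ⟨h1 | h1, h2⟩
        · exact ⟨h1, (hact h2).1⟩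
        · exact absurd h1 (hact h2).2 }

end Potential

end MatchingPhase

namespace MatchingPhase

variable {V : Type*} {G : SimpleGraph V} {M : G.Subgraph}
variable {ℓ : ℕ} {s s' : State M} {I I' : Set V} {α β γ u v t p x y b c : V} {k : ℕ} {B W : Set V}
variable {L : ℝ}

/-! ### The sizes of the structures and the recorded paths -/

/-- The bounds for the number of vertices of subtrees and of structures. -/
structure Size (ℓ : ℕ) (L : ℝ) (s : State M) (I : Set V) : Prop where
  verts : ∀ γ, ((s.struct γ).verts.ncard : ℝ) ≤ (ℓ + 1) * L
  sub : ∀ {v t}, v ∈ I → M.Adj v t →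
    (((s.forest I).sub v).ncard : ℝ) ≤ (ℓ + 1 - s.label v t) * L

/-- The recorded paths are disjoint and cover a fixed proportion of the removed vertices. -/
structure Recorded (ℓ : ℕ) (L : ℝ) (s : State M) : Prop where
  finite : s.paths.Finite
  support : ∀ {q}, q ∈ s.paths → ∀ {x}, x ∈ q.walk.support → x ∈ s.removed
  disjoint : ∀ {q}, q ∈ s.paths → ∀ {q'}, q' ∈ s.paths → q ≠ q' →
    q.walk.support.Disjoint q'.walk.support
  removed : (s.removed.ncard : ℝ) ≤ 2 * (ℓ + 1) * L * s.paths.ncard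

section Size

theorem ncard_union_le_real (X Y : Set V) : ((X ∪ Y).ncard : ℝ) ≤ X.ncard + Y.ncard := by
  exact_mod_cast Set.ncard_union_le X Y

theorem ncard_pair_le_real (x y : V) : (({x, y} : Set V).ncard : ℝ) ≤ 2 := by
  have : ({x, y} : Set V).ncard ≤ 2 :=
    (Set.ncard_insert_le _ _).trans (by rw [Set.ncard_singleton])
  exact_mod_cast this

theorem Inv.sub_verts (h : Inv ℓ s I) (hx : x ∈ (s.struct γ).verts) :
    (s.forest I).sub x ⊆ (s.struct γ).verts := fun _ ha => (h.anc_verts ha).1 hx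

theorem Inv.label_lt_of_anc (h : Inv ℓ s I) (hu : u ∉ I) (hx : x ∈ I) (hm : M.Adj x y)
    (ha : (s.forest I).Anc x u) (hk : (s.forest I).dist M u < k) : (s.label x y : ℝ) + 1 ≤ k := by
  have := h.ok.label_le_dist hx hm hu ha
  have h2 : s.label x y + 1 ≤ k := lt_of_le_of_lt this hk
  exact_mod_cast h2

variable [Finite V]

theorem ncard_le_real {X Y : Set V} (h : X ⊆ Y) : (X.ncard : ℝ) ≤ Y.ncard := by
  exact_mod_cast Set.ncard_le_ncard h (Set.toFinite _)

/-- The overtaking structure has fewer than `L` vertices and grows by two, so it has at most `2 *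
L`, which fits under an arc of label below `k ≤ ℓ`. The new subtree consists of two vertices, and `2
≤ L ≤ (ℓ + 1 - k) * L`. -/
theorem Size.addArc (hS : Size ℓ L s I) (h : Inv ℓ s I) (hv : ∀ β, v ∉ (s.struct β).verts)
    (hw : (s.struct α).working = some (s.Om u)) (hadj : G.Adj u v)
    (hn : ¬ M.Adj u v) (hm : M.Adj v t) (hk : (s.forest I).dist M u < k) (hkl : k < s.label v t)
    (hsm : ((s.struct α).verts.ncard : ℝ) < L) (hL : 2 ≤ L) (hℓ : 1 ≤ ℓ) :
    Size ℓ L (s.addArc α u v t k) (insert v I) := by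
  have hle := h.own.label_le hm
  have H := h.addHyp hv hw hadj hn hm hk (by omega)
  have e := h.addArc_forest (k := k) hv hw hm
  have hu := h.working_verts hw
  have hℓ' : (1 : ℝ) ≤ ℓ := by exact_mod_cast hℓ
  have hkℓ : (k : ℝ) ≤ ℓ := by exact_mod_cast (show k ≤ ℓ by omega)
  have h2 := ncard_pair_le_real v t
  refine ⟨fun γ => ?_, fun {x y} hx hxy => ?_⟩
  · by_cases eγ : γ = α
    · subst eγ
      have : ((s.addArc γ u v t k).struct γ).verts ⊆ (s.struct γ).verts ∪ {v, t} := fun x hx =>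
        (addArc_verts.1 hx).imp id And.right
      have h1 := (ncard_le_real this).trans (ncard_union_le_real _ _)
      nlinarith
    · rw [addArc_struct_ne eγ]
      exact hS.verts γ
  · rw [e]
    rcases hx with rfl | hx
    · have hlab : (s.addArc α u x t k).label x y = k := by
        obtain rfl : y = t := h.ok.matching.eq_of_adj_left hxy hm
        exact if_pos ⟨rfl, rfl⟩
      have h1 := ncard_le_real (H.sub_v_subset h.ok)
      rw [hlab]
      nlinarith
    · have hne : ¬ (x = v ∧ y = t) := by
        rintro ⟨rfl, -⟩
        exact H.not_vis (h.ok.inner_vis hx)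
      have hlab : (s.addArc α u v t k).label x y = s.label x y := if_neg hne
      rw [hlab]
      by_cases ha : (s.forest I).Anc x u
      · have h1 := (ncard_le_real (H.sub_subset_union h.ok (h.ok.inner_vis hx))).trans
          (ncard_union_le_real _ _)
        have h3 := ncard_le_real (h.sub_verts ((h.anc_verts ha).2 hu.1))
        have h4 := h.label_lt_of_anc hu.2 hx hxy ha hk
        nlinarith
      · exact (ncard_le_real (H.sub_subset h.ok (h.ok.inner_vis hx) ha)).trans (hS.sub hx hxy)

/-- The moved subtree has at most `(ℓ + 1 - label) * L ≤ (ℓ - k) * L` vertices. Together with the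
fewer than `L` vertices of the overtaking structure this is at most `(ℓ + 1 - k) * L`, which is
enough for the ancestors of `u`, since their labels are below `k`. -/
theorem Size.move (hS : Size ℓ L s I) (S : MoveSpec s s' I α p u v t k W) (h : Inv ℓ s I)
    (H : (s.forest I).MoveHyp M p u v t k) (hw : (s.struct α).working = some (s.Om u))
    (hsm : ((s.struct α).verts.ncard : ℝ) < L) : Size ℓ L s' I := by
  have e := S.forest_eq h H
  have hu := h.working_verts hw
  have hv := hS.sub H.inner H.matched
  have hL : 0 ≤ L := (Nat.cast_nonneg _).trans hsm.le
  have hlt : (k : ℝ) + 1 ≤ s.label v t := by exact_mod_cast H.lt_label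
  have hk0 : (1 : ℝ) ≤ k := by exact_mod_cast (Nat.zero_le _).trans_lt H.dist_lt
  refine ⟨fun γ => ?_, fun {x y} hx hxy => ?_⟩
  · by_cases eγ : γ = α
    · subst eγ
      have : (s'.struct γ).verts ⊆ (s.struct γ).verts ∪ (s.forest I).sub v := fun x hx => by
        rcases S.verts.1 hx with h1 | h1
        · exact .inr h1.1
        · exact .inl h1.2
      have h1 := (ncard_le_real this).trans (ncard_union_le_real _ _)
      nlinarith
    · have : (s'.struct γ).verts ⊆ (s.struct γ).verts := fun x hx => by
        rcases S.verts.1 hx with h1 | h1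
        · exact absurd h1.2 eγ
        · exact h1.2
      exact (ncard_le_real this).trans (hS.verts γ)
  · rw [e, S.label]
    by_cases exy : x = v ∧ y = t
    · obtain ⟨rfl, rfl⟩ := exy
      have hlab : s.setLabel x y k x y = k := if_pos ⟨rfl, rfl⟩
      have h1 := ncard_le_real (H.sub_subset h.ok (W := W) (H.not_anc_u h.ok))
      rw [hlab]
      nlinarith
    · have hlab : s.setLabel v t k x y = s.label x y := if_neg exy
      rw [hlab]
      by_cases ha : (s.forest I).Anc x u
      · have : ((s.forest I).move p u v t k W).sub x ⊆ (s.struct α).verts ∪ (s.forest I).sub v := by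
          intro z hz
          by_cases hz' : (s.forest I).Anc v z
          · exact .inr hz'
          · exact .inl (h.sub_verts ((h.anc_verts ha).2 hu.1) ((H.anc_iff hz').1 hz))
        have h1 := (ncard_le_real this).trans (ncard_union_le_real _ _)
        have h4 := h.label_lt_of_anc hu.2 hx hxy ha H.dist_lt
        nlinarith
      · exact (ncard_le_real (H.sub_subset h.ok ha)).trans (hS.sub hx hxy)

theorem Size.contract (hS : Size ℓ L s I) (h : Inv ℓ s I)
    (hw : (s.struct α).working = some (s.Om u)) (H : (s.forest I).CycleHyp M u v B c b) :
    Size ℓ L (s.contract α u v B) (I \ B) := by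
  refine ⟨fun γ => ?_, fun {x y} hx hxy => ?_⟩
  · rw [contract_verts]
    exact hS.verts γ
  · have hlab : (s.contract α u v B).label x y = s.label x y := if_neg fun h' => hx.2 h'.2.1
    rw [h.contract_forest hw H, hlab]
    exact (ncard_le_real (H.sub_subset h.ok hx.2)).trans (hS.sub hx.1 hxy)

theorem Size.delete (hS : Size ℓ L s I) (h : Inv ℓ s I) {q : AugPath M} :
    Size ℓ L (s.delete α β q) (I \ ((s.struct α).verts ∪ (s.struct β).verts)) := by
  refine ⟨fun γ => ?_, fun {x y} hx hxy => ?_⟩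
  · exact (ncard_le_real fun x hx => (mem_delete_verts hx).1).trans (hS.verts γ)
  · rw [h.delete_forest]
    exact (ncard_le_real (h.deleteHyp.sub_subset h.ok hx.2)).trans (hS.sub hx.1 hxy)

-- The new path lives on vertices of two structures, which were not removed before, so it is
-- disjoint from the earlier ones. The size bound for the two structures accounts for the factor `2
-- * (ℓ + 1) * L`.
omit [Finite V] in
theorem Recorded.delete (hR : Recorded ℓ L s) (hS : Size ℓ L s I) (h : Inv ℓ s I) {q : AugPath M}
    (hq : q.src = α) (hq' : ∀ e ∈ q.walk.edges, e = s(u, v) ∨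
      ∃ x y, ((x, y) ∈ (s.struct α).arcs ∨ (x, y) ∈ (s.struct β).arcs) ∧ e = s(x, y))
    (hu : u ∈ (s.struct α).verts) (hv : v ∈ (s.struct β).verts) :
    Recorded ℓ L (s.delete α β q) := by
  have hsup : ∀ {x}, x ∈ q.walk.support → x ∈ (s.struct α).verts ∪ (s.struct β).verts := by
    intro x hx
    obtain ⟨e, hy, hxe⟩ := (SimpleGraph.Walk.mem_support_iff_exists_mem_edges_of_not_nil
      (SimpleGraph.Walk.not_nil_of_ne q.src_ne_tgt)).1 hx
    obtain ⟨y, rfl⟩ := Sym2.mem_iff_exists.1 hxe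
    rcases hq' _ hy with e | ⟨a, d, had, e⟩
    · rcases Sym2.eq_iff.1 e with ⟨rfl, -⟩ | ⟨rfl, -⟩
      · exact .inl hu
      · exact .inr hv
    · have : a ∈ (s.struct α).verts ∪ (s.struct β).verts ∧
          d ∈ (s.struct α).verts ∪ (s.struct β).verts := by
        rcases had with had | had
        · exact ⟨.inl (h.own.arcs had).1, .inl (h.own.arcs had).2⟩
        · exact ⟨.inr (h.own.arcs had).1, .inr (h.own.arcs had).2⟩
      rcases Sym2.eq_iff.1 e with ⟨rfl, -⟩ | ⟨rfl, -⟩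
      · exact this.1
      · exact this.2
  have hnr : ∀ {x}, x ∈ (s.struct α).verts ∪ (s.struct β).verts → x ∉ s.removed := by
    rintro x (hx | hx)
    · exact h.own.not_removed hx
    · exact h.own.not_removed hx
  have hdis : ∀ {q'}, q' ∈ s.paths → q.walk.support.Disjoint q'.walk.support :=
    fun hq' x hx hx' => hnr (hsup hx) (hR.support hq' hx')
  have hqn : q ∉ s.paths := fun h' => hdis h' q.walk.start_mem_support q.walk.start_mem_support
  refine ⟨hR.finite.insert q, ?_, ?_, ?_⟩
  · rintro q' (rfl | h') x hx
    · exact .inr (hsup hx)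
    · exact .inl (hR.support h' hx)
  · rintro q₁ (rfl | h₁) q₂ (rfl | h₂) hne
    · exact absurd rfl hne
    · exact hdis h₂
    · exact (hdis h₁).symm
    · exact hR.disjoint h₁ h₂ hne
  · have h1 : ((s.delete α β q).removed.ncard : ℝ) ≤ s.removed.ncard +
        ((s.struct α).verts.ncard + (s.struct β).verts.ncard) :=
      (ncard_union_le_real _ _).trans (add_le_add le_rfl (ncard_union_le_real _ _))
    have h2 : ((s.delete α β q).paths.ncard : ℝ) = s.paths.ncard + 1 := by
      exact_mod_cast Set.ncard_insert_of_notMem hqn hR.finite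
    rw [h2]
    have h3 := hS.verts α
    have h4 := hS.verts β
    have h5 := hR.removed
    linarith

end Size

end MatchingPhase

namespace MatchingPhase

variable {V : Type*} {G : SimpleGraph V} {M : G.Subgraph}
variable {ℓ : ℕ} {s s' s₁ s₂ : State M} {I I' I₁ I₂ : Set V} {α β γ u v t p x y b c : V} {k : ℕ}
variable {B W : Set V} {L : ℝ}

/-! ### The procedures -/

/-- All invariants that every basic operation preserves. -/
structure Status (ℓ : ℕ) (L : ℝ) (s : State M) (I : Set V) : Prop where
  inv : Inv ℓ s I
  size : Size ℓ L s I
  recorded : Recorded ℓ L s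
  small : ∀ {γ}, γ ∉ s.modified → γ ∉ s.onHold → ((s.struct γ).verts.ncard : ℝ) < L
  two_le : 2 ≤ L
  pos : 1 ≤ ℓ

/-- The arc `(u, v)` does not admit an overtaking by an unmodified structure. -/
def State.Processed (s : State M) (I : Set V) (u v : V) : Prop :=
  ∀ {γ t}, γ ∉ s.modified → γ ∉ s.onHold → (s.struct γ).working = some (s.Om u) →
    v ∉ s.removed → v ∉ (s.forest I).outer → ¬ M.Adj u v → M.Adj v t →
    s.label v t ≤ (s.forest I).dist M u + 1

/-- No arc that leaves an inactive outer vertex admits an overtaking. -/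
def State.Settled (s : State M) (I : Set V) : Prop :=
  ∀ {u v t}, u ∈ (s.forest I).outer → v ∉ s.removed → v ∉ (s.forest I).outer → G.Adj u v →
    ¬ M.Adj u v → M.Adj v t → (s.forest I).Act u ∨ s.label v t ≤ (s.forest I).dist M u + 1

/-- The arcs between different outer vertices join two free vertices or are incident to modified
working vertices. -/
def State.Separated (s : State M) (I : Set V) : Prop :=
  ∀ {x y}, x ∈ (s.forest I).outer → y ∈ (s.forest I).outer → G.Adj x y → ¬ M.Adj x y →
    s.Om x ≠ s.Om y → (Free M x ∧ Free M y) ∨ s.Fresh x ∨ s.Fresh y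

/-- No arc joins different outer vertices. -/
def State.Closed (s : State M) (I : Set V) : Prop :=
  ∀ {x y}, x ∈ (s.forest I).outer → y ∈ (s.forest I).outer → G.Adj x y → ¬ M.Adj x y →
    s.Om x = s.Om y

theorem Inv.not_removed_outer (h : Inv ℓ s I) (hx : x ∈ (s.forest I).outer) : x ∉ s.removed := by
  obtain ⟨⟨γ, hγ⟩, -⟩ := hx
  exact h.own.not_removed hγ

section Progress

variable [Fintype V]

theorem Progress.trans (P : Progress ℓ s I s₁ I₁) (Q : Progress ℓ s₁ I₁ s₂ I₂) :
    Progress ℓ s I s₂ I₂ where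
  inv := Q.inv
  removed := P.removed.trans Q.removed
  outer hx := (P.outer hx).elim (fun h => .inl (Q.removed h)) Q.outer
  label x y := (Q.label x y).trans (P.label x y)
  modified := P.modified.trans Q.modified
  struct hγ := (Q.struct hγ).trans (P.struct fun h => hγ (Q.modified h))
  om_same {γ x} hγ hx := by
    have hγ' : γ ∉ s₁.modified := fun h => hγ (Q.modified h)
    exact (Q.om_same hγ (P.struct hγ' ▸ hx)).trans (P.om_same hγ' hx)
  dist_same {γ x} hγ hx hi := by
    have hγ' : γ ∉ s₁.modified := fun h => hγ (Q.modified h)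
    have hx' : x ∈ (s₁.struct γ).verts := P.struct hγ' ▸ hx
    refine (Q.dist_same hγ hx' ?_).trans (P.dist_same hγ' hx hi)
    exact ((P.outer ⟨⟨γ, hx⟩, hi⟩).resolve_left (P.inv.own.not_removed hx')).2
  onHold := Q.onHold.trans P.onHold
  inactive hx ha := by
    obtain ⟨h1, h2, h3⟩ := Q.inactive hx ha
    obtain ⟨h4, h5, h6⟩ := P.inactive h1 h2
    exact ⟨h4, h5, h3.trans h6⟩
  new hx := (Q.new hx).elim (fun h => (P.new h).imp id fun h' =>
    (Q.fresh h').resolve_left (Q.inv.not_removed_outer hx)) .inr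
  fresh hx := (P.fresh hx).elim (fun h => .inl (Q.removed h)) Q.fresh
  om e := (P.om e).elim (fun h => .inl (Q.removed h)) Q.om
  active := Q.active.trans P.active
  potential := Q.potential.trans P.potential

theorem Progress.small (P : Progress ℓ s I s' I') (h : Status ℓ L s I) (hγ : γ ∉ s'.modified)
    (hγ' : γ ∉ s'.onHold) : ((s'.struct γ).verts.ncard : ℝ) < L := by
  rw [P.struct hγ]
  exact h.small (fun h => hγ (P.modified h)) (P.onHold ▸ hγ')

theorem Progress.not_outer (P : Progress ℓ s I s' I') (hv : v ∉ s'.removed)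
    (ho : v ∉ (s'.forest I').outer) : v ∉ (s.forest I).outer :=
  fun h => (P.outer h).elim hv ho

/-- For a structure that is still unmodified, working vertex and distance are those of the moment
when the arc was read, and labels have only decreased since. -/
theorem Progress.processed (P : Progress ℓ s I s' I') (h : s.Processed I u v) :
    s'.Processed I' u v := by
  intro γ t hγ hγ' hw hv ho hn hm
  obtain ⟨hu, -⟩ := P.inv.working_verts hw
  rw [P.struct hγ] at hw hu
  rw [P.om_same hγ hu] at hw
  have hui : u ∉ I := fun hi => by
    have hI : u ∈ (s'.forest I').outer := ⟨⟨γ, P.struct hγ ▸ hu⟩, (P.inv.working_verts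
      (by rw [P.struct hγ, P.om_same hγ hu]; exact hw)).2⟩
    rcases P.new hI with h1 | ⟨δ, hδ, hδ'⟩
    · exact h1.2 hi
    · have := P.inv.own.disj (P.inv.working_verts hδ').1 (P.struct hγ ▸ hu)
      exact hγ (this ▸ hδ)
  rw [P.dist_same hγ hu hui]
  exact (P.label v t).trans (h (fun h => hγ (P.modified h)) (P.onHold ▸ hγ') hw
    (fun h => hv (P.removed h)) (P.not_outer hv ho) hn hm)

/-- Holds vacuously: the structure that contains `u` is marked, so the condition never applies to
it. -/
theorem Progress.processed_of_modified (P : Progress ℓ s I s' I') (h : Inv ℓ s I)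
    (hw : (s.struct α).working = some (s.Om u)) (hα : α ∈ s'.modified) :
    s'.Processed I' u v := by
  intro γ t hγ hγ' hw' hv ho hn hm
  obtain ⟨hu, -⟩ := P.inv.working_verts hw'
  rw [P.struct hγ] at hu
  exact absurd (h.own.disj hu (h.working_verts hw).1 ▸ hα) hγ

/-- The basic operations make no outer vertex inactive, keep the distances of inactive ones and
never raise labels. -/
theorem Progress.settled (P : Progress ℓ s I s' I') (h : s.Settled I) : s'.Settled I' := by
  intro u v t hu hv ho hadj hn hm
  by_cases ha : (s'.forest I').Act u
  · exact .inl ha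
  · obtain ⟨h1, h2, h3⟩ := P.inactive hu ha
    rw [h3]
    exact .inr ((P.label v t).trans ((h h1 (fun h => hv (P.removed h)) (P.not_outer hv ho)
      hadj hn hm).resolve_left h2))

/-- A vertex can become outer only within the working vertex of a modified structure, and such
blossoms keep this property until they are removed. -/
theorem Progress.separated (P : Progress ℓ s I s' I') (h : s.Separated I) : s'.Separated I' := by
  intro x y hx hy hadj hn hne
  have key : ∀ {z}, z ∈ (s'.forest I').outer → s.Fresh z → s'.Fresh z := fun hz hf =>
    (P.fresh hf).resolve_left (P.inv.not_removed_outer hz)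
  rcases P.new hx with hx' | hx'
  · rcases P.new hy with hy' | hy'
    · refine (h hx' hy' hadj hn fun e => ?_).imp id fun hf => hf.imp (key hx) (key hy)
      exact (P.om e).elim (P.inv.not_removed_outer hx) hne
    · exact .inr (.inr hy')
  · exact .inr (.inl hx')

theorem Status.overtake (h : Status ℓ L s I) (he : s.Eligible α u v) (hadj : G.Adj u v)
    (ho : v ∉ (s.forest I).outer) (hm : M.Adj v t) (hk : (s.forest I).dist M u < k)
    (hkl : k < s.label v t) (hop : OvertakeOp s α u v t k s') :
    ∃ I', Progress ℓ s I s' I' ∧ Status ℓ L s' I' ∧ α ∈ s'.modified := by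
  obtain ⟨hur, hvr, hne, hw, hn, hα, hα'⟩ := he
  have hsm := h.small hα hα'
  have hu := h.inv.working_verts hw
  have hyp : ∀ {p β}, v ∈ (s.struct β).verts → (p, v) ∈ (s.struct β).arcs →
      (s.forest I).MoveHyp M p u v t k := fun {p β} hv hp =>
    { inner := by
        by_contra hi
        exact ho ⟨⟨β, hv⟩, hi⟩
      arc := ⟨β, hp⟩
      outer := ⟨⟨α, hu.1⟩, hu.2⟩
      adj := hadj
      not_matched := hn
      matched := hm
      dist_lt := hk
      lt_label := hkl }
  cases hop with
  | unvisited hv =>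
    have P := h.inv.addArc_progress hv hvr hw hadj hn hm hk hkl hα
    exact ⟨_, P, ⟨P.inv, h.size.addArc h.inv hv hw hadj hn hm hk hkl hsm h.two_le h.pos,
      ⟨h.recorded.finite, h.recorded.support, h.recorded.disjoint, h.recorded.removed⟩,
      P.small h, h.two_le, h.pos⟩, .inl rfl⟩
  | same hv p hp hpv =>
    have H := hyp hv hp
    have S := h.inv.moveSame_spec H hw hv
    have P := S.progress (h.inv.moveSame_marks H hw hv hα) h.inv H hw hv
    exact ⟨_, P, ⟨P.inv, h.size.move S h.inv H hw hsm,
      ⟨h.recorded.finite, h.recorded.support, h.recorded.disjoint, h.recorded.removed⟩,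
      P.small h, h.two_le, h.pos⟩, .inl rfl⟩
  | other β hβ hv p hp hpv =>
    have H := hyp hv hp
    obtain ⟨W, S, T⟩ := h.inv.moveOther_marks H hw hβ hv hα
    have P := S.progress T h.inv H hw hv
    exact ⟨_, P, ⟨P.inv, h.size.move S h.inv H hw hsm,
      ⟨h.recorded.finite, h.recorded.support, h.recorded.disjoint, h.recorded.removed⟩,
      P.small h, h.two_le, h.pos⟩, .inr (.inl rfl)⟩

theorem Status.contract (h : Status ℓ L s I) (hw : (s.struct α).working = some (s.Om u))
    (hv : v ∈ (s.struct α).verts) (hvI : v ∉ I) (hadj : G.Adj u v) (hn : ¬ M.Adj u v)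
    (hne : s.Om u ≠ s.Om v) (hop : ContractOp s α u v s') :
    ∃ I', Progress ℓ s I s' I' ∧ Status ℓ L s' I' ∧ α ∈ s'.modified ∧
      s'.labelSum < s.labelSum := by
  obtain ⟨B, c, b, H, rfl⟩ := contractOp_eq h.inv hw hv hvI hadj hn hne hop
  have P := h.inv.contract_progress hw H
  refine ⟨_, P, ⟨P.inv, h.size.contract h.inv hw H,
      ⟨h.recorded.finite, h.recorded.support, h.recorded.disjoint, h.recorded.removed⟩,
      P.small h, h.two_le, h.pos⟩, .inl rfl, ?_⟩
  obtain ⟨x, hxB, hxi⟩ := H.exists_inner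
  obtain ⟨t, hm, -⟩ := h.inv.ok.inner_child hxi
  refine labelSum_lt P.label hm ?_
  have : (s.contract α u v B).label x t = 0 := if_pos ⟨hm, hxB, H.child hxB hxi hm⟩
  rw [this]
  exact h.inv.ok.label_pos hxi hm

/-- The outer vertices of `s'` and their structures are the same in `s`. -/
def Thinner (s : State M) (I : Set V) (s' : State M) (I' : Set V) : Prop :=
  ∀ {γ x}, x ∈ (s'.struct γ).verts → x ∉ I' →
    x ∈ (s.struct γ).verts ∧ x ∉ I ∧ s'.Om x = s.Om x ∧ s'.struct γ = s.struct γ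

theorem Status.augment (h : Status ℓ L s I) (hu : u ∈ (s.struct α).verts)
    (hv : v ∈ (s.struct β).verts) (hop : AugmentOp s α β u v s') :
    ∃ I', Progress ℓ s I s' I' ∧ Status ℓ L s' I' ∧ α ∈ s'.modified ∧ Thinner s I s' I' ∧
      u ∈ s'.removed := by
  obtain ⟨q, hq, -, hq', rfl⟩ := augmentOp_eq hop
  have P := h.inv.delete_progress (q := q) hu hv
  refine ⟨_, P, ⟨P.inv, h.size.delete h.inv, h.recorded.delete h.size h.inv hq hq' hu hv,
      P.small h, h.two_le, h.pos⟩, .inr (.inl rfl), ?_, .inr (.inl hu)⟩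
  intro γ x hx hxi
  obtain ⟨h1, h2⟩ := (delete_verts_iff h.inv).1 hx
  refine ⟨h1, fun hi => hxi ⟨hi, h2⟩, ?_, delete_struct_ne (mem_delete_verts hx).2⟩
  rw [h.inv.delete_Om]
  exact Forest.DeleteHyp.om_eq h2

theorem Status.extendStep (h : Status ℓ L s I) (hadj : G.Adj u v)
    (hstep : ExtendStep s (u, v) s') :
    ∃ I', Progress ℓ s I s' I' ∧ Status ℓ L s' I' ∧ s'.Processed I' u v := by
  have hno : (∀ β, ¬ s.Outer β v) → v ∉ (s.forest I).outer := fun ho ho' => by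
    obtain ⟨β, hβ⟩ := h.inv.exists_outer_iff.2 ho'
    exact ho β hβ
  have hou : ∀ {α}, s.Eligible α u v → u ∈ (s.forest I).outer := fun {α} he =>
    ⟨⟨α, (h.inv.working_verts he.2.2.2.1).1⟩, (h.inv.working_verts he.2.2.2.1).2⟩
  cases hstep with
  | skip _ _ hsk =>
    refine ⟨I, .refl h.inv, h, ?_⟩
    intro γ t hγ hγ' hw hv ho hn hm
    have hu := h.inv.working_verts hw
    refine absurd ⟨h.inv.own.not_removed hu.1, hv, fun e => ho ?_, hw, hn, hγ, hγ'⟩ (hsk γ)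
    exact h.inv.ok.outer_om ⟨⟨γ, hu.1⟩, hu.2⟩ e.symm
  | contract α _ _ _ he ho hop =>
    rw [h.inv.outer_iff] at ho
    obtain ⟨-, -, hne, hw, hn, -, -⟩ := he
    obtain ⟨I', P, h', hα, -⟩ := h.contract hw ho.1 ho.2 hadj hn hne hop
    exact ⟨I', P, h', P.processed_of_modified h.inv hw hα⟩
  | augment α β _ _ _ he hβ ho hop =>
    rw [h.inv.outer_iff] at ho
    obtain ⟨I', P, h', hα, -⟩ := h.augment (h.inv.working_verts he.2.2.2.1).1 ho.1 hop
    exact ⟨I', P, h', P.processed_of_modified h.inv he.2.2.2.1 hα⟩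
  | overtake α _ _ t d _ he ho hd hm hlt hop =>
    rw [h.inv.distance_iff (hou he)] at hd
    subst hd
    obtain ⟨I', P, h', hα⟩ := h.overtake he hadj (hno ho) hm (Nat.lt_succ_self _) hlt hop
    exact ⟨I', P, h', P.processed_of_modified h.inv he.2.2.2.1 hα⟩
  | noOvertake α _ _ t d he ho hd hm hle =>
    rw [h.inv.distance_iff (hou he)] at hd
    subst hd
    refine ⟨I, .refl h.inv, h, ?_⟩
    intro γ t' hγ hγ' hw hv ho' hn hm'
    obtain rfl := h.inv.ok.matching.eq_of_adj_left hm hm'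
    exact hle

theorem Status.extendScan (h : Status ℓ L s I) {l : List (V × V)}
    (hl : ∀ e ∈ l, G.Adj e.1 e.2) (hs : Scan ExtendStep l s s') :
    ∃ I', Progress ℓ s I s' I' ∧ Status ℓ L s' I' ∧ ∀ e ∈ l, s'.Processed I' e.1 e.2 := by
  induction hs generalizing I with
  | nil => exact ⟨I, .refl h.inv, h, by simp⟩
  | cons hstep _ ih =>
    obtain ⟨I₁, P, h₁, hp⟩ := h.extendStep (hl _ (by simp)) hstep
    obtain ⟨I₂, Q, h₂, hp'⟩ := ih h₁ fun e he => hl e (by simp [he])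
    refine ⟨I₂, P.trans Q, h₂, fun e he => ?_⟩
    rcases List.mem_cons.1 he with rfl | he
    · exact Q.processed hp
    · exact hp' e he

theorem Status.contractAll (h : Status ℓ L s I) (hs : ContractAll s s') :
    ∃ I', Progress ℓ s I s' I' ∧ Status ℓ L s' I' := by
  obtain ⟨hs, -⟩ := hs
  induction hs with
  | refl => exact ⟨I, .refl h.inv, h⟩
  | tail _ hstep ih =>
    obtain ⟨I₁, P, h₁⟩ := ih
    obtain ⟨α, u, v, ⟨hadj, hn, hu, hv, hw, hne, ho⟩, hop⟩ := hstep
    rw [h₁.inv.outer_iff] at ho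
    obtain ⟨I₂, Q, h₂, -⟩ := h₁.contract hw hv ho.2 hadj hn hne.symm hop
    exact ⟨I₂, P.trans Q, h₂⟩

-- Augment only deletes outer vertices. Hence an arc dealt with earlier in the scan cannot become
-- available for Augment again.
omit [Fintype V] in
theorem Thinner.joins (T : Thinner s I s' I') (h : Inv ℓ s I) (h' : Inv ℓ s' I')
    (hj : s'.Joins α β u v) : s.Joins α β u v := by
  obtain ⟨h1, h2, h3, h4⟩ := hj
  rw [h'.outer_iff] at h3 h4
  refine ⟨h1, h2, h.outer_iff.2 ?_, h.outer_iff.2 ?_⟩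
  · exact ⟨(T h3.1 h3.2).1, (T h3.1 h3.2).2.1⟩
  · exact ⟨(T h4.1 h4.2).1, (T h4.1 h4.2).2.1⟩

-- Likewise the second scan opens no new possibility for Contract, although no contraction follows
-- it.
omit [Fintype V] in
theorem Thinner.contractible (T : Thinner s I s' I') (h : Inv ℓ s I) (h' : Inv ℓ s' I')
    (hc : s'.Contractible α u v) : s.Contractible α u v := by
  obtain ⟨h1, h2, h3, h4, h5, h6, h7⟩ := hc
  rw [h'.outer_iff] at h7
  obtain ⟨u1, u2, u3, u4⟩ := T h3 (h'.working_verts h5).2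
  obtain ⟨v1, v2, v3, -⟩ := T h7.1 h7.2
  rw [u3, u4] at h5
  rw [u3, v3] at h6
  exact ⟨h1, h2, u1, v1, h5, h6, h.outer_iff.2 ⟨v1, v2⟩⟩

omit [Fintype V] in
theorem Thinner.refl : Thinner s I s I := fun h1 h2 => ⟨h1, h2, rfl, rfl⟩

omit [Fintype V] in
theorem Thinner.trans (T : Thinner s I s₁ I₁) (T' : Thinner s₁ I₁ s₂ I₂) : Thinner s I s₂ I₂ := by
  intro γ x hx hi
  obtain ⟨h1, h2, h3, h4⟩ := T' hx hi
  obtain ⟨h5, h6, h7, h8⟩ := T h1 h2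
  exact ⟨h5, h6, h3.trans h7, h4.trans h8⟩

theorem Status.joinStep (h : Status ℓ L s I) (hstep : JoinStep s (u, v) s') :
    ∃ I', Progress ℓ s I s' I' ∧ Status ℓ L s' I' ∧ Thinner s I s' I' ∧
      ∀ α β, ¬ s'.Joins α β u v := by
  cases hstep with
  | skip _ _ hsk => exact ⟨I, .refl h.inv, h, Thinner.refl, hsk⟩
  | augment α β _ _ _ hj hop =>
    obtain ⟨h1, h2, h3, h4⟩ := hj
    rw [h.inv.outer_iff] at h3 h4
    obtain ⟨I', P, h', -, T, hr⟩ := h.augment h3.1 h4.1 hop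
    refine ⟨I', P, h', T, fun γ δ hj' => ?_⟩
    exact h'.inv.own.not_removed (h'.inv.outer_iff.1 hj'.2.2.1).1 hr

theorem Status.joinScan (h : Status ℓ L s I) {l : List (V × V)} (hs : Scan JoinStep l s s') :
    ∃ I', Progress ℓ s I s' I' ∧ Status ℓ L s' I' ∧ Thinner s I s' I' ∧
      ∀ e ∈ l, ∀ α β, ¬ s'.Joins α β e.1 e.2 := by
  induction hs generalizing I with
  | nil => exact ⟨I, .refl h.inv, h, Thinner.refl, by simp⟩
  | cons hstep _ ih =>
    obtain ⟨I₁, P, h₁, T, hp⟩ := h.joinStep hstep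
    obtain ⟨I₂, Q, h₂, T', hp'⟩ := ih h₁
    refine ⟨I₂, P.trans Q, h₂, T.trans T', fun e he α β hj => ?_⟩
    rcases List.mem_cons.1 he with rfl | he
    · exact hp α β (T'.joins h₁.inv h₂.inv hj)
    · exact hp' e he α β hj

/-- Extend-Active-Path followed by Contract-and-Augment. -/
theorem Status.scans (h : Status ℓ L s I) {l l' : List (V × V)} (hl : IsStream G l)
    (hl' : IsStream G l') (hsep : s.Separated I) {s₃ : State M} (h1 : Scan ExtendStep l s s₁)
    (h2 : ContractAll s₁ s₂) (h3 : Scan JoinStep l' s₂ s₃) :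
    ∃ I₃, Progress ℓ s I s₃ I₃ ∧ Status ℓ L s₃ I₃ ∧
      (∀ {u v}, G.Adj u v → s₃.Processed I₃ u v) ∧ s₃.Closed I₃ := by
  obtain ⟨I₁, P₁, k₁, hp⟩ := h.extendScan (fun e he => (hl.2 e.1 e.2).1 he) h1
  obtain ⟨I₂, P₂, k₂⟩ := k₁.contractAll h2
  obtain ⟨I₃, P₃, k₃, T, hj⟩ := k₂.joinScan h3
  have P := (P₁.trans P₂).trans P₃
  refine ⟨I₃, P, k₃, fun {u v} hadj => ?_, ?_⟩
  · exact (P₂.trans P₃).processed (hp (u, v) ((hl.2 u v).2 hadj))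
  intro x y hx hy hadj hn
  by_contra hne
  obtain ⟨α, hα⟩ := hx.1
  obtain ⟨β, hβ⟩ := hy.1
  have hα' := k₃.inv.outer_iff.2 ⟨hα, hx.2⟩
  have hβ' := k₃.inv.outer_iff.2 ⟨hβ, hy.2⟩
  -- Within one structure the arc would be at a working vertex, and Contract would still apply; two
  -- free ends are excluded because a structure has one free vertex. Between two structures, the
  -- second scan has dealt with the arc.
  by_cases e : α = β
  · subst e
    have key : ∀ {x y}, s₃.Outer α x → s₃.Outer α y → G.Adj x y → ¬ M.Adj x y →
        s₃.Om x ≠ s₃.Om y → ¬ s₃.Fresh x := by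
      rintro x y hx hy hadj hn hne ⟨γ, -, hγ⟩
      obtain rfl := k₃.inv.own.disj (k₃.inv.working_verts hγ).1 hx.1
      exact h2.2 _ _ _ (T.contractible k₂.inv k₃.inv
        ⟨hadj, hn, hx.1, hy.1, hγ, hne.symm, hy⟩)
    rcases P.separated hsep hx hy hadj hn hne with ⟨hf, hf'⟩ | hf | hf
    · rw [k₃.inv.own.free_eq hα hf, k₃.inv.own.free_eq hβ hf'] at hadj
      exact G.loopless.irrefl _ hadj
    · exact key hα' hβ' hadj hn hne hf
    · exact key hβ' hα' hadj.symm (fun h => hn h.symm) (Ne.symm hne) hf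
  · exact hj (x, y) ((hl'.2 x y).2 hadj) α β ⟨hn, e, hα', hβ'⟩

end Progress

end MatchingPhase

namespace MatchingPhase

variable {V : Type*} {G : SimpleGraph V} {M : G.Subgraph}
variable {ℓ : ℕ} {s s' s₁ s₂ s₃ : State M} {I I' I₁ I₂ : Set V} {α β γ u v t p x y b c : V} {k : ℕ}
variable {B W : Set V} {L κ : ℝ}

/-! ### Backtracking -/

theorem Forest.OK.with_work {F : Forest V} (h : F.OK M ℓ) (hW : W ⊆ F.outer)
    (hW' : ∀ {x y}, x ∈ W → F.om y = F.om x → y ∈ W) : ({F with work := W} : Forest V).OK M ℓ :=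
  { matching := h.matching, mem_om := h.mem_om, om_eq := h.om_eq, om_vis := h.om_vis,
    arc_vis := h.arc_vis, arc_adj := h.arc_adj, inner_vis := h.inner_vis, inner_om := h.inner_om,
    inner_parent := h.inner_parent, inner_child := h.inner_child, arc_unique := h.arc_unique,
    label_lt := h.label_lt, crossing := h.crossing, mate := h.mate, blossom := h.blossom,
    work_outer := hW, work_om := hW' }

/-- The state `s` with other working vertices. -/
def State.withWorking (s : State M) (w : V → Option (Set V)) : State M :=
  { s with struct := fun α => { s.struct α with working := w α } }

theorem Inv.withWorking (h : Inv ℓ s I) {w : V → Option (Set V)}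
    (hw : ∀ {α W}, w α = some W → ∃ x ∈ (s.struct α).verts, x ∉ I ∧ W = s.Om x) :
    Inv ℓ (s.withWorking w) I where
  ok := by
    refine h.ok.with_work (W := {x | ∃ α, w α = some (s.Om x)}) ?_ ?_
    · rintro x ⟨α, hα⟩
      obtain ⟨y, hy, hyI, e⟩ := hw hα
      exact h.ok.outer_om ⟨⟨α, hy⟩, hyI⟩ e
    · rintro x y ⟨α, hα⟩ e
      exact ⟨α, hα.trans (congrArg some e.symm)⟩
  own :=
  { disj := h.own.disj, arcs := h.own.arcs, blossom_subset := h.own.blossom_subset,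
    blossom_nonempty := h.own.blossom_nonempty, root_free := h.own.root_free,
    root_mem := h.own.root_mem, free_eq := h.own.free_eq, cover := h.own.cover,
    not_removed := h.own.not_removed, removed_mate := h.own.removed_mate, working := hw,
    label_le := h.own.label_le, label_vis := h.own.label_vis }

/-- In the third case the blossom left by the working vertex is entered by a matched arc from an
inner `v`, so the grandparent is the outer parent of `v`. -/
theorem BacktrackTo.cases (h : Inv ℓ s I) {w : Option (Set V)} (hb : BacktrackTo s α w) :
    (w = (s.struct α).working ∧
      (α ∈ s.onHold ∨ α ∈ s.modified ∨ (s.struct α).working = none)) ∨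
    (α ∉ s.onHold ∧ α ∉ s.modified ∧
      ((w = none ∧ (s.struct α).working = some (s.Om α)) ∨
      ∃ x v t, x ∈ (s.struct α).verts ∧ v ∈ (s.struct α).verts ∧ x ∉ I ∧ v ∈ I ∧ M.Adj v t ∧
        (s.forest I).arc x v ∧ (s.struct α).working = some (s.Om t) ∧ w = some (s.Om x))) := by
  cases hb with
  | keep h1 => exact .inl ⟨rfl, h1⟩
  | root h1 h2 h3 => exact .inr ⟨h1, h2, .inl ⟨rfl, h3⟩⟩
  | grandparent X Y Z h1 h2 h3 h4 h5 h6 =>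
    refine .inr ⟨h1, h2, .inr ?_⟩
    obtain ⟨z, hz, hzI, rfl⟩ := h.own.working h3
    obtain ⟨hne, y, z', hyz, rfl, e⟩ := h6
    obtain ⟨hne', x, y', hxy, rfl, e'⟩ := h5
    have hz' := h.ok.not_inner_om hzI e
    have a1 : (s.forest I).arc y z' := ⟨α, hyz⟩
    have a2 : (s.forest I).arc x y' := ⟨α, hxy⟩
    obtain ⟨hy, -, hm⟩ := (h.ok.crossing a1 (by rw [← e] at hne; exact hne)).resolve_left
      fun h' => hz' h'.2.1
    obtain rfl := h.ok.eq_of_om_inner hy e'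
    refine ⟨x, y', z', (h.own.arcs hxy).1, (h.own.arcs hxy).2, ?_, hy, hm, a2, ?_, rfl⟩
    · exact (h.ok.parent hy a2).1.2
    · rw [h3, e]

/-- The base of a working blossom other than the root is matched, its mate is an inner parent, and
inner vertices have parents. -/
theorem Inv.exists_backtrackTo (h : Inv ℓ s I) (α : V) : ∃ w, BacktrackTo s α w := by
  by_cases h1 : α ∈ s.onHold ∨ α ∈ s.modified ∨ (s.struct α).working = none
  · exact ⟨_, .keep h1⟩
  push Not at h1
  obtain ⟨h1, h2, h3⟩ := h1
  obtain ⟨Z, hZ⟩ := Option.ne_none_iff_exists'.1 h3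
  obtain ⟨z, hz, hzI, rfl⟩ := h.own.working hZ
  by_cases e : s.Om z = s.Om α
  · exact ⟨_, .root h1 h2 (hZ.trans (congrArg some e))⟩
  · have ho : z ∈ (s.forest I).outer := ⟨⟨α, hz⟩, hzI⟩
    obtain ⟨b, hb, hbm, -⟩ := h.ok.blossom ho
    have hb' := h.om_verts hz hb
    have hnf : ¬ Free M b := fun hf => by
      obtain rfl := h.own.free_eq hb' hf
      exact e (h.ok.om_eq hb).symm
    simp only [Free, not_forall, not_not] at hnf
    obtain ⟨m, hm⟩ := hnf
    have hmo := hbm m hm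
    have hbo := h.ok.outer_om ho (h.ok.om_eq hb)
    have hmI : m ∈ I := (h.ok.mate hbo hm).resolve_left fun e' => hmo
      (h.ok.om_eq_iff.1 (e'.trans (h.ok.om_eq hb)))
    have a1 := (h.ok.mate_of_inner hmI hm.symm).2
    obtain ⟨p, a2⟩ := h.ok.inner_parent hmI
    have hm' := h.mate_verts hb' hm
    have hp' := (h.arc_verts a2).2 hm'
    exact ⟨_, .grandparent (s.Om p) (s.Om m) (s.Om z) h1 h2 hZ e
      ⟨h.ok.om_ne_of_arc_inner hmI a2, p, m, h.arc_struct a2 hp', rfl, rfl⟩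
      ⟨fun e' => hmo (h.ok.om_eq_iff.1 e'), m, b, h.arc_struct a1 hm', rfl, h.ok.om_eq hb⟩⟩

theorem Inv.exists_backtrack (h : Inv ℓ s I) : ∃ s', Backtrack s s' := by
  choose w hw using h.exists_backtrackTo
  exact ⟨_, w, hw, rfl⟩

section Backtrack

variable {w : V → Option (Set V)} (h : Inv ℓ s I) (hw : ∀ α, BacktrackTo s α (w α))
include h hw

theorem Inv.backtrack : Inv ℓ (s.withWorking w) I := by
  refine h.withWorking fun {α W} hα => ?_
  rcases (hw α).cases h with ⟨e, -⟩ | ⟨-, -, ⟨e, -⟩ | ⟨x, v, t, hx, -, hxI, -, -, -, -, e⟩⟩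
  · exact h.own.working (e ▸ hα)
  · rw [e] at hα
    cases hα
  · rw [e, Option.some.injEq] at hα
    exact ⟨x, hx, hxI, hα.symm⟩

/-- A new working vertex is an ancestor of the old one. -/
theorem Inv.act_of_backtrack (ha : ((s.withWorking w).forest I).Act x) : (s.forest I).Act x := by
  obtain ⟨y, ⟨γ, hγ⟩, ha⟩ := ha
  replace hγ : w γ = some (s.Om y) := hγ
  replace ha : (s.forest I).Anc x y := ha
  rcases (hw γ).cases h with ⟨e, -⟩ | ⟨-, -, ⟨e, -⟩ | ⟨z, v, t, -, -, -, hv, hm, harc, hz, e⟩⟩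
  · exact ⟨y, ⟨γ, e ▸ hγ⟩, ha⟩
  · rw [e] at hγ
    cases hγ
  · rw [e, Option.some.injEq] at hγ
    exact ⟨t, ⟨γ, hz⟩, ((ha.tail (.inl hγ.symm)).tail (.inr harc)).tail
      (.inr (h.ok.mate_of_inner hv hm).2)⟩

/-- An outer vertex loses its activity only if it lies in the old working vertex of a structure that
was neither modified nor on hold. All its arcs were then read while it was working, so none of them
admits an overtaking. The other outer vertices of the active path are above the grandparent. -/
theorem Inv.backtrack_settled (hs : s.Settled I)
    (hp : ∀ {u v}, G.Adj u v → s.Processed I u v) : (s.withWorking w).Settled I := by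
  intro u v t hu hv ho hadj hn hm
  rcases hs hu hv ho hadj hn hm with ha | hle
  swap
  · exact .inr hle
  obtain ⟨γ, hγ⟩ := hu.1
  replace hγ : u ∈ (s.struct γ).verts := hγ
  obtain ⟨z, hz, ha⟩ := (h.act_iff hγ).1 ha
  have fin : s.Om u = s.Om z → γ ∉ s.onHold → γ ∉ s.modified →
      ((s.withWorking w).forest I).Act u ∨
        (s.withWorking w).label v t ≤ ((s.withWorking w).forest I).dist M u + 1 :=
    fun e h1 h2 => .inr (hp hadj h2 h1 (e ▸ hz) hv ho hn hm)
  rcases (hw γ).cases h with ⟨e, -⟩ | ⟨h1, h2, ⟨e, hr⟩ | ⟨x, v', t', -, -, -, hv', hm', harc, hz', e⟩⟩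
  · exact .inl ⟨z, ⟨γ, e.trans hz⟩, ha⟩
  · rw [hz, Option.some.injEq] at hr
    refine fin (h.ok.anc_antisymm ha ?_) h1 h2
    exact (Relation.ReflTransGen.single (.inl hr)).trans (h.root_anc hγ)
  · rw [hz, Option.some.injEq] at hz'
    have hmate := h.ok.mate_of_inner hv' hm'
    by_cases e1 : s.Om u = s.Om t'
    · exact fin (e1.trans hz'.symm) h1 h2
    · have a1 := h.ok.anc_parent (ha.tail (.inl hz')) hmate.2
        (h.ok.om_ne_of_inner_arc hv' hmate.2) e1
      have a2 := h.ok.anc_parent a1 harc (h.ok.om_ne_of_arc_inner hv' harc)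
        fun e2 => hu.2 (h.ok.eq_of_om_inner hv' e2 ▸ hv')
      exact .inl ⟨x, ⟨γ, e⟩, a2⟩

theorem Inv.backtrack_active : (s.withWorking w).active ⊆ s.active := by
  intro γ hγ
  replace hγ : w γ ≠ none := hγ
  rcases (hw γ).cases h with ⟨e, -⟩ | ⟨h1, h2, ⟨e, hr⟩ | ⟨x, v', t', -, -, -, -, -, -, hz', e⟩⟩
  · exact fun h0 => hγ (e.trans h0)
  · exact absurd e hγ
  · intro h0
    rw [hz'] at h0
    cases h0

/-- Each structure that moves to a grandparent loses the matched arc of the two skipped tree arcs.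
Different structures lose different arcs, as the tails lie in disjoint vertex sets. -/
theorem Inv.backtrack_crit [Finite V] :
    (((s.withWorking w).forest I).crit M).ncard +
      ((s.withWorking w).active \ (s.onHold ∪ s.modified)).ncard ≤
    ((s.forest I).crit M).ncard := by
  have hsub : ((s.withWorking w).forest I).crit M ⊆ (s.forest I).crit M :=
    fun e he => ⟨he.1, he.2.1, h.act_of_backtrack hw he.2.2⟩
  rw [← Set.ncard_sdiff_add_ncard_of_subset hsub (Set.toFinite _), add_comm]
  refine Nat.add_le_add_right ?_ _
  have key : ∀ γ ∈ (s.withWorking w).active \ (s.onHold ∪ s.modified), ∃ e : V × V,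
      e.1 ∈ (s.struct γ).verts ∧ e ∈ (s.forest I).crit M \ ((s.withWorking w).forest I).crit M := by
    rintro γ ⟨hγ, hγ'⟩
    replace hγ : w γ ≠ none := hγ
    rcases (hw γ).cases h with ⟨e, h1⟩ | ⟨h1, h2, ⟨e, hr⟩ |
      ⟨x, v, t, hx, hv', hxI, hv, hm, harc, hz, e⟩⟩
    · rcases h1 with h1 | h1 | h1
      · exact absurd (.inl h1) hγ'
      · exact absurd (.inr h1) hγ'
      · exact absurd (e.trans h1) hγ
    · exact absurd e hγ
    · refine ⟨(v, t), hv', ⟨hm, hv, t, ⟨γ, hz⟩, .refl⟩, fun hc => ?_⟩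
      have ht := h.mate_verts hv' hm
      obtain ⟨y, hy, ha⟩ := ((h.backtrack hw).act_iff (α := γ) ht).1 hc.2.2
      replace hy : w γ = some (s.Om y) := hy
      rw [e, Option.some.injEq] at hy
      have ha' : (s.forest I).Anc t x := Relation.ReflTransGen.tail ha (.inl hy.symm)
      have hmate := h.ok.mate_of_inner hv hm
      have h1 := h.ok.anc_antisymm (Relation.ReflTransGen.tail (.single (.inr hmate.2)) (.inl rfl))
        (ha'.tail (.inr harc))
      exact h.ok.om_ne_of_inner_arc hv hmate.2 h1
  choose! f hf using key
  refine Set.ncard_le_ncard_of_injOn f (fun γ hγ => (hf γ hγ).2) ?_ (Set.toFinite _)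
  intro γ hγ δ hδ e
  exact h.own.disj (hf γ hγ).1 (e ▸ (hf δ hδ).1)

end Backtrack

/-! ### Pass-bundles -/

/-- The invariants of a phase at the end of a pass-bundle. -/
structure Boundary (ℓ : ℕ) (L : ℝ) (s : State M) (I : Set V) : Prop where
  inv : Inv ℓ s I
  size : Size ℓ L s I
  recorded : Recorded ℓ L s
  settled : s.Settled I
  separated : ∀ {x y}, x ∈ (s.forest I).outer → y ∈ (s.forest I).outer → G.Adj x y →
    ¬ M.Adj x y → s.Om x = s.Om y ∨ (Free M x ∧ Free M y)
  two_le : 2 ≤ L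
  pos : 1 ≤ ℓ

theorem Boundary.mark_inv (hs : Boundary ℓ (limitH κ) s I) : Inv ℓ (s.mark κ) I :=
  ⟨hs.inv.ok, ⟨hs.inv.own.disj, hs.inv.own.arcs, hs.inv.own.blossom_subset,
    hs.inv.own.blossom_nonempty, hs.inv.own.root_free, hs.inv.own.root_mem, hs.inv.own.free_eq,
    hs.inv.own.cover, hs.inv.own.not_removed, hs.inv.own.removed_mate, hs.inv.own.working,
    hs.inv.own.label_le, hs.inv.own.label_vis⟩⟩

theorem Boundary.mark (hs : Boundary ℓ (limitH κ) s I) : Status ℓ (limitH κ) (s.mark κ) I where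
  inv := hs.mark_inv
  size := ⟨hs.size.verts, hs.size.sub⟩
  recorded := ⟨hs.recorded.finite, hs.recorded.support, hs.recorded.disjoint, hs.recorded.removed⟩
  small := fun _ h1 => not_le.1 h1
  two_le := hs.two_le
  pos := hs.pos

/-- The potential pays for every structure active at the end that was not on hold: a modified one
through the operations that marked it, an unmodified one through the critical arc lost in
backtracking. -/
theorem Boundary.passBundle [Fintype V] (hs : Boundary ℓ (limitH κ) s I) {l l' : List (V × V)}
    (hl : IsStream G l) (hl' : IsStream G l') (hb : PassBundle κ l l' s s') :
    ∃ I', Boundary ℓ (limitH κ) s' I' ∧ s'.Closed I' ∧ s'.active ⊆ s.active ∧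
      s'.potential I' + (s'.active \ (s.mark κ).onHold).ncard ≤ s.potential I := by
  obtain ⟨s₁, s₂, s₃, h1, h2, h3, w, hw, rfl⟩ := hb
  have hsep : (s.mark κ).Separated I := fun hx hy hadj hn hne =>
    .inl ((hs.separated hx hy hadj hn).resolve_left hne)
  have hset : (s.mark κ).Settled I := hs.settled
  obtain ⟨I₃, P, k, hp, hsep'⟩ := hs.mark.scans hl hl' hsep h1 h2 h3
  have hcrit := k.inv.backtrack_crit hw
  have hact := k.inv.backtrack_active hw
  refine ⟨I₃, ⟨k.inv.backtrack hw, ⟨k.size.verts, k.size.sub⟩,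
    ⟨k.recorded.finite, k.recorded.support, k.recorded.disjoint, k.recorded.removed⟩,
    k.inv.backtrack_settled hw (P.settled hset) hp,
    fun hx hy hadj hn => .inl (hsep' hx hy hadj hn), hs.two_le, hs.pos⟩, hsep',
    hact.trans P.active, ?_⟩
  have hpot := P.potential
  have h0 : ((s.mark κ).modified ∩ (s.mark κ).active).ncard = 0 := by
    simp [State.mark]
  rw [h0] at hpot
  have hle : ((s₃.withWorking w).active \ (s.mark κ).onHold).ncard ≤
      (s₃.modified ∩ s₃.active).ncard +
        ((s₃.withWorking w).active \ (s₃.onHold ∪ s₃.modified)).ncard := by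
    refine (Set.ncard_le_ncard ?_ (Set.toFinite _)).trans (Set.ncard_union_le _ _)
    rintro γ ⟨g1, g2⟩
    by_cases g3 : γ ∈ s₃.modified
    · exact .inl ⟨g3, hact g1⟩
    · refine .inr ⟨g1, ?_⟩
      rintro (g4 | g4)
      · exact g2 (P.onHold ▸ g4)
      · exact g3 g4
  have e1 : (s₃.withWorking w).potential I₃ = 3 * s₃.labelSum +
    (((s₃.withWorking w).forest I₃).crit M).ncard := rfl
  have e2 : s₃.potential I₃ = 3 * s₃.labelSum + ((s₃.forest I₃).crit M).ncard := rfl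
  have e3 : (s.mark κ).potential I = s.potential I := rfl
  change (s₃.withWorking w).potential I₃ +
    ((s₃.withWorking w).active \ (s.mark κ).onHold).ncard ≤ s.potential I
  omega

/-! ### The procedures can be carried out -/

theorem Inv.exists_extendStep (h : Inv ℓ s I) (hadj : G.Adj u v) :
    ∃ s', ExtendStep s (u, v) s' := by
  by_cases he : ∀ α, ¬ s.Eligible α u v
  · exact ⟨s, .skip u v he⟩
  push Not at he
  obtain ⟨α, he⟩ := he
  obtain ⟨hur, hvr, hne, hw, hn, hα, hα'⟩ := id he
  have hu := h.working_verts hw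
  by_cases ho : ∃ β, s.Outer β v
  · obtain ⟨β, hβ⟩ := ho
    have hβ' := h.outer_iff.1 hβ
    by_cases e : β = α
    · subst e
      obtain ⟨s', hs'⟩ := exists_contractOp h hw hβ'.1
      exact ⟨s', .contract _ u v s' he hβ hs'⟩
    · obtain ⟨s', hs'⟩ := exists_augmentOp h hu.1 hu.2 hβ'.1 hβ'.2 (Ne.symm e) hadj hn
      exact ⟨s', .augment _ β u v s' he e hβ hs'⟩
  · push Not at ho
    have hvo : v ∉ (s.forest I).outer := fun ho' => by
      obtain ⟨β, hβ⟩ := h.exists_outer_iff.2 ho'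
      exact ho β hβ
    have hd := (h.distance_iff (u := u) ⟨⟨α, hu.1⟩, hu.2⟩ (d := (s.forest I).dist M u)).2 rfl
    -- A free vertex that is not removed is the root of its structure and thus outer. Hence `v` has
    -- a mate, and there is an arc to overtake.
    have hnf : ¬ Free M v := fun hf => by
      have := h.own.cover hf hvr
      exact hvo (h.root_outer this)
    simp only [Free, not_forall, not_not] at hnf
    obtain ⟨t, hm⟩ := hnf
    by_cases hle : s.label v t ≤ (s.forest I).dist M u + 1
    · exact ⟨s, .noOvertake α u v t _ he ho hd hm hle⟩
    · push Not at hle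
      have : ∃ s', OvertakeOp s α u v t ((s.forest I).dist M u + 1) s' := by
        by_cases hv : ∀ β, v ∉ (s.struct β).verts
        · exact ⟨_, .unvisited hv⟩
        · push Not at hv
          obtain ⟨β, hv⟩ := hv
          have hvI : v ∈ I := by
            by_contra hi
            exact hvo ⟨⟨β, hv⟩, hi⟩
          obtain ⟨p, hp⟩ := h.ok.inner_parent hvI
          have hp' := h.arc_struct hp ((h.arc_verts hp).2 hv)
          have hpv := h.ok.om_ne_of_arc_inner hvI hp
          by_cases e : β = α
          · subst e
            exact ⟨_, .same hv p hp' hpv⟩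
          · exact ⟨_, .other β e hv p hp' hpv⟩
      obtain ⟨s', hs'⟩ := this
      exact ⟨s', .overtake α u v t _ s' he ho hd hm hle hs'⟩

theorem Inv.exists_joinStep (h : Inv ℓ s I) (hadj : G.Adj u v) :
    ∃ s', JoinStep s (u, v) s' := by
  by_cases hj : ∀ α β, ¬ s.Joins α β u v
  · exact ⟨s, .skip u v hj⟩
  push Not at hj
  obtain ⟨α, β, hj⟩ := hj
  obtain ⟨hn, hne, hu, hv⟩ := id hj
  rw [h.outer_iff] at hu hv
  obtain ⟨s', hs'⟩ := exists_augmentOp h hu.1 hu.2 hv.1 hv.2 hne hadj hn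
  exact ⟨s', .augment α β u v s' hj hs'⟩

section Existence

variable [Fintype V]

theorem Status.exists_extendScan (h : Status ℓ L s I) {l : List (V × V)}
    (hl : ∀ e ∈ l, G.Adj e.1 e.2) : ∃ s', Scan ExtendStep l s s' := by
  induction l generalizing s I with
  | nil => exact ⟨s, .nil s⟩
  | cons e l ih =>
    obtain ⟨s₁, h1⟩ := h.inv.exists_extendStep (hl e (by simp))
    obtain ⟨I₁, -, h₁, -⟩ := h.extendStep (hl e (by simp)) h1
    obtain ⟨s₂, h2⟩ := ih h₁ fun e he => hl e (by simp [he])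
    exact ⟨s₂, .cons h1 h2⟩

theorem Status.exists_joinScan (h : Status ℓ L s I) {l : List (V × V)}
    (hl : ∀ e ∈ l, G.Adj e.1 e.2) : ∃ s', Scan JoinStep l s s' := by
  induction l generalizing s I with
  | nil => exact ⟨s, .nil s⟩
  | cons e l ih =>
    obtain ⟨s₁, h1⟩ := h.inv.exists_joinStep (hl e (by simp))
    obtain ⟨I₁, -, h₁, -⟩ := h.joinStep h1
    obtain ⟨s₂, h2⟩ := ih h₁ fun e he => hl e (by simp [he])
    exact ⟨s₂, .cons h1 h2⟩

/-- Every contraction lowers the sum of the labels, so the procedure terminates. -/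
theorem Status.exists_contractAll (h : Status ℓ L s I) : ∃ s', ContractAll s s' := by
  obtain ⟨n, hn⟩ : ∃ n, s.labelSum = n := ⟨_, rfl⟩
  induction n using Nat.strong_induction_on generalizing s I with
  | _ n ih =>
    by_cases hc : ∀ α u v, ¬ s.Contractible α u v
    · exact ⟨s, .refl, hc⟩
    push Not at hc
    obtain ⟨α, u, v, hc⟩ := hc
    obtain ⟨hadj, hm, hu, hv, hw, hne, ho⟩ := id hc
    obtain ⟨s₁, h1⟩ := exists_contractOp h.inv hw hv
    obtain ⟨I₁, -, h₁, -, hlt⟩ := h.contract hw hv (h.inv.outer_iff.1 ho).2 hadj hm hne.symm h1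
    obtain ⟨s₂, h2, h3⟩ := ih _ (hn ▸ hlt) h₁ rfl
    exact ⟨s₂, .head ⟨α, u, v, hc, h1⟩ h2, h3⟩

theorem Boundary.exists_passBundle (hs : Boundary ℓ (limitH κ) s I) {l l' : List (V × V)}
    (hl : IsStream G l) (hl' : IsStream G l') : ∃ s', PassBundle κ l l' s s' := by
  have hl₁ : ∀ e ∈ l, G.Adj e.1 e.2 := fun e he => (hl.2 e.1 e.2).1 he
  have hl₂ : ∀ e ∈ l', G.Adj e.1 e.2 := fun e he => (hl'.2 e.1 e.2).1 he
  obtain ⟨s₁, h1⟩ := hs.mark.exists_extendScan hl₁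
  obtain ⟨I₁, -, k₁, -⟩ := hs.mark.extendScan hl₁ h1
  obtain ⟨s₂, h2⟩ := k₁.exists_contractAll
  obtain ⟨I₂, -, k₂⟩ := k₁.contractAll h2
  obtain ⟨s₃, h3⟩ := k₂.exists_joinScan hl₂
  obtain ⟨I₃, -, k₃, -⟩ := k₂.joinScan h3
  obtain ⟨s', h4⟩ := k₃.inv.exists_backtrack
  exact ⟨s', s₁, s₂, s₃, h1, h2, h3, h4⟩

end Existence

end MatchingPhase

namespace MatchingPhase

variable {V : Type*} {G : SimpleGraph V} {M : G.Subgraph}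
variable {ℓ : ℕ} {s s' : State M} {I : Set V} {α β γ u v t p x y z b : V} {k : ℕ}
variable {L κ : ℝ}

/-! ### Short augmenting paths -/

open Classical in
/-- A short alternating walk from an inactive outer vertex to a free vertex meets a removed vertex
or the tail of a critical arc. -/
theorem Boundary.blocked (hs : Boundary ℓ L s I) (hcl : s.Closed I) : ∀ (n : ℕ) {x z : V} (w : G.Walk x z) (i : ℕ),
    w.length = n → w.IsPath → w.edges.IsChain (fun e f => e ∈ M.edgeSet ↔ f ∉ M.edgeSet) →
    (∀ e ∈ w.edges.head?, e ∉ M.edgeSet) → Free M z → x ≠ z → x ∈ (s.forest I).outer →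
    ¬ (s.forest I).Act x → (s.forest I).dist M x ≤ i →
    i + w.edges.countP (· ∈ M.edgeSet) ≤ ℓ →
    (∃ b ∈ s.Om x, (∀ m, M.Adj b m → m ∉ s.Om x) ∧ b ∉ w.support.tail) →
    (∀ y ∈ w.support, y ∉ s.removed) →
    (∀ y ∈ w.support, ∀ t, (y, t) ∉ (s.forest I).crit M) → False := by
  intro n
  induction n using Nat.strong_induction_on with
  | _ n ih =>
  intro x z w i hlen hp hch hhead hz hxz hx hna hd hi hb hr hc
  have h := hs.inv
  obtain ⟨b, hbx, hbm, hbt⟩ := hb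
  -- a free vertex that is not removed is outer
  have hfree : ∀ {y}, y ∉ s.removed → Free M y → y ∈ (s.forest I).outer := fun h1 h2 =>
    h.root_outer (h.own.cover h2 h1)
  have hbase : ∀ {y}, y ∈ s.Om x → (∀ m, M.Adj y m → m ∉ s.Om x) → y = b := fun h1 h2 =>
    h.ok.base_unique hx hbx h1 hbm h2
  cases w with
  | nil => exact hxz rfl
  | @cons _ v _ hxv w =>
  have hxvM : ¬ M.Adj x v := fun hm => hhead s(x, v) (by simp) hm
  rw [SimpleGraph.Walk.support_cons, List.tail_cons] at hbt
  cases w with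
  -- The free end would lie in the blossom of `x` and be its base, but the base does not occur on
  -- the rest of the walk.
  | nil =>
    have hv := hfree (hr z (by simp)) hz
    have e := hcl hx hv hxv hxvM
    have hvx : z ∈ s.Om x := e ▸ s.mem_Om z
    exact hbt (hbase hvx (fun m hm => absurd hm (hz m)) ▸ by simp)
  | @cons _ t _ hvt w =>
    rw [SimpleGraph.Walk.edges_cons, SimpleGraph.Walk.edges_cons, List.isChain_cons_cons] at hch
    have hm : M.Adj v t := by
      by_contra hm
      exact hxvM (hch.1.2 hm)
    have hp' := hp.of_cons.of_cons
    have hch' := hch.2.tail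
    have htz : t ≠ z := by
      rintro rfl
      exact hz v hm.symm
    have hhead' : ∀ e ∈ w.edges.head?, e ∉ M.edgeSet := by
      intro e he
      have := hch.2
      rw [List.isChain_cons] at this
      exact (this.1 e he).1 hm
    have hcount : i + 1 + w.edges.countP (· ∈ M.edgeSet) ≤ ℓ := by
      have : s(v, t) ∈ M.edgeSet := hm
      rw [SimpleGraph.Walk.edges_cons, SimpleGraph.Walk.edges_cons, List.countP_cons,
        List.countP_cons_of_pos (by simpa using hm)] at hi
      omega
    have hl : w.length < n := by
      simp only [SimpleGraph.Walk.length_cons] at hlen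
      omega
    have hr' : ∀ y ∈ w.support, y ∉ s.removed := fun y hy => hr y (by simp [hy])
    have hc' : ∀ y ∈ w.support, ∀ t, (y, t) ∉ (s.forest I).crit M :=
      fun y hy => hc y (by simp [hy])
    have hbt' : b ∉ w.support.tail := fun h' => hbt (by simp [List.mem_of_mem_tail h'])
    -- In this case `v` lies in the blossom of `x`. It is not the base, so its mate `t` is in the
    -- blossom too, and the walk goes on with the same distance and the same base.
    by_cases hv : v ∈ (s.forest I).outer
    · have e := hcl hx hv hxv hxvM
      have hvx : v ∈ s.Om x := e ▸ s.mem_Om v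
      have htx : t ∈ s.Om x := by
        by_contra htx
        refine hbt (hbase hvx (fun m hm' => ?_) ▸ by simp)
        rwa [h.ok.matching.eq_of_adj_left hm' hm]
      have et : s.Om t = s.Om x := h.ok.om_eq htx
      refine ih _ hl w (i + 1) rfl hp' hch' hhead' hz htz (h.ok.outer_om hx et) ?_ ?_ hcount ?_
        hr' hc'
      · rintro ⟨y, h1, h2⟩
        exact hna ⟨y, h1, .head (.inl et.symm) h2⟩
      · rw [Forest.OK.dist_om (F := s.forest I) et]
        omega
      · rw [et]
        exact ⟨b, hbx, hbm, hbt'⟩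
    · have hvr := hr v (by simp)
      -- As `x` is inactive and settled, `(v, t)` cannot be overtaken. Its label is thus at most `i
      -- + 1 ≤ ℓ`, so `v` was visited and is inner; its mate is outer with this label as distance,
      -- and inactive because the arc is not critical.
      have hlab : s.label v t ≤ i + 1 :=
        ((hs.settled hx hvr hv hxv hxvM hm).resolve_left hna).trans (by omega)
      have hvis := (h.own.label_vis hm (hlab.trans (by omega))).resolve_right hvr
      have hvI : v ∈ I := by
        by_contra hvI
        exact hv ⟨hvis, hvI⟩
      have hmate := h.ok.mate_of_inner hvI hm
      have hvt' : v ∉ s.Om t := fun hvt' =>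
        h.ok.om_ne_of_inner_arc hvI hmate.2 (h.ok.om_eq hvt')
      refine ih _ hl w (i + 1) rfl hp' hch' hhead' hz htz hmate.1 ?_ ?_ hcount ?_ hr' hc'
      · exact fun ha => hc v (by simp) t ⟨hm, hvI, ha⟩
      · rw [h.ok.dist_mate hvI hm]
        exact hlab
      · refine ⟨t, s.mem_Om t, fun m hm' => ?_, ?_⟩
        · rwa [h.ok.matching.eq_of_adj_left hm' hm.symm]
        · have := hp'.support_nodup
          rw [← SimpleGraph.Walk.cons_tail_support, List.nodup_cons] at this
          exact this.1

open Classical in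
theorem AugPath.countP_le (q : AugPath M) (hq : q.IsShort k) :
    q.walk.edges.countP (· ∈ M.edgeSet) ≤ k := by
  refine le_trans (le_of_eq ?_) hq
  have : {e | e ∈ q.walk.edges ∧ e ∈ M.edgeSet} =
      ((q.walk.edges.filter (· ∈ M.edgeSet)).toFinset : Set (Sym2 V)) := by
    ext e
    simp
  rw [this, Set.ncard_coe_finset, List.toFinset_card_of_nodup, List.countP_eq_length_filter]
  exact q.isPath.isTrail.edges_nodup.filter _

theorem head_edge_not_matched (w : G.Walk x z) (hf : Free M x) :
    ∀ e ∈ w.edges.head?, e ∉ M.edgeSet := by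
  intro e he hm
  cases w with
  | nil => simp at he
  | cons hadj w =>
    simp only [SimpleGraph.Walk.edges_cons, List.head?_cons, Option.mem_def,
      Option.some.injEq] at he
    subst he
    exact hf _ hm

/-- The walk starts at a root, which is its own base and has distance `0`. The number of matched
edges passed bounds the distance throughout. -/
theorem Boundary.hits (hs : Boundary ℓ L s I) (hcl : s.Closed I) (q : AugPath M) (hq : q.IsShort ℓ) :
    ∃ x ∈ q.walk.support, x ∈ s.removed ∪ Prod.fst '' (s.forest I).crit M ∪ s.active := by
  classical
  by_contra hcon
  push Not at hcon
  have hr : ∀ y ∈ q.walk.support, y ∉ s.removed := fun y hy h' => hcon y hy (.inl (.inl h'))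
  have hsrc := hs.inv.own.cover q.src_free (hr _ q.walk.start_mem_support)
  refine hs.blocked hcl _ q.walk 0 rfl q.isPath q.alternating (head_edge_not_matched _ q.src_free) q.tgt_free
    q.src_ne_tgt (hs.inv.root_outer hsrc) ?_ (hs.inv.dist_root hsrc).le ?_ ?_ hr
    fun y hy t ht => hcon y hy (.inl (.inr ⟨_, ht, rfl⟩))
  · intro ha
    obtain ⟨w, hw, -⟩ := (hs.inv.act_iff hsrc).1 ha
    refine hcon _ q.walk.start_mem_support (.inr ?_)
    simp [State.active, hw]
  · rw [zero_add]
    exact q.countP_le hq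
  · refine ⟨q.src, s.mem_Om _, fun m hm => absurd hm (q.src_free m), ?_⟩
    have := q.isPath.support_nodup
    rw [← SimpleGraph.Walk.cons_tail_support, List.nodup_cons] at this
    exact this.1

/-! ### Counting short paths, critical arcs and structures on hold. -/

section Counting

variable [Finite V]

theorem Boundary.card_le (hs : Boundary ℓ L s I) (hcl : s.Closed I) {Q : Finset (AugPath M)}
    (hQ : IsDisjointShort ℓ Q) :
    Q.card ≤ s.removed.ncard + ((s.forest I).crit M).ncard + s.active.ncard := by
  have key : ∀ q ∈ Q, ∃ x ∈ q.walk.support,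
      x ∈ s.removed ∪ Prod.fst '' (s.forest I).crit M ∪ s.active :=
    fun q hq => hs.hits hcl q (hQ.1 q hq)
  by_cases hne : Nonempty V
  swap
  · have : Q = ∅ := Finset.eq_empty_of_forall_notMem fun q _ => hne ⟨q.src⟩
    simp [this]
  choose! f hf using key
  have h1 : Q.card ≤ (s.removed ∪ Prod.fst '' (s.forest I).crit M ∪ s.active).ncard := by
    rw [← Set.ncard_coe_finset Q]
    refine Set.ncard_le_ncard_of_injOn f (fun q hq => (hf q hq).2) ?_ (Set.toFinite _)
    intro q hq q' hq' e
    by_contra hne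
    exact hQ.2 q hq q' hq' hne (hf q hq).1 (e ▸ (hf q' hq').1)
  have h2 := Set.ncard_union_le (s.removed ∪ Prod.fst '' (s.forest I).crit M) s.active
  have h3 := Set.ncard_union_le s.removed (Prod.fst '' (s.forest I).crit M)
  have h4 := Set.ncard_image_le (f := Prod.fst) (Set.toFinite ((s.forest I).crit M))
  omega

/-- The pair of structure and label determines a critical arc: two arcs on the same active path have
comparable tails, and equal labels mean equal ranks. The labels lie between `1` and `ℓ`. -/
theorem Inv.crit_le (h : Inv ℓ s I) :
    ((s.forest I).crit M).ncard ≤ s.active.ncard * ℓ := by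
  have key : ∀ e ∈ (s.forest I).crit M, ∃ γ w, e.1 ∈ (s.struct γ).verts ∧
      (s.struct γ).working = some (s.Om w) ∧ (s.forest I).Anc e.2 w := by
    rintro ⟨v, t⟩ ⟨hm, hv, ha⟩
    obtain ⟨γ, hγ⟩ := h.ok.inner_vis hv
    obtain ⟨w, h1, h2⟩ := (h.act_iff (h.mate_verts hγ hm)).1 ha
    exact ⟨γ, w, hγ, h1, h2⟩
  by_cases hne : Nonempty V
  swap
  · have : (s.forest I).crit M = ∅ :=
      Set.eq_empty_of_forall_notMem fun e _ => hne ⟨e.1⟩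
    simp [this]
  choose! f g hf using key
  have hcard : (s.active ×ˢ Set.Icc 1 ℓ).ncard = s.active.ncard * ℓ := by
    rw [Set.ncard_prod, ← Finset.coe_Icc, Set.ncard_coe_finset, Nat.card_Icc,
      Nat.add_sub_cancel]
  rw [← hcard]
  refine Set.ncard_le_ncard_of_injOn (fun e => (f e, s.label e.1 e.2)) ?_ ?_ (Set.toFinite _)
  · intro e he
    refine ⟨?_, h.ok.label_pos he.2.1 he.1, h.ok.label_le he.2.1 he.1⟩
    simp [State.active, (hf e he).2.1]
  · intro e he e' he' eq
    rw [Prod.mk.injEq] at eq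
    obtain ⟨-, h2, h3⟩ := hf e he
    obtain ⟨-, h2', h3'⟩ := hf e' he'
    rw [eq.1, h2', Option.some.injEq] at h2
    have a1 : (s.forest I).Anc e.1 (g e') :=
      ((h.ok.anc_of_act_mate he.2.1 he.1).trans h3).tail (.inl h2.symm)
    have a2 : (s.forest I).Anc e'.1 (g e') := (h.ok.anc_of_act_mate he'.2.1 he'.1).trans h3'
    have hrank : (s.forest I).rank M e.1 = (s.forest I).rank M e'.1 := by
      rw [h.ok.rank_inner he.2.1 he.1, h.ok.rank_inner he'.2.1 he'.1]
      have := eq.2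
      change 2 * s.label e.1 e.2 - 1 = 2 * s.label e'.1 e'.2 - 1
      omega
    have e1 : e.1 = e'.1 := by
      rcases h.ok.anc_total a1 a2 with a | a
      · rcases h.ok.anc_rank a with eo | hlt
        · exact h.ok.eq_of_om_inner he'.2.1 eo
        · omega
      · rcases h.ok.anc_rank a with eo | hlt
        · exact (h.ok.eq_of_om_inner he.2.1 eo).symm
        · omega
    refine Prod.ext e1 (h.ok.matching.eq_of_adj_left he.1 ?_)
    rw [e1]
    exact he'.1

/-- Structures are disjoint, and all vertices of a structure but its root are matched. -/
theorem Inv.onHold_le (h : Inv ℓ s I) :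
    ({γ | L ≤ ((s.struct γ).verts.ncard : ℝ)}.ncard : ℝ) * (L - 1) ≤ M.verts.ncard := by
  classical
  have := Fintype.ofFinite V
  set T : Finset V := {γ | L ≤ ((s.struct γ).verts.ncard : ℝ)}.toFinset with hT
  have hcard : {γ | L ≤ ((s.struct γ).verts.ncard : ℝ)}.ncard = T.card :=
    Set.ncard_eq_toFinset_card' _
  have hdis : (T : Set V).PairwiseDisjoint fun γ => ((s.struct γ).verts \ {γ}).toFinset := by
    intro γ _ δ _ hne
    rw [Function.onFun, Set.disjoint_toFinset, Set.disjoint_left]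
    exact fun x hx hx' => hne (h.own.disj hx.1 hx'.1)
  have hsub : T.biUnion (fun γ => ((s.struct γ).verts \ {γ}).toFinset) ⊆ M.verts.toFinset := by
    intro x hx
    rw [Finset.mem_biUnion] at hx
    obtain ⟨γ, -, hx⟩ := hx
    rw [Set.mem_toFinset] at hx ⊢
    by_contra hxM
    refine hx.2 (h.own.free_eq hx.1 fun y hy => hxM (M.edge_vert hy))
  have h1 := Finset.card_le_card hsub
  rw [Finset.card_biUnion hdis, ← Set.ncard_eq_toFinset_card'] at h1
  have h2 : ∀ γ ∈ T, L - 1 ≤ ((((s.struct γ).verts \ {γ}).toFinset.card : ℕ) : ℝ) := by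
    intro γ hγ
    rw [hT, Set.mem_toFinset] at hγ
    have : (s.struct γ).verts.ncard ≤ ((s.struct γ).verts \ {γ}).ncard + 1 := by
      have := Set.ncard_le_ncard_sdiff_add_ncard (s.struct γ).verts {γ}
      rwa [Set.ncard_singleton] at this
    rw [← Set.ncard_eq_toFinset_card']
    have h' : ((s.struct γ).verts.ncard : ℝ) ≤ ((s.struct γ).verts \ {γ}).ncard + 1 := by
      exact_mod_cast this
    have := hγ.trans h'
    linarith
  have h3 := Finset.card_nsmul_le_sum T _ _ h2
  rw [nsmul_eq_mul, ← Nat.cast_sum] at h3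
  rw [hcard]
  exact h3.trans (by exact_mod_cast h1)

end Counting

end MatchingPhase

namespace MatchingPhase

variable {V : Type*} {G : SimpleGraph V} {M : G.Subgraph}
variable {x z : V}

/-! ### Augmenting along disjoint paths -/

/-- The edges of an alternating path at one of its vertices. -/
theorem alternating_walk (hM : M.IsMatching) : ∀ (n : ℕ) {x z : V} (w : G.Walk x z),
    w.length = n → w.IsPath → w.edges.IsChain (fun e f => e ∈ M.edgeSet ↔ f ∉ M.edgeSet) →
    (∀ e ∈ w.edges.head?, e ∉ M.edgeSet) → Free M z → x ≠ z →
    ∀ v ∈ w.support, (∃ a, s(v, a) ∈ w.edges ∧ ¬ M.Adj v a ∧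
      ∀ c, s(v, c) ∈ w.edges → ¬ M.Adj v c → c = a) ∧
      (v ≠ x → ∀ t, M.Adj v t → s(v, t) ∈ w.edges) ∧ (v = x ∨ v = z ∨ ∃ t, M.Adj v t) := by
  intro n
  induction n using Nat.strong_induction_on with
  | _ n ih =>
  intro x z w hlen hp hch hhead hz hxz
  cases w with
  | nil => exact absurd rfl hxz
  | @cons _ v _ hxv w =>
  have hxvM : ¬ M.Adj x v := fun hm => hhead s(x, v) (by simp) hm
  have hx := hp.support_nodup
  rw [SimpleGraph.Walk.support_cons, List.nodup_cons] at hx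
  cases w with
  | nil =>
    intro y hy
    simp only [SimpleGraph.Walk.support_cons, SimpleGraph.Walk.support_nil, List.mem_cons,
      List.not_mem_nil, or_false] at hy
    rcases hy with rfl | rfl
    · refine ⟨⟨z, by simp, hxvM, fun c hc _ => ?_⟩, fun h => absurd rfl h, .inl rfl⟩
      simpa [hxz] using hc
    · refine ⟨⟨x, by simp [Sym2.eq_swap], fun h => hxvM h.symm, fun c hc _ => ?_⟩,
        fun _ t hm => absurd hm (hz t), .inr (.inl rfl)⟩
      simpa [hxz.symm] using hc
  | @cons _ t _ hvt w =>
    rw [SimpleGraph.Walk.edges_cons, SimpleGraph.Walk.edges_cons, List.isChain_cons_cons] at hch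
    have hm : M.Adj v t := by
      by_contra hm
      exact hxvM (hch.1.2 hm)
    have htz : t ≠ z := by
      rintro rfl
      exact hz v hm.symm
    have hhead' : ∀ e ∈ w.edges.head?, e ∉ M.edgeSet := by
      intro e he
      have := hch.2
      rw [List.isChain_cons] at this
      exact (this.1 e he).1 hm
    have hl : w.length < n := by
      simp only [SimpleGraph.Walk.length_cons] at hlen
      omega
    have key := ih _ hl w rfl hp.of_cons.of_cons hch.2.tail hhead' hz htz
    have hvw := hx.2
    rw [SimpleGraph.Walk.support_cons, List.nodup_cons] at hvw
    have hxw : x ≠ v ∧ x ∉ w.support := by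
      have := hx.1
      rw [SimpleGraph.Walk.support_cons, List.mem_cons, not_or] at this
      exact this
    have nx : ∀ c, s(x, c) ∉ w.edges := fun c hc => hxw.2 (w.fst_mem_support_of_mem_edges hc)
    have nv : ∀ c, s(v, c) ∉ w.edges := fun c hc => hvw.1 (w.fst_mem_support_of_mem_edges hc)
    have ht : t ∈ w.support := w.start_mem_support
    have hxt : x ≠ t := fun e => hxw.2 (e ▸ ht)
    intro y hy
    simp only [SimpleGraph.Walk.support_cons, List.mem_cons] at hy
    simp only [SimpleGraph.Walk.edges_cons, List.mem_cons]
    rcases hy with rfl | rfl | hy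
    · refine ⟨⟨v, .inl rfl, hxvM, ?_⟩, fun h => absurd rfl h, .inl rfl⟩
      rintro c (hc | hc | hc) -
      · simpa [hxw.1] using hc
      · rcases Sym2.eq_iff.1 hc with ⟨h1, -⟩ | ⟨h1, -⟩
        · exact absurd h1 hxw.1
        · exact absurd h1 hxt
      · exact absurd hc (nx c)
    · refine ⟨⟨x, .inl Sym2.eq_swap, fun h => hxvM h.symm, ?_⟩, fun _ c hc => ?_,
        .inr (.inr ⟨t, hm⟩)⟩
      · rintro c (hc | hc | hc) hcM
        · rcases Sym2.eq_iff.1 hc with ⟨h1, -⟩ | ⟨-, h1⟩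
          · exact absurd h1.symm hxw.1
          · exact h1
        · rcases Sym2.eq_iff.1 hc with ⟨-, rfl⟩ | ⟨h1, -⟩
          · exact absurd hm hcM
          · exact absurd (h1 ▸ ht) hvw.1
        · exact absurd hc (nv c)
      · rw [hM.eq_of_adj_left hc hm]
        exact .inr (.inl rfl)
    · have hyx : y ≠ x := fun e => hxw.2 (e ▸ hy)
      have hyv : y ≠ v := fun e => hvw.1 (e ▸ hy)
      obtain ⟨⟨a, ha, haM, hau⟩, h2, h3⟩ := key y hy
      refine ⟨⟨a, .inr (.inr ha), haM, ?_⟩, fun _ c hc => ?_, ?_⟩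
      · rintro c (hc | hc | hc) hcM
        · rcases Sym2.eq_iff.1 hc with ⟨h1, -⟩ | ⟨h1, -⟩
          · exact absurd h1 hyx
          · exact absurd h1 hyv
        · rcases Sym2.eq_iff.1 hc with ⟨h1, -⟩ | ⟨rfl, rfl⟩
          · exact absurd h1 hyv
          · exact absurd hm.symm hcM
        · exact hau c hc hcM
      · by_cases e : y = t
        · subst e
          rw [hM.eq_of_adj_left hc hm.symm]
          exact .inr (.inl Sym2.eq_swap)
        · exact .inr (.inr (h2 e c hc))
      · right
        rcases h3 with rfl | h3
        · exact .inr ⟨v, hm.symm⟩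
        · exact h3

theorem AugPath.edges_at (hM : M.IsMatching) (q : AugPath M) {v : V} (hv : v ∈ q.walk.support) :
    (∃ a, s(v, a) ∈ q.walk.edges ∧ ¬ M.Adj v a ∧
      ∀ c, s(v, c) ∈ q.walk.edges → ¬ M.Adj v c → c = a) ∧
      (∀ t, M.Adj v t → s(v, t) ∈ q.walk.edges) ∧
      (v = q.src ∨ v = q.tgt ∨ ∃ t, M.Adj v t) := by
  obtain ⟨h1, h2, h3⟩ := alternating_walk hM _ q.walk rfl q.isPath q.alternating
    (head_edge_not_matched _ q.src_free) q.tgt_free q.src_ne_tgt v hv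
  refine ⟨h1, fun t ht => h2 ?_ t ht, h3⟩
  rintro rfl
  exact q.src_free t ht

/-- On a path of `P` the new edges are the unmatched edges of that path, one at each vertex; off the
paths nothing changes. The new vertices are the ends of the paths. -/
theorem augment_spec (hM : M.IsMatching) {P : Set (AugPath M)}
    (hP : ∀ q ∈ P, ∀ q' ∈ P, q ≠ q' → q.walk.support.Disjoint q'.walk.support) :
    (augment M P).IsMatching ∧
      (augment M P).verts = M.verts ∪ (AugPath.src '' P ∪ AugPath.tgt '' P) := by
  have on_path : ∀ {q v c}, q ∈ P → v ∈ q.walk.support → (∃ q' ∈ P, s(v, c) ∈ q'.walk.edges) →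
      s(v, c) ∈ q.walk.edges := by
    rintro q v c hq hv ⟨q', hq', hc⟩
    by_cases e : q = q'
    · rwa [e]
    · exact absurd (q'.walk.fst_mem_support_of_mem_edges hc) (hP q hq q' hq' e hv)
  have adj_on : ∀ {q v c}, q ∈ P → v ∈ q.walk.support →
      ((augment M P).Adj v c ↔ s(v, c) ∈ q.walk.edges ∧ ¬ M.Adj v c) := by
    intro q v c hq hv
    obtain ⟨-, h2, -⟩ := q.edges_at hM hv
    constructor
    · rintro ⟨-, ⟨h3, h4⟩ | ⟨h3, h4⟩⟩
      · exact absurd ⟨q, hq, h2 c h3⟩ h4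
      · exact ⟨on_path hq hv h3, h4⟩
    · rintro ⟨h3, h4⟩
      exact ⟨q.walk.adj_of_mem_edges h3, .inr ⟨⟨q, hq, h3⟩, h4⟩⟩
  have adj_off : ∀ {v c}, (∀ q ∈ P, v ∉ q.walk.support) →
      ((augment M P).Adj v c ↔ M.Adj v c) := by
    intro v c hv
    have hno : ¬ ∃ q ∈ P, s(v, c) ∈ q.walk.edges := fun ⟨q, hq, hc⟩ =>
      hv q hq (q.walk.fst_mem_support_of_mem_edges hc)
    constructor
    · rintro ⟨-, ⟨h3, -⟩ | ⟨h3, -⟩⟩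
      · exact h3
      · exact absurd h3 hno
    · exact fun h3 => ⟨h3.adj_sub, .inl ⟨h3, hno⟩⟩
  constructor
  · rintro v ⟨y, hy⟩
    replace hy : (augment M P).Adj v y := hy
    by_cases hv : ∃ q ∈ P, v ∈ q.walk.support
    · obtain ⟨q, hq, hv⟩ := hv
      obtain ⟨⟨a, h1, h2, h3⟩, -⟩ := q.edges_at hM hv
      refine ⟨a, (adj_on hq hv).2 ⟨h1, h2⟩, fun c hc => ?_⟩
      obtain ⟨h4, h5⟩ := (adj_on hq hv).1 hc
      exact h3 c h4 h5
    · push Not at hv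
      refine ⟨y, hy, fun c hc => ?_⟩
      exact hM.eq_of_adj_left ((adj_off hv).1 hc) ((adj_off hv).1 hy)
  · ext v
    by_cases hv : ∃ q ∈ P, v ∈ q.walk.support
    · obtain ⟨q, hq, hv⟩ := hv
      obtain ⟨⟨a, h1, h2, -⟩, -, h3⟩ := q.edges_at hM hv
      refine iff_of_true ?_ ?_
      · exact (augment M P).edge_vert ((adj_on hq hv).2 ⟨h1, h2⟩)
      · rcases h3 with rfl | rfl | ⟨t, ht⟩
        · exact .inr (.inl ⟨q, hq, rfl⟩)
        · exact .inr (.inr ⟨q, hq, rfl⟩)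
        · exact .inl (M.edge_vert ht)
    · push Not at hv
      constructor
      · rintro ⟨y, hy⟩
        replace hy : (augment M P).Adj v y := hy
        exact .inl (M.edge_vert ((adj_off hv).1 hy))
      · rintro (hvM | ⟨q, hq, rfl⟩ | ⟨q, hq, rfl⟩)
        · obtain ⟨t, ht, -⟩ := hM hvM
          exact (augment M P).edge_vert ((adj_off hv).2 ht)
        · exact absurd q.walk.start_mem_support (hv q hq)
        · exact absurd q.walk.end_mem_support (hv q hq)

theorem ncard_verts_of_isMatching [Finite V] (hM : M.IsMatching) :
    M.verts.ncard = 2 * M.edgeSet.ncard := by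
  classical
  have := Fintype.ofFinite V
  have h := M.spanningCoe.sum_degrees_eq_twice_card_edges
  have he : M.spanningCoe.edgeFinset.card = M.edgeSet.ncard := by
    rw [← Set.ncard_coe_finset, SimpleGraph.coe_edgeFinset]
    congr 1
  have hd : ∀ v, M.spanningCoe.degree v = if v ∈ M.verts then 1 else 0 := by
    intro v
    rw [SimpleGraph.Subgraph.degree_spanningCoe]
    split_ifs with hv
    · exact SimpleGraph.Subgraph.isMatching_iff_forall_degree.1 hM v hv
    · exact SimpleGraph.Subgraph.degree_of_notMem_verts hv
  rw [Finset.sum_congr rfl fun v _ => hd v, Finset.sum_boole, he, Nat.cast_id] at h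
  rw [← h, ← Set.ncard_coe_finset]
  congr 1
  ext v
  simp

/-- Covered vertices are counted instead of edges: every path adds its two free ends, and a matching
covers twice as many vertices as it has edges. -/
theorem ncard_augment [Finite V] (hM : M.IsMatching) {P : Set (AugPath M)}
    (hP : ∀ q ∈ P, ∀ q' ∈ P, q ≠ q' → q.walk.support.Disjoint q'.walk.support) :
    (augment M P).edgeSet.ncard = M.edgeSet.ncard + P.ncard := by
  obtain ⟨h1, h2⟩ := augment_spec hM hP
  have e1 := ncard_verts_of_isMatching h1
  have e2 := ncard_verts_of_isMatching hM
  have d1 : Disjoint (AugPath.src '' P) (AugPath.tgt '' P) := by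
    rw [Set.disjoint_left]
    rintro _ ⟨q, hq, rfl⟩ ⟨q', hq', e⟩
    by_cases eq : q = q'
    · subst eq
      exact q.src_ne_tgt e.symm
    · exact hP q hq q' hq' eq q.walk.start_mem_support (e ▸ q'.walk.end_mem_support)
  have d2 : Disjoint M.verts (AugPath.src '' P ∪ AugPath.tgt '' P) := by
    rw [Set.disjoint_left]
    rintro v hv (⟨q, -, rfl⟩ | ⟨q, -, rfl⟩)
    · obtain ⟨t, ht, -⟩ := hM hv
      exact q.src_free t ht
    · obtain ⟨t, ht, -⟩ := hM hv
      exact q.tgt_free t ht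
  have c1 : (AugPath.src '' P).ncard = P.ncard := by
    refine Set.InjOn.ncard_image fun q hq q' hq' e => ?_
    by_contra hne
    exact hP q hq q' hq' hne q.walk.start_mem_support
      (by rw [e]; exact q'.walk.start_mem_support)
  have c2 : (AugPath.tgt '' P).ncard = P.ncard := by
    refine Set.InjOn.ncard_image fun q hq q' hq' e => ?_
    by_contra hne
    exact hP q hq q' hq' hne q.walk.end_mem_support
      (by rw [e]; exact q'.walk.end_mem_support)
  rw [h2, Set.ncard_union_eq d2 (Set.toFinite _) (Set.toFinite _),
    Set.ncard_union_eq d1 (Set.toFinite _) (Set.toFinite _), c1, c2] at e1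
  omega

end MatchingPhase

namespace MatchingPhase

variable {V : Type*} {G : SimpleGraph V} {M : G.Subgraph}
variable {ε h : ℝ}

/-! ### The phase -/

theorem initState_verts {γ x : V} :
    x ∈ ((initState M ε).struct γ).verts ↔ x = γ ∧ Free M γ := by
  by_cases hf : Free M γ
  · simp [initState, hf, Struct.single]
  · simp [initState, hf, Struct.empty]

theorem initState_arcs {γ : V} {e : V × V} : e ∉ ((initState M ε).struct γ).arcs := by
  by_cases hf : Free M γ
  · simp [initState, hf, Struct.single]
  · simp [initState, hf, Struct.empty]

theorem initState_blossoms {γ : V} {B : Set V} :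
    B ∈ ((initState M ε).struct γ).blossoms ↔ B = {γ} ∧ Free M γ := by
  by_cases hf : Free M γ
  · simp [initState, hf, Struct.single]
  · simp [initState, hf, Struct.empty]

theorem initState_working {γ : V} {W : Set V} :
    ((initState M ε).struct γ).working = some W ↔ W = {γ} ∧ Free M γ := by
  by_cases hf : Free M γ
  · simp [initState, hf, Struct.single, eq_comm]
  · simp [initState, hf, Struct.empty]

theorem initState_Om (x : V) : (initState M ε).Om x = {x} := by
  ext y
  constructor
  · rintro (rfl | ⟨B, ⟨hx, γ, hB⟩, hy⟩)
    · rfl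
    · obtain ⟨rfl, -⟩ := initState_blossoms.1 hB
      obtain rfl : x = γ := hx
      exact hy
  · rintro rfl
    exact State.mem_Om _ y

theorem initState_inv (hM : M.IsMatching) :
    Inv (ellMax ε) (initState M ε) ∅ := by
  have vis : ∀ {x}, x ∈ ((initState M ε).forest ∅).vis ↔ Free M x := by
    intro x
    constructor
    · rintro ⟨γ, hγ⟩
      obtain ⟨rfl, hf⟩ := initState_verts.1 hγ
      exact hf
    · exact fun hf => ⟨x, initState_verts.2 ⟨rfl, hf⟩⟩
  have noarc : ∀ {x y}, ¬ ((initState M ε).forest ∅).arc x y := fun ⟨_, hγ⟩ => initState_arcs hγ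
  have om : ∀ x, ((initState M ε).forest ∅).om x = {x} := initState_Om
  have om_eq : ∀ {x y}, ((initState M ε).forest ∅).om y = ((initState M ε).forest ∅).om x →
      y = x := by
    intro x y e
    rw [om, om] at e
    exact Set.singleton_injective e
  constructor
  · exact
    { matching := hM
      mem_om := State.mem_Om _
      om_eq := by
        intro x y hy
        rw [om] at hy
        rw [show y = x from hy]
      om_vis := by
        intro x y hx hy
        rw [om] at hy
        rwa [show y = x from hy]
      arc_vis := fun ha => absurd ha noarc
      arc_adj := fun ha => absurd ha noarc
      inner_vis := Set.empty_subset _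
      inner_om := fun hv => absurd hv (Set.notMem_empty _)
      inner_parent := fun hv => absurd hv (Set.notMem_empty _)
      inner_child := fun hv => absurd hv (Set.notMem_empty _)
      arc_unique := fun hv => absurd hv (Set.notMem_empty _)
      label_lt := fun hv => absurd hv (Set.notMem_empty _)
      crossing := fun ha => absurd ha noarc
      mate := fun hx hm => absurd hm (vis.1 hx.1 _)
      blossom := by
        intro x hx
        refine ⟨x, State.mem_Om _ x, fun m hm => absurd hm (vis.1 hx.1 m), fun y hy => ?_⟩
        rw [om] at hy ⊢
        rw [show y = x from hy]
        exact ⟨{x}, subset_rfl, .nil x⟩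
      work_outer := by
        rintro x ⟨γ, hγ⟩
        obtain ⟨e, hf⟩ := initState_working.1 hγ
        rw [initState_Om, Set.singleton_eq_singleton_iff] at e
        subst e
        exact ⟨vis.2 hf, Set.notMem_empty _⟩
      work_om := fun hx e => om_eq e ▸ hx }
  · exact
    { disj := by
        intro x α β h1 h2
        exact (initState_verts.1 h1).1.symm.trans (initState_verts.1 h2).1
      arcs := fun ha => absurd ha initState_arcs
      blossom_subset := by
        intro B α hB x hx
        obtain ⟨rfl, hf⟩ := initState_blossoms.1 hB
        exact initState_verts.2 ⟨hx, hf⟩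
      blossom_nonempty := by
        intro B α hB
        obtain ⟨rfl, -⟩ := initState_blossoms.1 hB
        exact Set.singleton_nonempty α
      root_free := fun hx => (initState_verts.1 hx).2
      root_mem := fun hx => initState_verts.2 ⟨rfl, (initState_verts.1 hx).2⟩
      free_eq := fun hx _ => (initState_verts.1 hx).1
      cover := fun hf _ => initState_verts.2 ⟨rfl, hf⟩
      not_removed := fun _ h => h
      removed_mate := fun hx => absurd hx (Set.notMem_empty _)
      working := by
        intro α W hW
        obtain ⟨rfl, hf⟩ := initState_working.1 hW
        exact ⟨α, initState_verts.2 ⟨rfl, hf⟩, Set.notMem_empty _, (initState_Om α).symm⟩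
      label_le := fun _ => le_rfl
      label_vis := fun _ hle => absurd hle (Nat.not_succ_le_self _) }

section Finite

variable [Fintype V]

theorem initState_boundary {L : ℝ} (hM : M.IsMatching) (hL : 2 ≤ L) (hℓ : 1 ≤ ellMax ε) :
    Boundary (ellMax ε) L (initState M ε) ∅ where
  inv := initState_inv hM
  size := by
    refine ⟨fun γ => ?_, fun hv => absurd hv (Set.notMem_empty _)⟩
    have h1 : ((initState M ε).struct γ).verts ⊆ {γ} := fun x hx => (initState_verts.1 hx).1
    have h2 := Set.ncard_le_ncard h1
    rw [Set.ncard_singleton] at h2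
    have h3 : (((initState M ε).struct γ).verts.ncard : ℝ) ≤ 1 := by exact_mod_cast h2
    have h4 : (0 : ℝ) ≤ ellMax ε := Nat.cast_nonneg _
    nlinarith
  recorded := by
    refine ⟨Set.finite_empty, fun h => absurd h (Set.notMem_empty _),
      fun h => absurd h (Set.notMem_empty _), ?_⟩
    simp [initState]
  settled := by
    intro u v t hu _ _ _ _ _
    -- At the start every outer vertex is a root and a working vertex, hence active.
    obtain ⟨γ, hγ⟩ := hu.1
    obtain ⟨rfl, hf⟩ := initState_verts.1 hγ
    exact .inl ⟨u, ⟨u, initState_working.2 ⟨initState_Om u, hf⟩⟩, .refl⟩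
  separated := by
    rintro x y ⟨⟨γ, hγ⟩, -⟩ ⟨⟨δ, hδ⟩, -⟩ - -
    obtain ⟨rfl, hf⟩ := initState_verts.1 hγ
    obtain ⟨rfl, hf'⟩ := initState_verts.1 hδ
    exact .inr ⟨hf, hf'⟩
  two_le := hL
  pos := hℓ

/-- There are no inner vertices and so no critical arcs; each of the `2 * |M|` matched arcs has
label `ℓ + 1`, counted with weight `3`. -/
theorem initState_potential (hM : M.IsMatching) :
    (initState M ε).potential ∅ ≤ 6 * M.edgeSet.ncard * (ellMax ε + 1) := by
  classical
  have h1 : ((initState M ε).forest ∅).crit M = ∅ :=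
    Set.eq_empty_of_forall_notMem fun e he => he.2.1
  have h2 : (Finset.univ.filter fun e : V × V => M.Adj e.1 e.2).card ≤ M.verts.ncard := by
    rw [← Set.ncard_coe_finset]
    refine Set.ncard_le_ncard_of_injOn Prod.fst ?_ ?_ (Set.toFinite _)
    · intro e he
      simp only [Finset.coe_filter, Finset.mem_univ, true_and, Set.mem_ofPred_eq] at he
      exact M.edge_vert he
    · intro e he e' he' eq
      simp only [Finset.coe_filter, Finset.mem_univ, true_and, Set.mem_ofPred_eq] at he he'
      exact Prod.ext eq (hM.eq_of_adj_left he (eq ▸ he'))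
  have h3 : (initState M ε).labelSum ≤ M.verts.ncard * (ellMax ε + 1) := by
    have : (initState M ε).labelSum =
        (Finset.univ.filter fun e : V × V => M.Adj e.1 e.2).card * (ellMax ε + 1) :=
      Finset.sum_const_nat fun _ _ => rfl
    rw [this]
    exact Nat.mul_le_mul_right _ h2
  rw [ncard_verts_of_isMatching hM] at h3
  rw [State.potential, h1, Set.ncard_empty]
  nlinarith

variable {L₁ L₂ : ℕ → List (V × V)}

/-- The invariants after `n` pass-bundles. -/
theorem phase_boundary (hM : M.IsMatching) (hh : 0 < h) (hh' : h ≤ 6) (hℓ : 1 ≤ ellMax ε)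
    (hL₁ : ∀ τ, IsStream G (L₁ τ)) (hL₂ : ∀ τ, IsStream G (L₂ τ)) {st : ℕ → State M}
    (h0 : st 0 = initState M ε) (n : ℕ)
    (hst : ∀ τ < n, PassBundle h (L₁ τ) (L₂ τ) (st τ) (st (τ + 1))) :
    ∃ I, Boundary (ellMax ε) (limitH h) (st n) I ∧ (n ≠ 0 → (st n).Closed I) ∧
      (n : ℝ) * (st n).active.ncard + (st n).potential I ≤
        n * (h * M.edgeSet.ncard / 3) + 6 * M.edgeSet.ncard * (ellMax ε + 1) := by
  induction n with
  | zero =>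
    have hL : 2 ≤ limitH h := by
      have : 1 ≤ 6 / h := (one_le_div hh).2 hh'
      unfold limitH
      linarith
    refine ⟨∅, h0 ▸ initState_boundary hM hL hℓ, fun h => absurd rfl h, ?_⟩
    have : ((st 0).potential ∅ : ℝ) ≤ 6 * M.edgeSet.ncard * (ellMax ε + 1) := by
      rw [h0]
      exact_mod_cast initState_potential hM
    simpa using this
  | succ n ih =>
    obtain ⟨I, hb, -, hle⟩ := ih fun τ hτ => hst τ (by omega)
    obtain ⟨I', hb', hcl, hact, hpot⟩ := hb.passBundle (hL₁ n) (hL₂ n) (hst n (by omega))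
    refine ⟨I', hb', fun _ => hcl, ?_⟩
    have h1 : ((st (n + 1)).active.ncard : ℝ) ≤ (st n).active.ncard := ncard_le_real hact
    have h2 : ((st (n + 1)).active.ncard : ℝ) ≤
        ((st (n + 1)).active \ ((st n).mark h).onHold).ncard + ((st n).mark h).onHold.ncard := by
      exact_mod_cast Set.ncard_le_ncard_sdiff_add_ncard _ _
    -- A structure on hold has at least `limitH h - 1 = 6 / h` matched vertices, and `M` covers `2 *
    -- |M|` vertices.
    have h3 : (((st n).mark h).onHold.ncard : ℝ) ≤ h * M.edgeSet.ncard / 3 := by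
      have := hb.inv.onHold_le (L := limitH h)
      have e : limitH h - 1 = 6 / h := by simp [limitH]
      rw [ncard_verts_of_isMatching hM, e, mul_div_assoc', div_le_iff₀ hh] at this
      push_cast at this
      change (Set.ncard {γ | limitH h ≤ (((st n).struct γ).verts.ncard : ℝ)} : ℝ) ≤ _
      linarith
    have h4 : ((st (n + 1)).potential I' : ℝ) +
        ((st (n + 1)).active \ ((st n).mark h).onHold).ncard ≤ (st n).potential I := by
      exact_mod_cast hpot
    -- The number of active structures never grows, so the current one also bounds the cost of all
    -- earlier pass-bundles from below.
    have h5 : (n : ℝ) * (st (n + 1)).active.ncard ≤ n * (st n).active.ncard :=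
      mul_le_mul_of_nonneg_left h1 (Nat.cast_nonneg n)
    push_cast
    linarith

theorem exists_phase (hM : M.IsMatching) (hh : 0 < h) (hh' : h ≤ 6) (hℓ : 1 ≤ ellMax ε)
    (hL₁ : ∀ τ, IsStream G (L₁ τ)) (hL₂ : ∀ τ, IsStream G (L₂ τ)) (n : ℕ) :
    ∃ st : ℕ → State M, st 0 = initState M ε ∧
      ∀ τ < n, PassBundle h (L₁ τ) (L₂ τ) (st τ) (st (τ + 1)) := by
  induction n with
  | zero => exact ⟨fun _ => initState M ε, rfl, fun τ hτ => absurd hτ (Nat.not_lt_zero τ)⟩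
  | succ n ih =>
    obtain ⟨st, h0, hst⟩ := ih
    obtain ⟨I, hb, -⟩ := phase_boundary hM hh hh' hℓ hL₁ hL₂ h0 n hst
    obtain ⟨s', hs'⟩ := hb.exists_passBundle (hL₁ n) (hL₂ n)
    refine ⟨Function.update st (n + 1) s', ?_, fun τ hτ => ?_⟩
    · rw [Function.update_of_ne (Nat.succ_ne_zero n).symm, h0]
    · rw [Function.update_of_ne (show τ ≠ n + 1 by omega)]
      by_cases e : τ = n
      · subst e
        rwa [Function.update_self]
      · rw [Function.update_of_ne (show τ + 1 ≠ n + 1 by omega)]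
        exact hst τ (by omega)

end Finite

/-! ### The parameters -/

/-- With `ε⁻¹ = 2 ^ k` the quotient is the integer `3 * 2 ^ k`, so the floor loses nothing. -/
theorem IsAccuracy.ellMax_eq (hε : IsAccuracy ε) : (ellMax ε : ℝ) = 3 / ε := by
  obtain ⟨-, -, k, hk⟩ := hε
  have : 3 / ε = ((3 * 2 ^ k : ℕ) : ℝ) := by
    rw [div_eq_mul_inv, hk]
    push_cast
    ring
  rw [ellMax, this, Nat.floor_natCast]

theorem IsScale.tauMax_eq (hε : IsAccuracy ε) (hh : IsScale ε h) :
    (tauMax ε h : ℝ) = 72 / (h * ε) := by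
  obtain ⟨-, -, k, hk⟩ := hε
  obtain ⟨⟨j, -, rfl⟩, -⟩ := hh
  have : 72 / ((1 / 2 : ℝ) ^ j * ε) = ((72 * 2 ^ j * 2 ^ k : ℕ) : ℝ) := by
    rw [div_eq_mul_inv, mul_inv, hk, one_div, inv_pow, inv_inv]
    push_cast
    ring
  rw [tauMax, this, Nat.floor_natCast]

theorem IsScale.pos (hh : IsScale ε h) : 0 < h ∧ h ≤ 1 / 2 := by
  obtain ⟨⟨j, hj, rfl⟩, -⟩ := hh
  refine ⟨by positivity, ?_⟩
  calc (1 / 2 : ℝ) ^ j ≤ (1 / 2) ^ 1 := pow_le_pow_of_le_one (by norm_num) (by norm_num) hj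
    _ = 1 / 2 := pow_one _

/-- The computation that bounds the number of recorded paths. -/
theorem paths_bound {h ε l m n a c r k : ℝ} (hh : 0 < h) (hh' : h ≤ 1 / 2) (hε : 0 < ε)
    (hε' : ε ≤ 1) (hl : l = 3 / ε) (hn : n = 72 / (h * ε)) (hm : 0 ≤ m) (hk : 0 ≤ k)
    (ha : n * a ≤ n * (h * m / 3) + 6 * m * (l + 1)) (hc : c ≤ a * l)
    (hr : r ≤ 2 * (l + 1) * (6 / h + 1) * k) (hP : 4 * h * l * m ≤ r + c + a) :
    (1 + h * l / (36 / (h * ε))) * m ≤ m + k := by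
  have hl3 : 3 ≤ l := by
    rw [hl, le_div_iff₀ hε]
    linarith
  have hlε : l * ε = 3 := by
    rw [hl]
    field_simp
  -- Divide by `n`: one third of `h * m` comes from the structures on hold, and at most another
  -- third from the initial potential, since `(l + 1) * ε = 3 + ε ≤ 4`.
  have ha' : a ≤ 2 / 3 * (h * m) := by
    have h1 : n * (h * ε) = 72 := by
      rw [hn]
      field_simp
    have hhε : 0 < h * ε := mul_pos hh hε
    have h2 : 72 * a ≤ 72 * (h * m / 3) + 6 * m * (l + 1) * (h * ε) := by
      have := mul_le_mul_of_nonneg_right ha hhε.le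
      calc 72 * a = n * a * (h * ε) := by rw [← h1]; ring
        _ ≤ _ := this
        _ = n * (h * ε) * (h * m / 3) + 6 * m * (l + 1) * (h * ε) := by ring
        _ = _ := by rw [h1]
    have h3 : 6 * m * (l + 1) * (h * ε) = 6 * (h * m) * (3 + ε) := by
      rw [← hlε]
      ring
    have h4 : h * m * ε ≤ h * m * 1 := mul_le_mul_of_nonneg_left hε' (mul_nonneg hh.le hm)
    linarith
  have hhm : 0 ≤ h * m := mul_nonneg hh.le hm
  -- Active structures and critical arcs together take at most `(2/3) * h * m * (l + 1) ≤ h * m * l`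
  -- of the `4 * h * l * m` paths.
  have h5 : 3 * (h * m) * l ≤ r := by
    have h6 : a * (l + 1) ≤ 2 / 3 * (h * m) * (l + 1) :=
      mul_le_mul_of_nonneg_right ha' (by linarith)
    nlinarith
  have h6 : r * h ≤ 18 * l * k := by
    have e : 2 * (l + 1) * (6 / h + 1) * k * h = 2 * (l + 1) * (6 + h) * k := by
      field_simp
    have h7 : r * h ≤ 2 * (l + 1) * (6 + h) * k := by
      rw [← e]
      exact mul_le_mul_of_nonneg_right hr hh.le
    -- Here `h ≤ 1 / 2` and `l ≥ 3` give `13 * (l + 1) ≤ 18 * l`.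
    have h8 : 2 * (l + 1) * (6 + h) ≤ 18 * l := by nlinarith
    exact h7.trans (mul_le_mul_of_nonneg_right h8 hk)
  have h7 : h * (h * m) ≤ 6 * k := by
    have h8 : 3 * (h * m) * l * h ≤ 18 * l * k :=
      (mul_le_mul_of_nonneg_right h5 hh.le).trans h6
    have h9 : l * (h * (h * m)) ≤ l * (6 * k) := by linarith
    exact le_of_mul_le_mul_left h9 (by linarith)
  -- The required gain `h² m / 12` is half of the bound `h² m / 6 ≤ k` obtained above.
  have h8 : h * l / (36 / (h * ε)) = h * h / 12 := by
    rw [hl]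
    field_simp
    norm_num
  rw [h8]
  linarith

end MatchingPhase

theorem mainTheorem6 {V : Type*} [Finite V] (G : SimpleGraph V) (ε h : ℝ)
    (hε : MatchingPhase.IsAccuracy ε) (hh : MatchingPhase.IsScale ε h)
    (M : G.Subgraph) (hM : M.IsMatching)
    (L₁ L₂ : ℕ → List (V × V))
    (hL₁ : ∀ τ, MatchingPhase.IsStream G (L₁ τ)) (hL₂ : ∀ τ, MatchingPhase.IsStream G (L₂ τ))
    (Pstar : Finset (MatchingPhase.AugPath M))
    (hPstar : MatchingPhase.IsMaximumDisjointShort (MatchingPhase.ellMax ε) Pstar)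
    (hlarge : 4 * h * (MatchingPhase.ellMax ε : ℝ) * (M.edgeSet.ncard : ℝ) ≤ (Pstar.card : ℝ)) :
    (∃ M' : G.Subgraph, MatchingPhase.PhaseResult M ε h L₁ L₂ M') ∧
    ∀ M' : G.Subgraph, MatchingPhase.PhaseResult M ε h L₁ L₂ M' →
      M'.IsMatching ∧
      (1 + h * (MatchingPhase.ellMax ε : ℝ) / MatchingPhase.Delta ε h) * (M.edgeSet.ncard : ℝ)
        ≤ (M'.edgeSet.ncard : ℝ) := by
  have := Fintype.ofFinite V
  have hpos := hh.pos
  have hl := hε.ellMax_eq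
  have hℓ : 1 ≤ MatchingPhase.ellMax ε := by
    have : (1 : ℝ) ≤ MatchingPhase.ellMax ε := by
      rw [hl, le_div_iff₀ hε.1]
      linarith [hε.2.1]
    exact_mod_cast this
  have hh6 : h ≤ 6 := by linarith [hpos.2]
  constructor
  · obtain ⟨st, h0, hst⟩ := MatchingPhase.exists_phase hM hpos.1 hh6 hℓ hL₁ hL₂
      (MatchingPhase.tauMax ε h)
    exact ⟨_, st, h0, hst, rfl⟩
  · rintro M' ⟨st, h0, hst, rfl⟩
    obtain ⟨I, hb, hcl, hle⟩ := MatchingPhase.phase_boundary hM hpos.1 hh6 hℓ hL₁ hL₂ h0 _ hst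
    have hτ := hh.tauMax_eq hε
    -- `Closed` can fail in the initial state, where adjacent free vertices are allowed; it is
    -- available only after at least one pass-bundle.
    have hτ0 : MatchingPhase.tauMax ε h ≠ 0 := by
      have : (0 : ℝ) < MatchingPhase.tauMax ε h := by
        rw [hτ]
        have := hpos.1
        have := hε.1
        positivity
      exact_mod_cast this.ne'
    have hdis : ∀ q ∈ (st (MatchingPhase.tauMax ε h)).paths,
        ∀ q' ∈ (st (MatchingPhase.tauMax ε h)).paths, q ≠ q' →
        q.walk.support.Disjoint q'.walk.support :=
      fun q hq q' hq' hne => hb.recorded.disjoint hq hq' hne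
    refine ⟨(MatchingPhase.augment_spec hM hdis).1, ?_⟩
    rw [MatchingPhase.ncard_augment hM hdis]
    push_cast
    have hc := hb.inv.crit_le
    have hcard := hb.card_le (hcl hτ0) hPstar.1
    refine MatchingPhase.paths_bound (c := (((st (MatchingPhase.tauMax ε h)).forest I).crit M).ncard)
      (a := (st (MatchingPhase.tauMax ε h)).active.ncard)
      (r := (st (MatchingPhase.tauMax ε h)).removed.ncard) hpos.1 hpos.2 hε.1 hε.2.1 hl hτ
      (Nat.cast_nonneg _) (Nat.cast_nonneg _) ?_ ?_ hb.recorded.removed ?_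
    · exact (le_add_of_nonneg_right (Nat.cast_nonneg _)).trans hle
    · exact_mod_cast hc
    · exact hlarge.trans (by exact_mod_cast hcard)
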